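/- Let $\gamma=\gamma_1$ be the standard Gaussian measure on $\mathbb R$. For $|\rho|\le 1$ and measurable $f:\mathbb R\to[0,1]$ let $T_\rho f(x)=\int_{\mathbb R} f(x\rho+y\sqrt{1-\rho^2})\,d\gamma(y)$. Let $h_2(x)=(x^2-1)/2$ be the second Hermite polynomial, and let $B(0,r)=(-r,r)$. All sets and functions below are measurable. For $0<a,b<1$, a *centered pair* is a pair $(A,B)$ with $\gamma(A)=a$, $\gamma(B)=b$ such that, for some $r,s>0$, either $A=B(0,r)$ and $B=B(0,s)^c$, or $A=B(0,r)^c$ and $B=B(0,s)$. **Theorem.** (I) Let $0<a,b<1$ and $$|\rho|<\tfrac1{1000}\min\big(e^{-40},a^{20},(1-a)^{20},b^{20},(1-b)^{20}\big).$$ 1. (Symmetric Gaussian Problem in dimension 1.) Some centered pair $(A,B)$ attains the infimum of $\int_{\mathbb R}1_{A'}\,T_\rho 1_{B'}\,d\gamma$ over all $A',B'\subset\mathbb R$ with $\gamma(A')=a$, $\gamma(B')=b$, $A'=-A'$ and, if $\rho<0$, also $B'=-B'$. 2. There is a centered pair $(A,B)$ attaining $$\inf_{\substack{f,g:\mathbb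 R\to[0,1]\\ \int f d\gamma=a,\ \int g d\gamma=b}}\Big(\int_{\mathbb R} f\sqrt{2!}\,h_2\,d\gamma\Big)\Big(\int_{\mathbb R} g\sqrt{2!}\,h_2\,d\gamma\Big),\qquad(*)$$ that is, such that the product for $f=1_A$, $g=1_B$ equals this infimum. 3. Suppose $\rho\neq0$. Let $A',B'\subset\mathbb R$ satisfy $\gamma(A')=a$, $\gamma(B')=b$, $A'=-A'$ and, if $\rho<0$, also $B'=-B'$. Then $(1_{A'},1_{B'})$ attains the infimum of $\int_{\mathbb R} f\,T_\rho g\,d\gamma$ over all $f,g:\mathbb R\to[0,1]$ with $\int f d\gamma=a$, $\int g d\gamma=b$, $f$ even and, if $\rho<0$, also $g$ even, if and only if there is a centered pair $(A,B)$ attaining $(*)$ such that $A'=A$ and $B'=B$ up to $\gamma$-null sets. (II) (Quadratic version.) Let $0<a<1$ and $|\rho|<\tfrac1{1000}\min(e^{-40},a^{20},(1-a)^{20})$. Then there is a set $A$ with $\gamma(A)=a$, equal to $B(0,r)$ or to $B(0,r)^c$ for some $r>0$, which attains the supremum of $\int_{\mathbb R}1_{A'}T_\rho1_{A'}\,d\gamma$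 over all $A'\subset\mathbb R$ with $\gamma(A')=a$ and $A'=-A'$. -/

import Mathlib

namespace SymmNoise

open MeasureTheory ProbabilityTheory

noncomputable section

/-- The standard Gaussian measure on the real line. -/
abbrev gamma1 : Measure ℝ := gaussianReal 0 1

/-- The indicator function of a set, with real values. -/
def ind (A : Set ℝ) : ℝ → ℝ := A.indicator (fun _ => (1 : ℝ))

/-- The Ornstein-Uhlenbeck operator `T_ρ` with correlation `ρ`. -/
def ouOp (ρ : ℝ) (f : ℝ → ℝ) (x : ℝ) : ℝ :=
  ∫ y, f (x * ρ + y * Real.sqrt (1 - ρ ^ 2)) ∂gamma1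

/-- The bilinear noise functional `∫ f(x) T_ρ g(x) dγ(x)`. -/
def noise (ρ : ℝ) (f g : ℝ → ℝ) : ℝ := ∫ x, f x * ouOp ρ g x ∂gamma1

/-- The Hermite polynomials `h_l` with `exp (t x - t ^ 2 / 2) = ∑ t ^ l h_l(x)`, that is,
`h_l = He_l / l!` for the (monic) probabilists' Hermite polynomial `He_l`. -/
def hermiteFn (l : ℕ) (x : ℝ) : ℝ :=
  Polynomial.aeval x (Polynomial.hermite l) / (Nat.factorial l : ℝ)

/-- The Hermite-Fourier coefficient `∫ f √(l!) h_l dγ`. -/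
def hermiteCoeff (l : ℕ) (f : ℝ → ℝ) : ℝ :=
  ∫ x, f x * (Real.sqrt (Nat.factorial l : ℝ) * hermiteFn l x) ∂gamma1

/-- Measurable sets of Gaussian measure `a`. -/
def SetClass (a : ℝ) (A : Set ℝ) : Prop := MeasurableSet A ∧ gamma1.real A = a

/-- Measurable functions with values in `[0,1]` and Gaussian integral `a`. -/
def FunClass (a : ℝ) (f : ℝ → ℝ) : Prop :=
  Measurable f ∧ (∀ x, 0 ≤ f x ∧ f x ≤ 1) ∧ ∫ x, f x ∂gamma1 = a

/-- The pairs of sets competing in the symmetric Gaussian problem: `A` is symmetric, and `B` is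
required to be symmetric only for negative correlation. -/
def AdmissibleSets (ρ a b : ℝ) (A B : Set ℝ) : Prop :=
  SetClass a A ∧ SetClass b B ∧ (∀ x, -x ∈ A ↔ x ∈ A) ∧ (ρ < 0 → ∀ x, -x ∈ B ↔ x ∈ B)

/-- The pairs of functions competing in the relaxed symmetric Gaussian problem. -/
def AdmissibleFuns (ρ a b : ℝ) (f g : ℝ → ℝ) : Prop :=
  FunClass a f ∧ FunClass b g ∧ (∀ x, f (-x) = f x) ∧ (ρ < 0 → ∀ x, g (-x) = g x)

/-- `(A, B)` attains the infimum of the noise functional over all admissible pairs of sets. -/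
def MinimizesOverSets (ρ a b : ℝ) (A B : Set ℝ) : Prop :=
  AdmissibleSets ρ a b A B ∧
    IsLeast {v | ∃ A' B', AdmissibleSets ρ a b A' B' ∧ v = noise ρ (ind A') (ind B')}
      (noise ρ (ind A) (ind B))

/-- `(A, B)` is an admissible pair of sets and attains the infimum of the noise functional over
all admissible pairs of functions. -/
def MinimizesOverFuns (ρ a b : ℝ) (A B : Set ℝ) : Prop :=
  AdmissibleSets ρ a b A B ∧
    IsLeast {v | ∃ f g, AdmissibleFuns ρ a b f g ∧ v = noise ρ f g}
      (noise ρ (ind A) (ind B))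

/-- One of the sets `A`, `B` is a centered open interval, the other one is the complement of a
centered open interval, and their Gaussian measures are `a` and `b`. -/
def CenteredPair (a b : ℝ) (A B : Set ℝ) : Prop :=
  gamma1.real A = a ∧ gamma1.real B = b ∧
    ∃ r > 0, ∃ s > 0,
      (A = Metric.ball (0 : ℝ) r ∧ B = (Metric.ball (0 : ℝ) s)ᶜ) ∨
      (A = (Metric.ball (0 : ℝ) r)ᶜ ∧ B = Metric.ball (0 : ℝ) s)

/-- `(A, B)` attains the infimum of the product of the Hermite-Fourier coefficients of degree two
over all pairs of `[0,1]`-valued functions with integrals `a` and `b`. -/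
def MinimizesSecondOrder (a b : ℝ) (A B : Set ℝ) : Prop :=
  IsLeast {v | ∃ f g, FunClass a f ∧ FunClass b g ∧ v = hermiteCoeff 2 f * hermiteCoeff 2 g}
    (hermiteCoeff 2 (ind A) * hermiteCoeff 2 (ind B))

/-- The one-dimensional symmetric Gaussian problem has the expected answer: one of the two
centered pairs of measures `a`, `b` attains the infimum. -/
def SymmetricGaussianProblem (ρ a b : ℝ) : Prop :=
  ∃ A B, CenteredPair a b A B ∧ MinimizesOverSets ρ a b A B

/-- The quadratic version: the centered interval of measure `a`, or the complement of a centered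
interval with this measure, attains the supremum of the noise stability among the symmetric sets of
measure `a`. -/
def QuadraticSymmetricGaussianProblem (ρ a : ℝ) : Prop :=
  ∃ A, gamma1.real A = a ∧
    (∃ r > 0, A = Metric.ball (0 : ℝ) r ∨ A = (Metric.ball (0 : ℝ) r)ᶜ) ∧
    IsGreatest {v | ∃ A', SetClass a A' ∧ (∀ x, -x ∈ A' ↔ x ∈ A') ∧
      v = noise ρ (ind A') (ind A')} (noise ρ (ind A) (ind A))

end

end SymmNoise

/-! For even `f` the kernel of the noise form may be averaged over `x ↦ -x`. The averaged Mehler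
kernel is even in each variable and expands as `1 + (ρ² / 2) (x² - 1) (y² - 1) + O(ρ⁴)`. With the
masses fixed, the leading nonconstant part of the noise is therefore `ρ² / 2` times the product of
the two degree-two coefficients. By the bathtub principle each coefficient is extremal exactly at a
centered interval or its complement (a cap), so a centered pair minimizes the product: this is
`CapPairs.second_order_lower`. The rest shows that the `O(ρ⁴)` term does not disturb this answer.

Localization. If a competitor does at least as well as the best centered pair, `second_order_gap`
puts its coefficient product within `O(ρ²)` of the optimum. The excess in the bathtub principle is
an integral of the deviation weighted by the distance to the boundary (`IsCap.excess`), so it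
controls the `L¹` distance to a cap (`integral_abs_le_of_excess`). The competitor is thus
`O(ρ)`-close in `L¹`, with constants depending on the masses, to one of the two centered pairs. The
sign of the second coefficient of `f` tells to which.

Local optimality. Write the competitor as a pair of caps plus deviations `φ`, `ψ` of mean zero. The
smoothed indicator of an interval is strictly decreasing in `|x|` at rate of order `ρ²`, so the
first variation has a favourable sign and size about `ρ²` times the deviation weighted by `min |x² -
r²| 1` (`cap_first_variation`). For the cross term, mean zero allows the kernel to be replaced by
its second mixed difference, of size `ρ² |x² - r²| |y² - s²|`. This bounds the cross term by the
same weighted deviations times a factor that is small for `L¹`-small deviations (`cross_term_le`).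
The first variation wins (`cap_pair_local`), strictly unless both deviations vanish almost
everywhere.

Choice between the two pairs. It remains to see that noise and coefficient product order the two
centered pairs alike. With `n` the map from mass to `r φ(r)`, the products are compared through the
monotone ratio `n t / n (1 - t)`. The gap is at least a multiple of `p³ |a - b|`, where `p` bounds
all the masses `a, 1 - a, b, 1 - b` from below, while the remainders differ by at most a multiple of
`ρ⁴ |a - b| / p` (`cap_pairs_compare`). Both are linear in `|a - b|`, so smallness of `ρ` in terms
of `p` suffices even when `a` is close to `b`.

The quadratic version uses the same local analysis with two caps of equal type, which makes the pair
a local maximum instead. -/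

namespace SymmNoise

open MeasureTheory ProbabilityTheory

noncomputable section

/-! ### The even Mehler kernel: symmetries and growth. -/

/-- The Mehler kernel of correlation `ρ`, symmetrised under `x ↦ -x`. -/
def mehlerEven (ρ x y : ℝ) : ℝ :=
  Real.exp (-(ρ ^ 2 / (2 * (1 - ρ ^ 2)) * (x ^ 2 + y ^ 2))) *
    Real.cosh (ρ / (1 - ρ ^ 2) * (x * y)) / Real.sqrt (1 - ρ ^ 2)

theorem mehlerEven_comm (ρ x y : ℝ) : mehlerEven ρ x y = mehlerEven ρ y x := by
  unfold mehlerEven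
  rw [add_comm (x ^ 2), mul_comm x y]

theorem mehlerEven_abs_left (ρ x y : ℝ) : mehlerEven ρ |x| y = mehlerEven ρ x y := by
  rcases abs_choice x with h | h <;> rw [h]
  simp [mehlerEven]

theorem mehlerEven_abs_right (ρ x y : ℝ) : mehlerEven ρ x |y| = mehlerEven ρ x y := by
  rw [mehlerEven_comm, mehlerEven_abs_left, mehlerEven_comm]

theorem continuous_mehlerEven (ρ : ℝ) :
    Continuous fun z : ℝ × ℝ => mehlerEven ρ z.1 z.2 := by
  unfold mehlerEven
  have := Real.continuous_cosh
  fun_prop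

theorem mehlerEven_nonneg (ρ x y : ℝ) : 0 ≤ mehlerEven ρ x y := by
  unfold mehlerEven
  have := Real.cosh_pos (ρ / (1 - ρ ^ 2) * (x * y))
  positivity

theorem cosh_mul_le_exp (ν x y : ℝ) :
    Real.cosh (ν * (x * y)) ≤ Real.exp (|ν| / 2 * (x ^ 2 + y ^ 2)) := by
  have h1 : Real.cosh (ν * (x * y)) ≤ Real.exp |ν * (x * y)| := by
    rw [← Real.cosh_abs, Real.cosh_eq]
    have : Real.exp (-|ν * (x * y)|) ≤ Real.exp |ν * (x * y)| :=
      Real.exp_le_exp.2 (by linarith [abs_nonneg (ν * (x * y))])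
    linarith
  refine h1.trans (Real.exp_le_exp.2 ?_)
  rw [abs_mul]
  have h2 : |x * y| ≤ (x ^ 2 + y ^ 2) / 2 := by
    rw [abs_mul]
    nlinarith [sq_nonneg (|x| - |y|), sq_abs x, sq_abs y]
  nlinarith [abs_nonneg ν]

/-- For `t ≥ 0` the function `t cosh t - sinh t` vanishes at `0` and has derivative `t sinh t ≥ 0`.
-/
theorem abs_sinh_le (u : ℝ) : |Real.sinh u| ≤ |u| * Real.cosh u := by
  have key : ∀ t : ℝ, 0 ≤ t → Real.sinh t ≤ t * Real.cosh t := by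
    intro t ht
    have hm : MonotoneOn (fun t => t * Real.cosh t - Real.sinh t) (Set.Ici 0) := by
      refine monotoneOn_of_deriv_nonneg (convex_Ici 0) ?_ ?_ ?_
      · have := Real.continuous_cosh
        have := Real.continuous_sinh
        fun_prop
      · intro x _
        exact (((hasDerivAt_id x).mul (Real.hasDerivAt_cosh x)).sub
          (Real.hasDerivAt_sinh x)).differentiableAt.differentiableWithinAt
      · intro x hx
        rw [interior_Ici] at hx
        have h := (((hasDerivAt_id x).mul (Real.hasDerivAt_cosh x)).sub
          (Real.hasDerivAt_sinh x)).deriv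
        have h2 : deriv (fun t => t * Real.cosh t - Real.sinh t) x
            = 1 * Real.cosh x + x * Real.sinh x - Real.cosh x := h
        rw [h2]
        have := Real.sinh_nonneg_iff.2 (le_of_lt hx)
        have hx' : 0 < x := hx
        nlinarith [mul_nonneg hx'.le this]
    have := hm (Set.mem_Ici.2 le_rfl) (Set.mem_Ici.2 ht) ht
    simp at this
    linarith
  rw [Real.abs_sinh, ← Real.cosh_abs]
  exact key _ (abs_nonneg u)

/-- Elementary consequences of the smallness of the correlation. -/
theorem small_corr {ρ : ℝ} (h : |ρ| ≤ 1 / 1000) :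
    ρ ^ 2 ≤ 1 / 1000000 ∧ 0 < 1 - ρ ^ 2 ∧ (1 - ρ ^ 2)⁻¹ ≤ 1 + 2 * ρ ^ 2 ∧
      (Real.sqrt (1 - ρ ^ 2))⁻¹ ≤ 1 + ρ ^ 2 := by
  have h1 : ρ ^ 2 ≤ 1 / 1000000 := by
    rw [← sq_abs]; nlinarith [abs_nonneg ρ]
  have h2 : 0 < 1 - ρ ^ 2 := by linarith
  refine ⟨h1, h2, ?_, ?_⟩
  · rw [inv_le_iff_one_le_mul₀ h2]
    nlinarith [sq_nonneg ρ]
  · have h3 : 1 - ρ ^ 2 / 2 - ρ ^ 4 / 2  ≤ Real.sqrt (1 - ρ ^ 2) := by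
      apply Real.le_sqrt_of_sq_le
      nlinarith [sq_nonneg ρ, mul_nonneg (sq_nonneg ρ) (sq_nonneg ρ),
        mul_nonneg (mul_nonneg (sq_nonneg ρ) (sq_nonneg ρ)) (sq_nonneg ρ),
        mul_nonneg (mul_nonneg (sq_nonneg ρ) (sq_nonneg ρ)) (sub_nonneg.2 h1)]
    have h4 : 0 < Real.sqrt (1 - ρ ^ 2) := Real.sqrt_pos.2 h2
    rw [inv_le_iff_one_le_mul₀ h4]
    nlinarith [sq_nonneg ρ, mul_nonneg (sq_nonneg ρ) (sq_nonneg ρ),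
        mul_nonneg (mul_nonneg (sq_nonneg ρ) (sq_nonneg ρ)) (sub_nonneg.2 h1)]

theorem mehlerEven_le {ρ : ℝ} (h : |ρ| ≤ 1 / 1000) (x y : ℝ) :
    mehlerEven ρ x y ≤ 2 * Real.exp (x ^ 2 / 8) * Real.exp (y ^ 2 / 8) := by
  obtain ⟨h1, h2, h3, h4⟩ := small_corr h
  unfold mehlerEven
  rw [div_eq_mul_inv]
  have e1 : Real.exp (-(ρ ^ 2 / (2 * (1 - ρ ^ 2)) * (x ^ 2 + y ^ 2))) ≤ 1 := by
    rw [Real.exp_le_one_iff]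
    have : 0 ≤ ρ ^ 2 / (2 * (1 - ρ ^ 2)) * (x ^ 2 + y ^ 2) := by positivity
    linarith
  have e2 : Real.cosh (ρ / (1 - ρ ^ 2) * (x * y)) ≤
      Real.exp (x ^ 2 / 8) * Real.exp (y ^ 2 / 8) := by
    refine (cosh_mul_le_exp _ _ _).trans ?_
    rw [← Real.exp_add]
    refine Real.exp_le_exp.2 ?_
    have : |ρ / (1 - ρ ^ 2)| ≤ 1 / 4 := by
      rw [abs_div, abs_of_pos h2, div_le_iff₀ h2]; linarith
    nlinarith [sq_nonneg x, sq_nonneg y]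
  have e3 : (Real.sqrt (1 - ρ ^ 2))⁻¹ ≤ 2 := by linarith
  calc _ ≤ (1 * (Real.exp (x ^ 2 / 8) * Real.exp (y ^ 2 / 8))) * 2 := by
        gcongr
    _ = _ := by ring

/-! ### Second mixed differences of the even Mehler kernel. -/

/-- A mean value inequality in the variable `t²`: both `M t² - g` and `M t² + g` are monotone
between `r` and `x`. Measuring increments by squares suits even functions, whose derivative vanishes
at `0`. -/
theorem abs_sub_le_of_deriv_le {g g' : ℝ → ℝ} (hg : ∀ t, HasDerivAt g (g' t) t) {x r M : ℝ}
    (hx : 0 ≤ x) (hr : 0 ≤ r)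
    (hM : ∀ t, 0 ≤ t → t ≤ max x r → |g' t| ≤ M * (2 * t)) :
    |g x - g r| ≤ M * |x ^ 2 - r ^ 2| := by
  have key : ∀ x r : ℝ, 0 ≤ r → r ≤ x → (∀ t, 0 ≤ t → t ≤ x → |g' t| ≤ M * (2 * t)) →
      |g x - g r| ≤ M * (x ^ 2 - r ^ 2) := by
    intro x r hr hrx hM
    have hsq : ∀ t : ℝ, HasDerivAt (fun t => M * t ^ 2) (M * (2 * t)) t := fun t => by
      simpa using (hasDerivAt_pow 2 t).const_mul M
    have m1 : MonotoneOn (fun t => M * t ^ 2 - g t) (Set.Icc r x) := by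
      refine monotoneOn_of_deriv_nonneg (convex_Icc r x) ?_ ?_ ?_
      · exact fun t _ => ((hsq t).sub (hg t)).continuousAt.continuousWithinAt
      · exact fun t _ => ((hsq t).sub (hg t)).differentiableAt.differentiableWithinAt
      · intro t ht
        rw [interior_Icc] at ht
        have := ((hsq t).sub (hg t)).deriv
        change 0 ≤ deriv ((fun t => M * t ^ 2) - g) t
        rw [this]
        have := (abs_le.1 (hM t (hr.trans ht.1.le) ht.2.le)).2
        linarith
    have m2 : MonotoneOn (fun t => M * t ^ 2 + g t) (Set.Icc r x) := by
      refine monotoneOn_of_deriv_nonneg (convex_Icc r x) ?_ ?_ ?_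
      · exact fun t _ => ((hsq t).add (hg t)).continuousAt.continuousWithinAt
      · exact fun t _ => ((hsq t).add (hg t)).differentiableAt.differentiableWithinAt
      · intro t ht
        rw [interior_Icc] at ht
        have := ((hsq t).add (hg t)).deriv
        change 0 ≤ deriv ((fun t => M * t ^ 2) + g) t
        rw [this]
        have := (abs_le.1 (hM t (hr.trans ht.1.le) ht.2.le)).1
        linarith
    have i1 := m1 (Set.left_mem_Icc.2 hrx) (Set.right_mem_Icc.2 hrx) hrx
    have i2 := m2 (Set.left_mem_Icc.2 hrx) (Set.right_mem_Icc.2 hrx) hrx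
    simp only at i1 i2
    rw [abs_le]
    constructor <;> linarith
  rcases le_total r x with h | h
  · rw [abs_of_nonneg (a := x ^ 2 - r ^ 2) (by nlinarith)]
    exact key x r hr h (fun t h0 h1 => hM t h0 (h1.trans (le_max_left _ _)))
  · rw [abs_sub_comm, abs_sub_comm (x ^ 2), abs_of_nonneg (a := r ^ 2 - x ^ 2) (by nlinarith)]
    exact key r x hx h (fun t h0 h1 => hM t h0 (h1.trans (le_max_right _ _)))

/-- The left side is the absolute mixed partial derivative of `exp (-l (t² + u²)) cosh (ν t u)`.
Since `|sinh|` carries a factor `t u`, every term does, and the growth of `1 + 2 z` is absorbed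
through `exp (-z) (1 + 2 z) ≤ 2`. -/
theorem abs_mixed_deriv_le {l ν t u M : ℝ} (hl0 : 0 ≤ l) (ht : 0 ≤ t) (hu : 0 ≤ u)
    (hc : Real.cosh (ν * (t * u)) ≤ M) :
    Real.exp (-(l * (t ^ 2 + u ^ 2))) * |(4 * l ^ 2 + ν ^ 2) * (t * u) * Real.cosh (ν * (t * u)) +
      ν * (1 - 2 * l * (t ^ 2 + u ^ 2)) * Real.sinh (ν * (t * u))| ≤
      (t * u) * M * (4 * l ^ 2 + 3 * ν ^ 2) := by
  have htu : 0 ≤ t * u := mul_nonneg ht hu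
  have hc0 := Real.cosh_pos (ν * (t * u))
  have hM0 : 0 ≤ M := hc0.le.trans hc
  have hsh : |Real.sinh (ν * (t * u))| ≤ |ν| * (t * u) * Real.cosh (ν * (t * u)) := by
    have := abs_sinh_le (ν * (t * u))
    rwa [abs_mul, abs_of_nonneg htu] at this
  set z := l * (t ^ 2 + u ^ 2) with hz
  have hz0 : 0 ≤ z := by positivity
  have hez : Real.exp (-z) * (1 + 2 * z) ≤ 2 := by
    rw [Real.exp_neg, inv_mul_le_iff₀ (Real.exp_pos z)]
    linarith [Real.add_one_le_exp z]
  have hez1 : Real.exp (-z) ≤ 1 := Real.exp_le_one_iff.2 (by linarith)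
  have hb : |(4 * l ^ 2 + ν ^ 2) * (t * u) * Real.cosh (ν * (t * u)) +
      ν * (1 - 2 * l * (t ^ 2 + u ^ 2)) * Real.sinh (ν * (t * u))| ≤
      (t * u) * Real.cosh (ν * (t * u)) * ((4 * l ^ 2 + ν ^ 2) + ν ^ 2 * (1 + 2 * z)) := by
    refine (abs_add_le _ _).trans ?_
    have e1 : |(4 * l ^ 2 + ν ^ 2) * (t * u) * Real.cosh (ν * (t * u))| =
      (4 * l ^ 2 + ν ^ 2) * (t * u) * Real.cosh (ν * (t * u)) :=
        abs_of_nonneg (by positivity)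
    have e2 : |ν * (1 - 2 * l * (t ^ 2 + u ^ 2)) * Real.sinh (ν * (t * u))| ≤
        |ν| * (1 + 2 * z) * (|ν| * (t * u) * Real.cosh (ν * (t * u))) := by
      rw [abs_mul, abs_mul]
      gcongr
      rw [abs_le]
      constructor <;> nlinarith
    rw [e1]
    have : |ν| * (1 + 2 * z) * (|ν| * (t * u) * Real.cosh (ν * (t * u))) =
      ν ^ 2 * (1 + 2 * z) * (t * u) * Real.cosh (ν * (t * u)) := by
        rw [← sq_abs ν]; ring
    nlinarith
  calc _ ≤ Real.exp (-z) * ((t * u) * Real.cosh (ν * (t * u)) *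
      ((4 * l ^ 2 + ν ^ 2) + ν ^ 2 * (1 + 2 * z))) := by gcongr
    _ = (t * u) * Real.cosh (ν * (t * u)) * (Real.exp (-z) * (4 * l ^ 2 + ν ^ 2) +
        ν ^ 2 * (Real.exp (-z) * (1 + 2 * z))) := by ring
    _ ≤ (t * u) * M * (1 * (4 * l ^ 2 + ν ^ 2) + ν ^ 2 * 2) := by gcongr
    _ = _ := by ring

theorem hasDerivAt_mehlerEven (ρ y t : ℝ) :
    HasDerivAt (fun x => mehlerEven ρ x y)
      (Real.exp (-(ρ ^ 2 / (2 * (1 - ρ ^ 2)) * (t ^ 2 + y ^ 2))) *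
        (ρ / (1 - ρ ^ 2) * y * Real.sinh (ρ / (1 - ρ ^ 2) * (t * y)) -
        2 * (ρ ^ 2 / (2 * (1 - ρ ^ 2))) * t * Real.cosh (ρ / (1 - ρ ^ 2) * (t * y))) /
          Real.sqrt (1 - ρ ^ 2)) t := by
  unfold mehlerEven
  generalize ρ ^ 2 / (2 * (1 - ρ ^ 2)) = l
  generalize ρ / (1 - ρ ^ 2) = ν
  have h1 : HasDerivAt (fun x : ℝ => -(l * (x ^ 2 + y ^ 2))) (-(l * (2 * t))) t := by
    simpa using (((hasDerivAt_pow 2 t).add_const (y ^ 2)).const_mul l).fun_neg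
  have h2 : HasDerivAt (fun x : ℝ => ν * (x * y)) (ν * y) t := by
    simpa using ((hasDerivAt_id t).mul_const y).const_mul ν
  refine ((h1.exp.fun_mul h2.cosh).div_const (Real.sqrt (1 - ρ ^ 2))).congr_deriv ?_
  ring

/-- The second mixed difference of the even Mehler kernel. -/
theorem abs_mixed_difference_le {ρ : ℝ} (h : |ρ| ≤ 1 / 1000) {r s : ℝ} (hr : 0 ≤ r) (hs : 0 ≤ s)
    (x y : ℝ) :
    |mehlerEven ρ x y - mehlerEven ρ x s - mehlerEven ρ r y + mehlerEven ρ r s| ≤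
      ρ ^ 2 * |x ^ 2 - r ^ 2| * |y ^ 2 - s ^ 2| *
        Real.exp (|ρ| * (x ^ 2 + r ^ 2 + y ^ 2 + s ^ 2)) := by
  have key : ∀ x y : ℝ, 0 ≤ x → 0 ≤ y →
    |mehlerEven ρ x y - mehlerEven ρ x s - mehlerEven ρ r y + mehlerEven ρ r s| ≤
      ρ ^ 2 * |x ^ 2 - r ^ 2| * |y ^ 2 - s ^ 2| *
        Real.exp (|ρ| * (x ^ 2 + r ^ 2 + y ^ 2 + s ^ 2)) := by
    clear x y
    intro x y hx hy
    obtain ⟨h1, h2, h3, h4⟩ := small_corr h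
    set M := Real.exp (|ρ| * (x ^ 2 + r ^ 2 + y ^ 2 + s ^ 2)) with hM
    have hsq : 0 < Real.sqrt (1 - ρ ^ 2) := Real.sqrt_pos.2 h2
    -- The mixed partial is at most `ρ² M (2 t) (2 u)`, so integrating in `u` and then in `t`, each
    -- time in the squared variable, yields the product of the two differences of squares.
    have inner : ∀ t, 0 ≤ t → t ≤ max x r → ∀ u, 0 ≤ u → u ≤ max y s →
        |Real.exp (-(ρ ^ 2 / (2 * (1 - ρ ^ 2)) * (t ^ 2 + u ^ 2))) *
        ((4 * (ρ ^ 2 / (2 * (1 - ρ ^ 2))) ^ 2 + (ρ / (1 - ρ ^ 2)) ^ 2) * (t * u) *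
            Real.cosh (ρ / (1 - ρ ^ 2) * (t * u)) +
          (ρ / (1 - ρ ^ 2)) * (1 - 2 * (ρ ^ 2 / (2 * (1 - ρ ^ 2))) * (t ^ 2 + u ^ 2)) *
            Real.sinh (ρ / (1 - ρ ^ 2) * (t * u))) / Real.sqrt (1 - ρ ^ 2)|
          ≤ 2 * ρ ^ 2 * M * t * (2 * u) := by
      intro t ht htx u hu huy
      have hl0 : 0 ≤ ρ ^ 2 / (2 * (1 - ρ ^ 2)) := by positivity
      have hl : ρ ^ 2 / (2 * (1 - ρ ^ 2)) ≤ ρ ^ 2 := by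
        rw [div_le_iff₀ (by positivity)]; nlinarith [sq_nonneg ρ]
      have hν : (ρ / (1 - ρ ^ 2)) ^ 2 ≤ 1.01 * ρ ^ 2 := by
        rw [div_pow, div_le_iff₀ (by positivity)]
        nlinarith [sq_nonneg ρ, mul_nonneg (sq_nonneg ρ) (sub_nonneg.2 h1)]
      have hνa : |ρ / (1 - ρ ^ 2)| / 2 ≤ |ρ| := by
        rw [abs_div, abs_of_pos h2, div_div, div_le_iff₀ (by positivity)]
        nlinarith [abs_nonneg ρ]
      generalize ρ ^ 2 / (2 * (1 - ρ ^ 2)) = l at *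
      generalize ρ / (1 - ρ ^ 2) = ν at *
      have hc : Real.cosh (ν * (t * u)) ≤ M := by
        refine (cosh_mul_le_exp _ _ _).trans (Real.exp_le_exp.2 ?_)
        have ht2 : t ^ 2 ≤ x ^ 2 + r ^ 2 := by
          rcases le_max_iff.1 htx with h | h <;> nlinarith [sq_nonneg x, sq_nonneg r]
        have hu2 : u ^ 2 ≤ y ^ 2 + s ^ 2 := by
          rcases le_max_iff.1 huy with h | h <;> nlinarith [sq_nonneg y, sq_nonneg s]
        calc |ν| / 2 * (t ^ 2 + u ^ 2) ≤ |ρ| * (t ^ 2 + u ^ 2) := by gcongr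
          _ ≤ |ρ| * (x ^ 2 + r ^ 2 + (y ^ 2 + s ^ 2)) := by gcongr
          _ = _ := by ring
      have step := abs_mixed_deriv_le hl0 ht hu hc
      rw [abs_div, abs_mul, abs_of_pos (Real.exp_pos _), abs_of_pos hsq, div_eq_mul_inv]
      have hA : (Real.sqrt (1 - ρ ^ 2))⁻¹ ≤ 1.01 := by linarith
      have hcoef : (4 * l ^ 2 + 3 * ν ^ 2) * 1.01 ≤ 4 * ρ ^ 2 := by
        have : l ^ 2 ≤ ρ ^ 2 * (1 / 1000000) := by nlinarith
        nlinarith [sq_nonneg ρ]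
      calc _ ≤ (t * u) * M * (4 * l ^ 2 + 3 * ν ^ 2) * 1.01 := by gcongr
        _ = (t * u) * M * ((4 * l ^ 2 + 3 * ν ^ 2) * 1.01) := by ring
        _ ≤ (t * u) * M * (4 * ρ ^ 2) := by gcongr
        _ = _ := by ring
    have outer := abs_sub_le_of_deriv_le
      (g := fun x => mehlerEven ρ x y - mehlerEven ρ x s)
      (fun t => (hasDerivAt_mehlerEven ρ y t).sub (hasDerivAt_mehlerEven ρ s t)) hx hr
      (M := ρ ^ 2 * M * |y ^ 2 - s ^ 2|) ?_
    · calc _ = |mehlerEven ρ x y - mehlerEven ρ x s - (mehlerEven ρ r y - mehlerEven ρ r s)| := by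
            congr 1; ring
        _ ≤ _ := outer
        _ = _ := by ring
    · intro t ht htx
      have hd : ∀ u, HasDerivAt (fun y => Real.exp (-(ρ ^ 2 / (2 * (1 - ρ ^ 2)) * (t ^ 2 + y ^ 2))) *
        (ρ / (1 - ρ ^ 2) * y * Real.sinh (ρ / (1 - ρ ^ 2) * (t * y)) -
        2 * (ρ ^ 2 / (2 * (1 - ρ ^ 2))) * t * Real.cosh (ρ / (1 - ρ ^ 2) * (t * y))) /
          Real.sqrt (1 - ρ ^ 2)) (Real.exp (-(ρ ^ 2 / (2 * (1 - ρ ^ 2)) * (t ^ 2 + u ^ 2))) *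
        ((4 * (ρ ^ 2 / (2 * (1 - ρ ^ 2))) ^ 2 + (ρ / (1 - ρ ^ 2)) ^ 2) * (t * u) *
            Real.cosh (ρ / (1 - ρ ^ 2) * (t * u)) +
          (ρ / (1 - ρ ^ 2)) * (1 - 2 * (ρ ^ 2 / (2 * (1 - ρ ^ 2))) * (t ^ 2 + u ^ 2)) *
            Real.sinh (ρ / (1 - ρ ^ 2) * (t * u))) / Real.sqrt (1 - ρ ^ 2)) u := by
        intro u
        generalize ρ ^ 2 / (2 * (1 - ρ ^ 2)) = l
        generalize ρ / (1 - ρ ^ 2) = ν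
        have d1 : HasDerivAt (fun x : ℝ => -(l * (t ^ 2 + x ^ 2))) (-(l * (2 * u))) u := by
          simpa using (((hasDerivAt_pow 2 u).const_add (t ^ 2)).const_mul l).fun_neg
        have d2 : HasDerivAt (fun x : ℝ => ν * (t * x)) (ν * t) u := by
          simpa using ((hasDerivAt_id u).const_mul t).const_mul ν
        have d3 : HasDerivAt (fun x : ℝ => ν * x) ν u := by
          simpa using (hasDerivAt_id u).const_mul ν
        refine ((d1.exp.fun_mul ((d3.fun_mul d2.sinh).fun_sub
          (d2.cosh.const_mul (2 * l * t)))).div_const (Real.sqrt (1 - ρ ^ 2))).congr_deriv ?_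
        ring
      have := abs_sub_le_of_deriv_le hd hy hs (M := 2 * ρ ^ 2 * M * t) (inner t ht htx)
      refine this.trans (le_of_eq ?_)
      ring
  have := key |x| |y| (abs_nonneg x) (abs_nonneg y)
  simpa only [mehlerEven_abs_left, mehlerEven_abs_right, sq_abs] using this

/-! ### Second-order expansion of the even Mehler kernel. -/

theorem exp_neg_taylor {z : ℝ} (hz : 0 ≤ z) : |Real.exp (-z) - 1 + z| ≤ z ^ 2 := by
  have h1 := Real.add_one_le_exp (-z)
  rw [abs_of_nonneg (by linarith)]
  rcases le_total z 1 with h | h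
  · have h2 := Real.abs_exp_sub_one_sub_id_le (x := -z) (by rw [abs_neg, abs_of_nonneg hz]; exact h)
    rw [neg_sq] at h2
    linarith [(abs_le.1 h2).2]
  · have : Real.exp (-z) ≤ 1 := Real.exp_le_one_iff.2 (by linarith)
    nlinarith

/-- The half-angle formula `cosh t = 1 + 2 sinh² (t / 2)` reduces both signs to `t / 2 ≤ sinh (t /
2) ≤ (t / 2) cosh (t / 2)`. Keeping `cosh u` in the error makes the bound valid for all `u`. -/
theorem cosh_taylor (u : ℝ) : |Real.cosh u - 1 - u ^ 2 / 2| ≤ u ^ 4 * Real.cosh u := by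
  have hsq : ∀ t : ℝ, Real.cosh t = 1 + 2 * Real.sinh (t / 2) ^ 2 := by
    intro t
    have h := Real.cosh_two_mul (t / 2)
    have h2 := Real.cosh_sq (t / 2)
    rw [show 2 * (t / 2) = t by ring] at h
    linarith
  have key : ∀ t : ℝ, 0 ≤ t → Real.cosh t - 1 - t ^ 2 / 2 ≤ t ^ 4 * Real.cosh t ∧
      0 ≤ Real.cosh t - 1 - t ^ 2 / 2 := by
    intro t ht
    have c1 := Real.one_le_cosh t
    have s1 : t / 2 ≤ Real.sinh (t / 2) := Real.self_le_sinh_iff.2 (by linarith)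
    have s2 := (le_abs_self _).trans (abs_sinh_le (t / 2))
    rw [abs_of_nonneg (by linarith : 0 ≤ t / 2)] at s2
    have h2 := Real.cosh_sq (t / 2)
    have hc := hsq t
    constructor
    · have e1 : Real.sinh (t / 2) ^ 2 ≤ (t / 2) ^ 2 * Real.cosh (t / 2) ^ 2 := by
        rw [← mul_pow]; exact pow_le_pow_left₀ (by linarith) s2 2
      have e2 : Real.cosh (t / 2) ^ 2 ≤ Real.cosh t := by nlinarith
      have e3 : Real.cosh t - 1 - t ^ 2 / 2 ≤
          t ^ 2 / 2 * Real.sinh (t / 2) ^ 2 := by rw [hc]; nlinarith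
      have e4 : Real.sinh (t / 2) ^ 2 ≤ (t / 2) ^ 2 * Real.cosh t :=
        e1.trans (by gcongr)
      have e5 : t ^ 2 / 2 * Real.sinh (t / 2) ^ 2 ≤ t ^ 2 / 2 * ((t / 2) ^ 2 * Real.cosh t) := by
        gcongr
      have : 0 ≤ t ^ 4 * Real.cosh t := by positivity
      nlinarith
    · have : (t / 2) ^ 2 ≤ Real.sinh (t / 2) ^ 2 := pow_le_pow_left₀ (by linarith) s1 2
      nlinarith
  have h := key |u| (abs_nonneg u)
  rw [Real.cosh_abs, sq_abs, show |u| ^ 4 = u ^ 4 by rw [← abs_pow, abs_of_nonneg (by positivity)]] at h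
  rw [abs_of_nonneg h.2]
  exact h.1

theorem one_add_le_exp_tenth (X : ℝ) : 1 + X ≤ 10 * Real.exp (X / 10) := by
  have := Real.add_one_le_exp (X / 10)
  linarith [Real.exp_pos (X / 10)]

/-- Perturbation of a product of three factors to first order. -/
theorem triple_product_error {a b d a₁ b₁ d₁ h T B : ℝ} (ha : |a - 1 - a₁| ≤ h ^ 2)
    (hb : |b - 1 + b₁| ≤ 2 * h ^ 2 * T ^ 2) (hd : |d - 1 - d₁| ≤ 2 * h ^ 2 * T ^ 2 * B)
    (ha0 : 0 ≤ a) (ha2 : a ≤ 2) (hb0 : 0 ≤ b) (hb1 : b ≤ 1) (ha₁ : |a₁| ≤ h) (hb₁ : |b₁| ≤ h * T)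
    (hd₁ : |d₁| ≤ h * T) (hdB : 1 + |d₁| ≤ 2 * B) (hT : 1 ≤ T) (hB : 1 ≤ B) (hh : 0 ≤ h) (hh1 : h ≤ 1) :
    |a * b * d - (1 + a₁ - b₁ + d₁)| ≤ 20 * h ^ 2 * T ^ 2 * B := by
  -- An exact expansion in which each of the seven terms contains a remainder or a product of two
  -- first-order quantities, hence is of order `h²`.
  have e : a * b * d - (1 + a₁ - b₁ + d₁) = a * b * (d - 1 - d₁) + a * (b - 1 + b₁) * (1 + d₁)
      + (a - 1 - a₁) * (1 + d₁) - (a - 1 - a₁) * b₁ * (1 + d₁) 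
      - a₁ * b₁ * (1 + d₁) + a₁ * d₁ - b₁ * d₁ := by ring
  have hd1 : |1 + d₁| ≤ 2 * B := (abs_add_le _ _).trans (by simpa using hdB)
  have hTB : 1 ≤ T ^ 2 := by nlinarith
  have hb0' : |b₁| ≤ T := hb₁.trans (by nlinarith)
  have hT2 : T ≤ T ^ 2 := by nlinarith
  have t1 : |a * b * (d - 1 - d₁)| ≤ 2 * 1 * (2 * h ^ 2 * T ^ 2 * B) := by
    rw [abs_mul, abs_mul, abs_of_nonneg ha0, abs_of_nonneg hb0]; gcongr
  have t2 : |a * (b - 1 + b₁) * (1 + d₁)| ≤ 2 * (2 * h ^ 2 * T ^ 2) * (2 * B) := by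
    rw [abs_mul, abs_mul, abs_of_nonneg ha0]; gcongr
  have t3 : |(a - 1 - a₁) * (1 + d₁)| ≤ h ^ 2 * (2 * B) := by
    rw [abs_mul]; gcongr
  have t4 : |(a - 1 - a₁) * b₁ * (1 + d₁)| ≤ h ^ 2 * T * (2 * B) := by
    rw [abs_mul, abs_mul]; gcongr
  have t5 : |a₁ * b₁ * (1 + d₁)| ≤ h * (h * T) * (2 * B) := by
    rw [abs_mul, abs_mul]; gcongr
  have t6 : |a₁ * d₁| ≤ h * (h * T) := by rw [abs_mul]; gcongr
  have t7 : |b₁ * d₁| ≤ (h * T) * (h * T) := by rw [abs_mul]; gcongr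
  have q1 : h ^ 2 * B ≤ h ^ 2 * T ^ 2 * B := by
    have : 0 ≤ h ^ 2 * B := by positivity
    nlinarith
  have q2 : h ^ 2 * T * B ≤ h ^ 2 * T ^ 2 * B := by gcongr
  have q3 : h ^ 2 * T ^ 2 ≤ h ^ 2 * T ^ 2 * B := by
    have : 0 ≤ h ^ 2 * T ^ 2 := by positivity
    nlinarith
  have q4 : h ^ 2 * T ≤ h ^ 2 * T ^ 2 := by gcongr
  rw [e]
  rw [abs_le] at *
  constructor <;> linarith

theorem inv_sqrt_taylor {ρ : ℝ} (h1 : ρ ^ 2 ≤ 1 / 1000000) :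
    |(Real.sqrt (1 - ρ ^ 2))⁻¹ - 1 - ρ ^ 2 / 2| ≤ (ρ ^ 2) ^ 2 := by
  have h0 := sq_nonneg ρ
  generalize ρ ^ 2 = h at *
  have h2 : 0 < 1 - h := by linarith
  have l1 : 1 + h / 2 ≤ (Real.sqrt (1 - h))⁻¹ := by
    rw [le_inv_comm₀ (by positivity) (Real.sqrt_pos.2 h2)]
    apply Real.sqrt_le_iff.2 ⟨by positivity, ?_⟩
    rw [inv_pow, ← one_div, le_div_iff₀ (by positivity)]
    nlinarith [mul_nonneg h0 (sq_nonneg h), sq_nonneg h]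
  have l2 : (Real.sqrt (1 - h))⁻¹ ≤ 1 + h / 2 + h ^ 2 := by
    rw [inv_le_comm₀ (Real.sqrt_pos.2 h2) (by positivity)]
    apply Real.le_sqrt_of_sq_le
    rw [inv_pow, ← one_div, div_le_iff₀ (by positivity)]
    have e : (1 - h) * (1 + h / 2 + h ^ 2) ^ 2 = 1 + h ^ 2 * (5 / 4 - 5 / 4 * h - h ^ 3) := by ring
    rw [e]
    have : h ^ 3 ≤ h := by
      calc h ^ 3 ≤ h ^ 1 := pow_le_pow_of_le_one h0 (by linarith) (by norm_num)
        _ = _ := pow_one _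
    have : 0 ≤ 5 / 4 - 5 / 4 * h - h ^ 3 := by linarith
    have := mul_nonneg (sq_nonneg h) this
    linarith
  rw [abs_le]
  constructor <;> linarith [sq_nonneg h]

/-- Here `h` stands for `ρ²`, `l` for `ρ² / (2 (1 - ρ²))` and `S` for `x² + y²`. Replacing `l` by `h
/ 2` costs only `h² S`. -/
theorem exp_factor_taylor {h l S T : ℝ} (h0 : 0 ≤ h) (hl1 : h / 2 ≤ l) (hl2 : l ≤ h / 2 + h ^ 2)
    (hh : h ≤ 1 / 2) (hS : 0 ≤ S) (hST : S ≤ T) (hT : 1 ≤ T) :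
    |Real.exp (-(l * S)) - 1 + h * S / 2| ≤ 2 * h ^ 2 * T ^ 2 := by
  have hl0 : 0 ≤ l := by linarith
  have hlh : l ≤ h := by nlinarith
  have hz0 : 0 ≤ l * S := by positivity
  have e1 := exp_neg_taylor hz0
  have e2 : (l * S) ^ 2 ≤ h ^ 2 * T ^ 2 := by
    rw [← mul_pow]; exact pow_le_pow_left₀ hz0 (by gcongr) 2
  have hTT : T ≤ T ^ 2 := le_self_pow₀ hT two_ne_zero
  have e4 : (l - h / 2) * S ≤ h ^ 2 * T ^ 2 := by
    have : l - h / 2 ≤ h ^ 2 := by linarith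
    have : S ≤ T ^ 2 := hST.trans hTT
    gcongr
  have e5 : 0 ≤ (l - h / 2) * S := mul_nonneg (by linarith) hS
  rw [abs_le] at *
  constructor <;> linarith

/-- Here `u` stands for `ρ x y / (1 - ρ²)`, `h` for `ρ²` and `P` for `x² y²`. The bound `B` for
`cosh u` keeps the error uniform. -/
theorem cosh_factor_taylor {h u P T B : ℝ} (h0 : 0 ≤ h) (h1 : h ≤ 1 / 1000000) (hP : 0 ≤ P)
    (hu1 : h * P ≤ u ^ 2) (hu2 : u ^ 2 ≤ (h + 3 * h ^ 2) * P) (hPT : P ≤ T) (hT : 1 ≤ T)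
    (hPT2 : 2 * P ≤ T ^ 2) (hB : 1 ≤ B) (hc : Real.cosh u ≤ B) :
    |Real.cosh u - 1 - h * P / 2| ≤ 2 * h ^ 2 * T ^ 2 * B := by
  have e1 := cosh_taylor u
  have e2 : u ^ 2 ≤ 1.1 * h * T := by
    have : h + 3 * h ^ 2 ≤ 1.1 * h := by nlinarith
    exact hu2.trans (by gcongr)
  have hhT : 0 ≤ h ^ 2 * T ^ 2 := by positivity
  have e3 : u ^ 4 * Real.cosh u ≤ 1.25 * h ^ 2 * T ^ 2 * B := by
    have : u ^ 4 ≤ 1.25 * h ^ 2 * T ^ 2 := by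
      calc u ^ 4 = (u ^ 2) ^ 2 := by ring
        _ ≤ (1.1 * h * T) ^ 2 := pow_le_pow_left₀ (sq_nonneg u) e2 2
        _ = 1.21 * (h ^ 2 * T ^ 2) := by ring
        _ ≤ _ := by linarith
    gcongr
  have e5 : u ^ 2 / 2 - h * P / 2 ≤ 0.75 * (h ^ 2 * T ^ 2 * B) := by
    have : P ≤ T ^ 2 * B / 2 := by nlinarith [sq_nonneg T]
    calc _ ≤ (3 * h ^ 2 / 2) * P := by linarith
      _ ≤ (3 * h ^ 2 / 2) * (T ^ 2 * B / 2) := by gcongr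
      _ = _ := by ring
  rw [abs_le] at *
  constructor <;> linarith

/-- Second-order expansion of the even Mehler kernel in the correlation. -/
theorem abs_mehlerEven_sub_le {ρ : ℝ} (h : |ρ| ≤ 1 / 1000) (x y : ℝ) :
    |mehlerEven ρ x y - 1 - ρ ^ 2 / 2 * ((x ^ 2 - 1) * (y ^ 2 - 1))| ≤
      200000 * ρ ^ 4 * (Real.exp (x ^ 2 / 4) * Real.exp (y ^ 2 / 4)) := by
  obtain ⟨h1, h2, h3, h4⟩ := small_corr h
  have h0 := sq_nonneg ρ
  set X := x ^ 2 with hX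
  set Y := y ^ 2 with hY
  have hX0 : 0 ≤ X := sq_nonneg x
  have hY0 : 0 ≤ Y := sq_nonneg y
  -- `T` dominates all polynomial factors, and `B` dominates the hyperbolic cosine.
  set T := (1 + X) * (1 + Y) with hT
  set B := Real.exp ((X + Y) / 50) with hB
  have hXYT : X * Y ≤ T := by rw [hT]; nlinarith
  have hST : X + Y ≤ T := by rw [hT]; nlinarith [mul_nonneg hX0 hY0]
  have hXYT2 : 2 * (X * Y) ≤ T ^ 2 := by
    have h2T : 2 * (X * Y) ≤ T * T := by
      have : 1 + X * Y ≤ T := by rw [hT]; nlinarith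
      have := mul_nonneg hX0 hY0
      calc 2 * (X * Y) ≤ (1 + X * Y) * (1 + X * Y) := by nlinarith
        _ ≤ T * T := by gcongr
    rwa [sq]
  have hT1 : 1 ≤ T := by rw [hT]; nlinarith [mul_nonneg hX0 hY0]
  have hB1 : 1 ≤ B := Real.one_le_exp (by positivity)
  have hl : ρ ^ 2 / (2 * (1 - ρ ^ 2)) = ρ ^ 2 / 2 + ρ ^ 4 / (2 * (1 - ρ ^ 2)) := by
    field_simp; ring
  have hl' : ρ ^ 4 / (2 * (1 - ρ ^ 2)) ≤ ρ ^ 4 := by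
    rw [div_le_iff₀ (by positivity)]; nlinarith [sq_nonneg (ρ ^ 2)]
  have hl0 : 0 ≤ ρ ^ 4 / (2 * (1 - ρ ^ 2)) := by positivity
  have hv2 : (ρ / (1 - ρ ^ 2)) ^ 2 ≤ ρ ^ 2 + 3 * ρ ^ 4 := by
    rw [div_pow, div_le_iff₀ (by positivity)]
    have e : (ρ ^ 2 + 3 * ρ ^ 4) * (1 - ρ ^ 2) ^ 2 - ρ ^ 2 = ρ ^ 4 * (1 - ρ ^ 2 * (5 - 3 * ρ ^ 2)) := by
      ring
    have : 0 ≤ 1 - ρ ^ 2 * (5 - 3 * ρ ^ 2) := by linarith [sq_nonneg (ρ ^ 2)]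
    have : 0 ≤ ρ ^ 4 * (1 - ρ ^ 2 * (5 - 3 * ρ ^ 2)) := by positivity
    linarith
  have hv1 : ρ ^ 2 ≤ (ρ / (1 - ρ ^ 2)) ^ 2 := by
    rw [div_pow, le_div_iff₀ (by positivity)]
    have : (1 - ρ ^ 2) ^ 2 ≤ 1 := by nlinarith
    nlinarith
  have hva : |ρ / (1 - ρ ^ 2)| / 2 ≤ 1 / 50 := by
    rw [abs_div, abs_of_pos h2, div_div, div_le_iff₀ (by positivity)]
    nlinarith [abs_nonneg ρ]
  have hcB : Real.cosh (ρ / (1 - ρ ^ 2) * (x * y)) ≤ B := by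
    refine (cosh_mul_le_exp _ _ _).trans (Real.exp_le_exp.2 ?_)
    have : 0 ≤ X + Y := by positivity
    nlinarith
  have hxy : (x * y) ^ 2 = X * Y := by rw [hX, hY]; ring
  -- The first-order terms of the three factors add up to `(ρ² / 2) (X - 1) (Y - 1)`.
  have main : |(Real.sqrt (1 - ρ ^ 2))⁻¹ * Real.exp (-(ρ ^ 2 / (2 * (1 - ρ ^ 2)) * (X + Y))) *
      Real.cosh (ρ / (1 - ρ ^ 2) * (x * y)) -
      (1 + ρ ^ 2 / 2 - ρ ^ 2 * (X + Y) / 2 + ρ ^ 2 * (X * Y) / 2)| ≤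
        20 * (ρ ^ 2) ^ 2 * T ^ 2 * B := by
    have hh4 : (ρ ^ 2) ^ 2 = ρ ^ 4 := by ring
    apply triple_product_error
    · exact inv_sqrt_taylor h1
    · exact exp_factor_taylor h0 (by rw [hl]; linarith) (by rw [hl]; linarith) (by linarith)
        (by positivity) hST hT1
    · refine cosh_factor_taylor h0 h1 (mul_nonneg hX0 hY0) ?_ ?_ hXYT hT1 hXYT2 hB1 hcB
      · rw [mul_pow, hxy]; gcongr
      · rw [mul_pow, hxy, hh4]; gcongr
    · positivity
    · linarith
    · positivity
    · exact Real.exp_le_one_iff.2 (by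
        have : 0 ≤ ρ ^ 2 / (2 * (1 - ρ ^ 2)) * (X + Y) := by positivity
        linarith)
    · rw [abs_of_nonneg (by positivity)]; linarith
    · rw [abs_of_nonneg (by positivity)]
      have : ρ ^ 2 * (X + Y) ≤ ρ ^ 2 * T := by gcongr
      have : 0 ≤ ρ ^ 2 * (X + Y) := by positivity
      linarith
    · rw [abs_of_nonneg (by positivity)]
      have : ρ ^ 2 * (X * Y) ≤ ρ ^ 2 * T := by gcongr
      have : 0 ≤ ρ ^ 2 * (X * Y) := by positivity
      linarith
    · rw [abs_of_nonneg (by positivity)]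
      have : ρ ^ 2 * (X * Y) ≤ ((X + Y) / 50) ^ 2 := by
        calc ρ ^ 2 * (X * Y) ≤ 1 / 1000000 * (X * Y) := by
              gcongr
          _ ≤ _ := by linarith [mul_nonneg hX0 hY0, sq_nonneg X, sq_nonneg Y]
      have hq := Real.quadratic_le_exp_of_nonneg (x := (X + Y) / 50) (by positivity)
      have : 0 ≤ (X + Y) / 50 := by positivity
      linarith
    · exact hT1
    · exact hB1
    · exact h0
    · linarith
  -- From `1 + X ≤ 10 exp (X / 10)`, the square of `T` costs `10⁴` and exponent `1/5`. Together with
  -- the `1/50` from `B` this stays below `1/4`.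
  have hfin : T ^ 2 * B ≤ 10000 * (Real.exp (X / 4) * Real.exp (Y / 4)) := by
    have i1 := one_add_le_exp_tenth X
    have i2 := one_add_le_exp_tenth Y
    have : T ≤ 100 * Real.exp ((X + Y) / 10) := by
      rw [hT]
      calc (1 + X) * (1 + Y) ≤ (10 * Real.exp (X / 10)) * (10 * Real.exp (Y / 10)) := by gcongr
        _ = 100 * (Real.exp (X / 10) * Real.exp (Y / 10)) := by ring
        _ = _ := by rw [← Real.exp_add]; ring_nf
    calc T ^ 2 * B ≤ (100 * Real.exp ((X + Y) / 10)) ^ 2 * B := by gcongr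
      _ = 10000 * Real.exp ((X + Y) / 10 + (X + Y) / 10 + (X + Y) / 50) := by
        rw [hB, Real.exp_add, Real.exp_add]; ring
      _ ≤ 10000 * Real.exp (X / 4 + Y / 4) := by
        have : (X + Y) / 10 + (X + Y) / 10 + (X + Y) / 50 ≤ X / 4 + Y / 4 := by linarith
        exact mul_le_mul_of_nonneg_left (Real.exp_le_exp.2 this) (by norm_num)
      _ = _ := by rw [Real.exp_add]
  calc _ = |(Real.sqrt (1 - ρ ^ 2))⁻¹ * Real.exp (-(ρ ^ 2 / (2 * (1 - ρ ^ 2)) * (X + Y))) *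
      Real.cosh (ρ / (1 - ρ ^ 2) * (x * y)) -
      (1 + ρ ^ 2 / 2 - ρ ^ 2 * (X + Y) / 2 + ρ ^ 2 * (X * Y) / 2)| := by
        unfold mehlerEven
        congr 1
        rw [div_eq_mul_inv]
        ring
    _ ≤ 20 * ρ ^ 4 * (T ^ 2 * B) := by
        refine main.trans (le_of_eq ?_); ring
    _ ≤ 20 * ρ ^ 4 * (10000 * (Real.exp (X / 4) * Real.exp (Y / 4))) := by gcongr
    _ = _ := by ring

/-! ### Bilinear forms with kernels of moderate Gaussian growth. -/

/-- Measurable functions with absolute value at most one. -/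
def UnitBdd (f : ℝ → ℝ) : Prop := Measurable f ∧ ∀ x, |f x| ≤ 1

/-- Measurable kernels of moderate Gaussian growth. -/
def TameKernel (k : ℝ → ℝ → ℝ) : Prop :=
  Measurable (fun z : ℝ × ℝ => k z.1 z.2) ∧
    ∃ C, ∀ x y, |k x y| ≤ C * (Real.exp (x ^ 2 / 4) * Real.exp (y ^ 2 / 4))

/-- The bilinear form with kernel `k` with respect to the Gaussian measure. -/
def kernelForm (k : ℝ → ℝ → ℝ) (f g : ℝ → ℝ) : ℝ :=
  ∫ z, f z.1 * g z.2 * k z.1 z.2 ∂(gamma1.prod gamma1)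

theorem gamma1_pdf (x : ℝ) :
    gaussianPDFReal 0 1 x = (Real.sqrt (2 * Real.pi))⁻¹ * Real.exp (-(x ^ 2 / 2)) := by
  simp [gaussianPDFReal, neg_div]

theorem gaussian_exp_quarter :
    Integrable (fun x : ℝ => Real.exp (x ^ 2 / 4)) gamma1 ∧
      ∫ x, Real.exp (x ^ 2 / 4) ∂gamma1 ≤ 3 / 2 := by
  have e : ∀ x : ℝ, gaussianPDFReal 0 1 x • Real.exp (x ^ 2 / 4) =
      (Real.sqrt (2 * Real.pi))⁻¹ * Real.exp (-(1 / 4) * x ^ 2) := by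
    intro x
    rw [gamma1_pdf, smul_eq_mul, mul_assoc, ← Real.exp_add]
    ring_nf
  constructor
  · rw [gamma1, gaussianReal_of_var_ne_zero _ one_ne_zero, gaussianPDF_def,
      integrable_withDensity_iff_integrable_smul' (by fun_prop) (by simp)]
    have := (integrable_exp_neg_mul_sq (b := 1 / 4) (by norm_num)).const_mul
      (Real.sqrt (2 * Real.pi))⁻¹
    refine this.congr (Filter.Eventually.of_forall fun x => ?_)
    simp only
    rw [ENNReal.toReal_ofReal (gaussianPDFReal_nonneg _ _ _), e]
  · rw [gamma1, integral_gaussianReal_eq_integral_smul one_ne_zero]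
    simp_rw [e]
    rw [integral_const_mul, integral_gaussian, ← Real.sqrt_inv, ← Real.sqrt_mul (by positivity)]
    apply Real.sqrt_le_iff.2 ⟨by norm_num, ?_⟩
    -- The integral equals `√2`.
    have : (2 * Real.pi)⁻¹ * (Real.pi / (1 / 4)) = 2 := by
      field_simp; norm_num
    rw [this]; norm_num

theorem integrable_of_le_exp {h : ℝ → ℝ} (hm : Measurable h) {C : ℝ}
    (hC : ∀ x, |h x| ≤ C * Real.exp (x ^ 2 / 4)) : Integrable h gamma1 :=
  (gaussian_exp_quarter.1.const_mul C).mono' hm.aestronglyMeasurable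
    (Filter.Eventually.of_forall hC)

theorem UnitBdd.integrable {f : ℝ → ℝ} (hf : UnitBdd f) : Integrable f gamma1 :=
  Integrable.of_bound hf.1.aestronglyMeasurable 1 (Filter.Eventually.of_forall hf.2)

theorem UnitBdd.abs {f : ℝ → ℝ} (hf : UnitBdd f) : UnitBdd fun x => |f x| :=
  ⟨hf.1.abs, fun x => by rw [abs_abs]; exact hf.2 x⟩

theorem integrable_exp_prod :
    Integrable (fun z : ℝ × ℝ => Real.exp (z.1 ^ 2 / 4) * Real.exp (z.2 ^ 2 / 4))
      (gamma1.prod gamma1) :=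
  gaussian_exp_quarter.1.mul_prod gaussian_exp_quarter.1

theorem TameKernel.integrable {k : ℝ → ℝ → ℝ} (hk : TameKernel k) {f g : ℝ → ℝ} (hf : UnitBdd f)
    (hg : UnitBdd g) :
    Integrable (fun z : ℝ × ℝ => f z.1 * g z.2 * k z.1 z.2) (gamma1.prod gamma1) := by
  obtain ⟨hkm, C, hC⟩ := hk
  refine (integrable_exp_prod.const_mul C).mono' ?_ (Filter.Eventually.of_forall fun z => ?_)
  · exact (((hf.1.comp measurable_fst).mul (hg.1.comp measurable_snd)).mul hkm).aestronglyMeasurable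
  · rw [Real.norm_eq_abs, abs_mul, abs_mul]
    calc _ ≤ 1 * 1 * |k z.1 z.2| := by gcongr <;> [exact hf.2 _; exact hg.2 _]
      _ ≤ _ := by simpa using hC z.1 z.2

theorem TameKernel.sub {k k' : ℝ → ℝ → ℝ} (hk : TameKernel k) (hk' : TameKernel k') :
    TameKernel fun x y => k x y - k' x y := by
  obtain ⟨hkm, C, hC⟩ := hk
  obtain ⟨hkm', C', hC'⟩ := hk'
  refine ⟨hkm.sub hkm', C + C', fun x y => ?_⟩
  rw [add_mul]
  exact (abs_sub _ _).trans (add_le_add (hC x y) (hC' x y))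

theorem tameKernel_prod {u w : ℝ → ℝ} (hu : Measurable u) (hw : Measurable w) {C D : ℝ}
    (hC : ∀ x, |u x| ≤ C * Real.exp (x ^ 2 / 4)) (hD : ∀ x, |w x| ≤ D * Real.exp (x ^ 2 / 4)) :
    TameKernel fun x y => u x * w y := by
  refine ⟨(hu.comp measurable_fst).mul (hw.comp measurable_snd), C * D, fun x y => ?_⟩
  rw [abs_mul]
  calc _ ≤ (C * Real.exp (x ^ 2 / 4)) * (D * Real.exp (y ^ 2 / 4)) := by
        gcongr
        · exact (abs_nonneg _).trans (hC x)
        · exact hC x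
        · exact hD y
    _ = _ := by ring

theorem kernelForm_iterated {k : ℝ → ℝ → ℝ} (hk : TameKernel k) {f g : ℝ → ℝ} (hf : UnitBdd f)
    (hg : UnitBdd g) :
    kernelForm k f g = ∫ x, f x * ∫ y, g y * k x y ∂gamma1 ∂gamma1 := by
  rw [kernelForm, integral_prod _ (hk.integrable hf hg)]
  simp only [mul_assoc]
  simp_rw [integral_const_mul]

theorem kernelForm_comm {k : ℝ → ℝ → ℝ} (hs : ∀ x y, k x y = k y x) (f g : ℝ → ℝ) :
    kernelForm k f g = kernelForm k g f := by
  unfold kernelForm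
  rw [← integral_prod_swap]
  refine integral_congr_ae (Filter.Eventually.of_forall fun z => ?_)
  simp only [Prod.fst_swap, Prod.snd_swap]
  rw [hs z.2 z.1]
  ring

theorem kernelForm_sub_left {k : ℝ → ℝ → ℝ} (hk : TameKernel k) {f f' g : ℝ → ℝ} (hf : UnitBdd f)
    (hf' : UnitBdd f') (hg : UnitBdd g) :
    kernelForm k (fun x => f x - f' x) g = kernelForm k f g - kernelForm k f' g := by
  unfold kernelForm
  rw [← integral_sub (hk.integrable hf hg) (hk.integrable hf' hg)]
  refine integral_congr_ae (Filter.Eventually.of_forall fun z => ?_)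
  simp only
  ring

theorem kernelForm_sub_right {k : ℝ → ℝ → ℝ} (hk : TameKernel k) {f g g' : ℝ → ℝ} (hf : UnitBdd f)
    (hg : UnitBdd g) (hg' : UnitBdd g') :
    kernelForm k f (fun x => g x - g' x) = kernelForm k f g - kernelForm k f g' := by
  unfold kernelForm
  rw [← integral_sub (hk.integrable hf hg) (hk.integrable hf hg')]
  refine integral_congr_ae (Filter.Eventually.of_forall fun z => ?_)
  simp only
  ring

theorem kernelForm_sub_kernel {k k' : ℝ → ℝ → ℝ} (hk : TameKernel k) (hk' : TameKernel k')
    {f g : ℝ → ℝ} (hf : UnitBdd f) (hg : UnitBdd g) :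
    kernelForm (fun x y => k x y - k' x y) f g = kernelForm k f g - kernelForm k' f g := by
  unfold kernelForm
  rw [← integral_sub (hk.integrable hf hg) (hk'.integrable hf hg)]
  refine integral_congr_ae (Filter.Eventually.of_forall fun z => ?_)
  simp only
  ring

theorem kernelForm_prod (u w f g : ℝ → ℝ) :
    kernelForm (fun x y => u x * w y) f g =
      (∫ x, f x * u x ∂gamma1) * ∫ y, g y * w y ∂gamma1 := by
  rw [← integral_prod_mul (fun x => f x * u x) (fun y => g y * w y)]
  refine integral_congr_ae (Filter.Eventually.of_forall fun z => ?_)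
  simp only
  ring

theorem kernelForm_congr_ae (k : ℝ → ℝ → ℝ) {f f' g g' : ℝ → ℝ} (hf : f =ᵐ[gamma1] f')
    (hg : g =ᵐ[gamma1] g') : kernelForm k f g = kernelForm k f' g' := by
  refine integral_congr_ae ?_
  have h1 := (Measure.quasiMeasurePreserving_fst (μ := gamma1) (ν := gamma1)).ae_eq_comp hf
  have h2 := (Measure.quasiMeasurePreserving_snd (μ := gamma1) (ν := gamma1)).ae_eq_comp hg
  filter_upwards [h1, h2] with z hz1 hz2
  simp only [Function.comp] at hz1 hz2
  rw [hz1, hz2]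

theorem abs_kernelForm_le {k b : ℝ → ℝ → ℝ} (hb : TameKernel b)
    (h : ∀ x y, |k x y| ≤ b x y) {f g : ℝ → ℝ} (hf : UnitBdd f) (hg : UnitBdd g) :
    |kernelForm k f g| ≤ kernelForm b (fun x => |f x|) (fun x => |g x|) := by
  unfold kernelForm
  rw [← Real.norm_eq_abs]
  refine norm_integral_le_of_norm_le (hb.integrable hf.abs hg.abs)
    (Filter.Eventually.of_forall fun z => ?_)
  rw [Real.norm_eq_abs, abs_mul, abs_mul]
  gcongr
  exact h _ _

theorem tameKernel_const (c : ℝ) : TameKernel fun _ _ => c := by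
  refine ⟨measurable_const, |c|, fun x y => ?_⟩
  have h1 : 1 ≤ Real.exp (x ^ 2 / 4) := Real.one_le_exp (by positivity)
  have h2 : 1 ≤ Real.exp (y ^ 2 / 4) := Real.one_le_exp (by positivity)
  exact le_mul_of_one_le_right (abs_nonneg c) (one_le_mul_of_one_le_of_one_le h1 h2)

theorem tameKernel_mehlerEven {ρ : ℝ} (h : |ρ| ≤ 1 / 1000) : TameKernel (mehlerEven ρ) := by
  refine ⟨(continuous_mehlerEven ρ).measurable, 2, fun x y => ?_⟩
  rw [abs_of_nonneg (mehlerEven_nonneg _ _ _)]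
  refine (mehlerEven_le h x y).trans ?_
  rw [mul_assoc]
  gcongr <;> norm_num

/-! ### The noise functional as a form with the even Mehler kernel. -/

/-- The Mehler kernel. -/
def mehlerKernel (ρ x y : ℝ) : ℝ :=
  Real.exp (-(ρ ^ 2 / (2 * (1 - ρ ^ 2)) * (x ^ 2 + y ^ 2))) *
    Real.exp (ρ / (1 - ρ ^ 2) * (x * y)) / Real.sqrt (1 - ρ ^ 2)

theorem mehlerEven_eq (ρ x y : ℝ) :
    mehlerEven ρ x y = (mehlerKernel ρ x y + mehlerKernel ρ (-x) y) / 2 := by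
  unfold mehlerEven mehlerKernel
  rw [Real.cosh_eq, neg_sq, show ρ / (1 - ρ ^ 2) * (-x * y) = -(ρ / (1 - ρ ^ 2) * (x * y)) by ring]
  ring

theorem mehlerKernel_nonneg (ρ x y : ℝ) : 0 ≤ mehlerKernel ρ x y := by
  unfold mehlerKernel; positivity

theorem tameKernel_mehlerKernel {ρ : ℝ} (h : |ρ| ≤ 1 / 1000) : TameKernel (mehlerKernel ρ) := by
  refine ⟨?_, 4, fun x y => ?_⟩
  · unfold mehlerKernel; fun_prop
  · rw [abs_of_nonneg (mehlerKernel_nonneg _ _ _)]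
    have h2 := mehlerEven_eq ρ x y
    have h3 := mehlerKernel_nonneg ρ (-x) y
    have h4 := mehlerEven_le h x y
    have h5 : 2 * Real.exp (x ^ 2 / 8) * Real.exp (y ^ 2 / 8) ≤
        2 * (Real.exp (x ^ 2 / 4) * Real.exp (y ^ 2 / 4)) := by
      rw [mul_assoc]
      gcongr <;> norm_num
    linarith

/-- Completing the square: the Mehler kernel is the density, relative to the standard Gaussian, of
the normal law with mean `ρ x` and variance `1 - ρ²`, which is the law defining `T_ρ` at `x`. -/
theorem mehlerKernel_mul_pdf {ρ : ℝ} (h : ρ ^ 2 < 1) (x y : ℝ) :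
    gaussianPDFReal 0 1 y * mehlerKernel ρ x y =
      gaussianPDFReal (x * ρ) (1 - ρ ^ 2).toNNReal y := by
  have hv : 0 < 1 - ρ ^ 2 := by linarith
  rw [gamma1_pdf, gaussianPDFReal, mehlerKernel, Real.coe_toNNReal _ hv.le,
    Real.sqrt_mul (by positivity), Real.sqrt_mul (by positivity), Real.sqrt_mul (by positivity)]
  rw [show (√2 * √Real.pi)⁻¹ * Real.exp (-(y ^ 2 / 2)) *
    (Real.exp (-(ρ ^ 2 / (2 * (1 - ρ ^ 2)) * (x ^ 2 + y ^ 2))) *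
    Real.exp (ρ / (1 - ρ ^ 2) * (x * y)) / √(1 - ρ ^ 2)) =
     (√2 * √Real.pi * √(1 - ρ ^ 2))⁻¹ * (Real.exp (-(y ^ 2 / 2)) *
    (Real.exp (-(ρ ^ 2 / (2 * (1 - ρ ^ 2)) * (x ^ 2 + y ^ 2))) *
    Real.exp (ρ / (1 - ρ ^ 2) * (x * y)))) by rw [mul_inv]; ring]
  rw [← Real.exp_add, ← Real.exp_add]
  congr 2
  field_simp
  ring

theorem ouOp_eq {ρ : ℝ} (h : ρ ^ 2 < 1) (g : ℝ → ℝ) (x : ℝ) :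
    ouOp ρ g x = ∫ y, g y * mehlerKernel ρ x y ∂gamma1 := by
  have hv : 0 < 1 - ρ ^ 2 := by linarith
  have hc : Real.sqrt (1 - ρ ^ 2) ≠ 0 := (Real.sqrt_pos.2 hv).ne'
  have hmap : gamma1.map (fun y => x * ρ + y * Real.sqrt (1 - ρ ^ 2)) =
      gaussianReal (x * ρ) (1 - ρ ^ 2).toNNReal := by
    have h1 := gaussianReal_map_mul_const (μ := 0) (v := 1) (Real.sqrt (1 - ρ ^ 2))
    have e : (NNReal.mk (Real.sqrt (1 - ρ ^ 2) ^ 2) (sq_nonneg _) * 1 : NNReal) =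
        (1 - ρ ^ 2).toNNReal := by
      ext
      rw [mul_one, Real.coe_toNNReal _ hv.le]
      exact Real.sq_sqrt hv.le
    rw [e, mul_zero] at h1
    have h2 := gaussianReal_map_const_add (μ := 0) (v := (1 - ρ ^ 2).toNNReal) (x * ρ)
    rw [zero_add] at h2
    rw [← h2, ← h1, Measure.map_map (by fun_prop) (by fun_prop)]
    rfl
  have hemb : MeasurableEmbedding (fun y => x * ρ + y * Real.sqrt (1 - ρ ^ 2)) :=
    (measurableEmbedding_addLeft (x * ρ)).comp (measurableEmbedding_mulRight₀ hc)
  rw [ouOp, ← hemb.integral_map (μ := gamma1) (g := g), hmap,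
    integral_gaussianReal_eq_integral_smul (by simpa using hv),
    gamma1, integral_gaussianReal_eq_integral_smul one_ne_zero]
  refine integral_congr_ae (Filter.Eventually.of_forall fun y => ?_)
  simp only [smul_eq_mul]
  rw [← mehlerKernel_mul_pdf h]
  ring

theorem integral_neg_gamma1 (f : ℝ → ℝ) : ∫ x, f (-x) ∂gamma1 = ∫ x, f x ∂gamma1 := by
  have h : gamma1.map (fun x => -x) = gamma1 := by
    have := gaussianReal_map_neg (μ := 0) (v := 1)
    rwa [neg_zero] at this
  conv_rhs => rw [← h]
  exact ((MeasurableEquiv.neg ℝ).measurableEmbedding.integral_map f).symm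

/-- The substitution `x ↦ -x` preserves both the Gaussian measure and `f`, so reflecting the kernel
in its first variable does not change the form. Averaging the two kernels requires evenness of `f`
only. -/
theorem noise_eq_kernelForm {ρ : ℝ} (h : |ρ| ≤ 1 / 1000) {f g : ℝ → ℝ} (hf : UnitBdd f)
    (hg : UnitBdd g) (he : ∀ x, f (-x) = f x) :
    noise ρ f g = kernelForm (mehlerEven ρ) f g := by
  obtain ⟨h1, h2, -, -⟩ := small_corr h
  have t1 := tameKernel_mehlerKernel h
  have t2 : TameKernel fun x y => mehlerKernel ρ (-x) y := by
    obtain ⟨-, C, hC⟩ := t1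
    refine ⟨by unfold mehlerKernel; fun_prop, C, fun x y => ?_⟩
    have := hC (-x) y
    rwa [neg_sq] at this
  have e1 : noise ρ f g = kernelForm (mehlerKernel ρ) f g := by
    rw [kernelForm_iterated t1 hf hg, noise]
    simp only [ouOp_eq (by linarith : ρ ^ 2 < 1)]
  have e2 : kernelForm (fun x y => mehlerKernel ρ (-x) y) f g =
      kernelForm (mehlerKernel ρ) f g := by
    rw [kernelForm_iterated t2 hf hg, kernelForm_iterated t1 hf hg]
    rw [← integral_neg_gamma1 fun x => f x * ∫ y, g y * mehlerKernel ρ x y ∂gamma1]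
    simp only [he]
  have e3 : kernelForm (mehlerEven ρ) f g = (kernelForm (mehlerKernel ρ) f g +
      kernelForm (fun x y => mehlerKernel ρ (-x) y) f g) / 2 := by
    unfold kernelForm
    rw [← integral_add (t1.integrable hf hg) (t2.integrable hf hg), ← integral_div]
    refine integral_congr_ae (Filter.Eventually.of_forall fun z => ?_)
    simp only
    rw [mehlerEven_eq]
    ring
  rw [e1, e3, e2]
  ring

/-! ### Gaussian mass of centered intervals and bounds for their radii. -/

/-- The standard Gaussian density. -/
abbrev gpdf : ℝ → ℝ := gaussianPDFReal 0 1

/-- The Gaussian measure of the centered interval of radius `r`. -/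
def gaussMass (r : ℝ) : ℝ := ∫ x in (-r)..r, gpdf x

theorem gpdf_neg (x : ℝ) : gpdf (-x) = gpdf x := by
  simp [gpdf, gaussianPDFReal]

theorem gpdf_pos (x : ℝ) : 0 < gpdf x := gaussianPDFReal_pos _ _ _ one_ne_zero

theorem hasDerivAt_gpdf (x : ℝ) : HasDerivAt gpdf (-x * gpdf x) x := by
  have e : gpdf = fun x => (Real.sqrt (2 * Real.pi))⁻¹ * Real.exp (-(x ^ 2 / 2)) := by
    ext x; exact gamma1_pdf x
  have h1 : HasDerivAt (fun x : ℝ => -(x ^ 2 / 2)) (-x) x := by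
    simpa using ((hasDerivAt_pow 2 x).div_const 2).fun_neg
  rw [e]
  refine (h1.exp.const_mul _).congr_deriv ?_
  ring

theorem continuous_gpdf : Continuous gpdf :=
  continuous_iff_continuousAt.2 fun x => (hasDerivAt_gpdf x).continuousAt

theorem inv_sqrt_two_pi_bounds :
    398 / 1000 ≤ (Real.sqrt (2 * Real.pi))⁻¹ ∧ (Real.sqrt (2 * Real.pi))⁻¹ ≤ 4 / 10 := by
  have h1 := Real.pi_gt_d4
  have h2 := Real.pi_lt_d4
  have h3 : (5 / 2 : ℝ) ≤ Real.sqrt (2 * Real.pi) := Real.le_sqrt_of_sq_le (by norm_num at *; linarith)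
  have h4 : Real.sqrt (2 * Real.pi) ≤ 251 / 100 :=
    Real.sqrt_le_iff.2 ⟨by norm_num, by norm_num at *; linarith⟩
  constructor
  · rw [le_inv_comm₀ (by norm_num) (by linarith)]; norm_num at *; linarith
  · rw [inv_le_comm₀ (by linarith) (by norm_num)]; norm_num at *; linarith

theorem gpdf_le (x : ℝ) : gpdf x ≤ 4 / 10 := by
  rw [gpdf, gamma1_pdf]
  have h := inv_sqrt_two_pi_bounds.2
  have h1 : Real.exp (-(x ^ 2 / 2)) ≤ 1 := Real.exp_le_one_iff.2 (by linarith [sq_nonneg x])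
  nlinarith [Real.exp_pos (-(x ^ 2 / 2))]

theorem gpdf_anti {x y : ℝ} (hx : 0 ≤ x) (hxy : x ≤ y) : gpdf y ≤ gpdf x := by
  rw [gpdf, gamma1_pdf, gamma1_pdf]
  gcongr

theorem gpdf_ge (x : ℝ) : 398 / 1000 * (1 - x ^ 2 / 2) ≤ gpdf x := by
  rw [gpdf, gamma1_pdf]
  have h := inv_sqrt_two_pi_bounds.1
  have h1 := Real.add_one_le_exp (-(x ^ 2 / 2))
  calc _ ≤ 398 / 1000 * Real.exp (-(x ^ 2 / 2)) := by gcongr; linarith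
    _ ≤ _ := by gcongr

theorem gamma1_real_ball {r : ℝ} (hr : 0 ≤ r) :
    gamma1.real (Metric.ball (0 : ℝ) r) = gaussMass r := by
  have h0 : 0 ≤ ∫ x in Set.Ioo (-r) r, gpdf x :=
    integral_nonneg fun x => (gpdf_pos x).le
  rw [Real.ball_eq_Ioo, zero_sub, zero_add, Measure.real, gaussianReal_apply_eq_integral _ one_ne_zero,
    ENNReal.toReal_ofReal h0, gaussMass, intervalIntegral.integral_of_le (by linarith),
    integral_Ioc_eq_integral_Ioo]

theorem gamma1_real_ball_compl {r : ℝ} (hr : 0 ≤ r) :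
    gamma1.real (Metric.ball (0 : ℝ) r)ᶜ = 1 - gaussMass r := by
  rw [probReal_compl_eq_one_sub Metric.isOpen_ball.measurableSet, gamma1_real_ball hr]

theorem hasDerivAt_gaussMass (r : ℝ) : HasDerivAt gaussMass (2 * gpdf r) r := by
  have hc := continuous_gpdf
  have h : ∀ t, HasDerivAt (fun u => ∫ x in (0 : ℝ)..u, gpdf x) (gpdf t) t := fun t =>
    intervalIntegral.integral_hasDerivAt_right (hc.intervalIntegrable _ _)
      (hc.stronglyMeasurableAtFilter _ _) hc.continuousAt
  have e : gaussMass = fun r => (∫ x in (0 : ℝ)..r, gpdf x) - ∫ x in (0 : ℝ)..(-r), gpdf x := by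
    ext r
    rw [gaussMass, intervalIntegral.integral_interval_sub_left (hc.intervalIntegrable _ _)
      (hc.intervalIntegrable _ _)]
  rw [e]
  refine ((h r).fun_sub ((h (-r)).comp r (hasDerivAt_neg r))).congr_deriv ?_
  rw [gpdf_neg]; ring

theorem gaussMass_zero : gaussMass 0 = 0 := by simp [gaussMass]

theorem continuous_gaussMass : Continuous gaussMass :=
  continuous_iff_continuousAt.2 fun x => (hasDerivAt_gaussMass x).continuousAt

theorem strictMono_gaussMass : StrictMono gaussMass :=
  strictMono_of_deriv_pos fun x => by
    rw [(hasDerivAt_gaussMass x).deriv]; linarith [gpdf_pos x]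

theorem tendsto_gaussMass : Filter.Tendsto gaussMass Filter.atTop (nhds 1) := by
  have := intervalIntegral_tendsto_integral (μ := volume) (f := gpdf)
    (integrable_gaussianPDFReal 0 1) Filter.tendsto_neg_atTop_atBot Filter.tendsto_id
  rwa [integral_gaussianPDFReal_eq_one _ one_ne_zero] at this

theorem exists_radius {t : ℝ} (h0 : 0 < t) (h1 : t < 1) : ∃ r, 0 < r ∧ gaussMass r = t := by
  obtain ⟨R, hR, hR0⟩ := ((tendsto_gaussMass.eventually (lt_mem_nhds h1)).and
    (Filter.eventually_ge_atTop 0)).exists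
  obtain ⟨r, hr, hrt⟩ := intermediate_value_Icc hR0 continuous_gaussMass.continuousOn
    ⟨by rw [gaussMass_zero]; exact h0.le, hR.le⟩
  refine ⟨r, lt_of_le_of_ne hr.1 ?_, hrt⟩
  rintro rfl
  rw [gaussMass_zero] at hrt
  linarith

theorem le_of_deriv_bound {F F' : ℝ → ℝ} (hF : ∀ x, HasDerivAt F (F' x) x) {a b : ℝ}
    (hab : a ≤ b) (h : ∀ x, a < x → x < b → 0 ≤ F' x) : F a ≤ F b := by
  refine monotoneOn_of_deriv_nonneg (convex_Icc a b)
    (fun x _ => (hF x).continuousAt.continuousWithinAt)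
    (fun x _ => (hF x).differentiableAt.differentiableWithinAt) ?_
    (Set.left_mem_Icc.2 hab) (Set.right_mem_Icc.2 hab) hab
  intro x hx
  rw [interior_Icc] at hx
  rw [(hF x).deriv]
  exact h x hx.1 hx.2

theorem gaussMass_le {r : ℝ} (hr : 0 ≤ r) : gaussMass r ≤ 8 / 10 * r := by
  have := le_of_deriv_bound (F := fun r => 8 / 10 * r - gaussMass r)
    (fun x => ((hasDerivAt_id x).const_mul (8 / 10)).fun_sub (hasDerivAt_gaussMass x)) hr
    (fun x _ _ => by linarith [gpdf_le x])
  simp only [gaussMass_zero] at this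
  linarith

/-- The density is smallest at the endpoints of the interval. In derivative form, the difference of
the two sides has derivative `2 x² φ(x) ≥ 0`. -/
theorem le_gaussMass {r : ℝ} (hr : 0 ≤ r) : 2 * r * gpdf r ≤ gaussMass r := by
  have := le_of_deriv_bound (F := fun r => gaussMass r - 2 * r * gpdf r)
    (fun x => (hasDerivAt_gaussMass x).fun_sub
      (((hasDerivAt_id x).const_mul 2).fun_mul (hasDerivAt_gpdf x))) hr
    (fun x h _ => by
      simp only [id]
      nlinarith [mul_nonneg (mul_nonneg h.le h.le) (gpdf_pos x).le])
  simp only [gaussMass_zero] at this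
  linarith

theorem gaussMass_ge_cubic {r : ℝ} (hr : 0 ≤ r) :
    796 / 1000 * (r - r ^ 3 / 6) ≤ gaussMass r := by
  have := le_of_deriv_bound (F := fun r => gaussMass r - 796 / 1000 * (r - r ^ 3 / 6))
    (fun x => (hasDerivAt_gaussMass x).fun_sub
      (((hasDerivAt_id x).fun_sub ((hasDerivAt_pow 3 x).div_const 6)).const_mul (796 / 1000))) hr
    (fun x h _ => by
      have := gpdf_ge x
      norm_num
      linarith)
  simp only [gaussMass_zero] at this
  norm_num at this
  linarith

/-- Mills' inequality. -/
theorem one_sub_gaussMass_le {r : ℝ} (hr : 0 < r) : r * (1 - gaussMass r) ≤ 2 * gpdf r := by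
  have hanti : ∀ R, r ≤ R → 2 * gpdf R / R - (1 - gaussMass R) ≤
      2 * gpdf r / r - (1 - gaussMass r) := by
    intro R hR
    have hd : ∀ x, 0 < x → HasDerivAt (fun x => 2 * gpdf x / x - (1 - gaussMass x))
        (-(2 * gpdf x / x ^ 2)) x := by
      intro x hx
      refine ((((hasDerivAt_gpdf x).const_mul 2).fun_div (hasDerivAt_id x) hx.ne').fun_sub
        ((hasDerivAt_gaussMass x).const_sub 1)).congr_deriv ?_
      simp only [id]
      field_simp
      ring
    refine antitoneOn_of_deriv_nonpos (f := fun x => 2 * gpdf x / x - (1 - gaussMass x))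
      (convex_Icc r R) ?_ ?_ ?_
      (Set.left_mem_Icc.2 hR) (Set.right_mem_Icc.2 hR) hR
    · exact fun x hx => (hd x (hr.trans_le hx.1)).continuousAt.continuousWithinAt
    · intro x hx
      rw [interior_Icc] at hx
      exact (hd x (hr.trans hx.1)).differentiableAt.differentiableWithinAt
    · intro x hx
      rw [interior_Icc] at hx
      rw [(hd x (hr.trans hx.1)).deriv]
      have := gpdf_pos x
      have : 0 ≤ 2 * gpdf x / x ^ 2 := by positivity
      linarith
  -- The quotient `2 φ(R) / R` is nonnegative, so the limit of the remaining term alone shows that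
  -- the decreasing function is nonnegative.
  have hlim : Filter.Tendsto (fun R => -(1 - gaussMass R)) Filter.atTop (nhds (-(1 - 1))) :=
    (tendsto_gaussMass.const_sub 1).neg
  have hge : -(1 - 1 : ℝ) ≤ 2 * gpdf r / r - (1 - gaussMass r) := by
    refine le_of_tendsto hlim ?_
    filter_upwards [Filter.eventually_ge_atTop r] with R hR
    have := hanti R hR
    have h2 : 0 ≤ 2 * gpdf R / R := by
      have := gpdf_pos R
      have := hr.trans_le hR
      positivity
    linarith
  have h3 : 1 - gaussMass r ≤ 2 * gpdf r / r := by linarith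
  rwa [le_div_iff₀ hr, mul_comm] at h3

theorem gpdf_one_ge : 238 / 1000 ≤ gpdf 1 := by
  rw [gpdf, gamma1_pdf]
  have h := inv_sqrt_two_pi_bounds.1
  have h1 : (3 / 5 : ℝ) ≤ Real.exp (-(1 ^ 2 / 2)) := by
    rw [Real.exp_neg, le_inv_comm₀ (by norm_num) (Real.exp_pos _)]
    have h3 : Real.exp (1 ^ 2 / 2) ^ 2 = Real.exp 1 := by
      rw [← Real.exp_nat_mul]; norm_num
    have h2 := Real.exp_one_lt_d9
    rw [← h3] at h2
    have := abs_le_of_sq_le_sq (a := Real.exp (1 ^ 2 / 2)) (b := (3 / 5 : ℝ)⁻¹)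
      (by norm_num at *; linarith) (by norm_num)
    exact (le_abs_self _).trans this
  nlinarith

/-- A radius is controlled by the measures of the interval and of its complement. -/
theorem radius_bounds {p r : ℝ} (hp : 0 < p) (hp2 : p ≤ 1 / 2) (hr : 0 < r) (h1 : p ≤ gaussMass r)
    (h2 : gaussMass r ≤ 1 - p) :
    p ≤ r ∧ p / 4 ≤ r * gpdf r ∧ Real.exp (r ^ 2 / 4) ≤ 1 / p := by
  have hr1 := gaussMass_le hr.le
  have hφ := gpdf_pos r
  refine ⟨by linarith, ?_, ?_⟩
  -- For `r ≤ 1` the density is at least `φ(1)` and `r` is at least of order `p`. For `r ≥ 1` Mills'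
  -- inequality bounds `φ(r)` below by `r p / 2`.
  · rcases le_total r 1 with h | h
    · have := gpdf_anti hr.le h
      have := gpdf_one_ge
      nlinarith
    · have := one_sub_gaussMass_le hr
      have h3 : r * p ≤ 2 * gpdf r := by nlinarith
      nlinarith
  · rw [le_div_iff₀ hp]
    rcases le_total r 1 with h | h
    · have : Real.exp (r ^ 2 / 4) ≤ Real.exp (1 / 4) := Real.exp_le_exp.2 (by nlinarith)
      have h4 : Real.exp (1 / 4) ^ 4 = Real.exp 1 := by
        rw [← Real.exp_nat_mul]; norm_num
      have h5 := Real.exp_one_lt_d9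
      have h6 : Real.exp (1 / 4) ≤ 2 := by
        by_contra hcon
        push Not at hcon
        have : (2 : ℝ) ^ 4 < Real.exp (1 / 4) ^ 4 := pow_lt_pow_left₀ hcon (by norm_num) (by norm_num)
        norm_num at *
        linarith
      nlinarith
    -- Mills' inequality with `r ≥ 1` gives `p ≤ 2 r φ(r)`. One factor `exp (-r² / 4)` of the
    -- density compensates `r`, and the other cancels `exp (r² / 4)`.
    · have h3 := one_sub_gaussMass_le hr
      have h4 : p ≤ 2 * r * gpdf r := by nlinarith
      have h5 : r ≤ Real.exp (r ^ 2 / 4) := by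
        have := Real.add_one_le_exp (r ^ 2 / 4)
        nlinarith [sq_nonneg (r - 2)]
      have h6 : gpdf r = (Real.sqrt (2 * Real.pi))⁻¹ * (Real.exp (-(r ^ 2 / 4)) *
          Real.exp (-(r ^ 2 / 4))) := by
        rw [gpdf, gamma1_pdf, ← Real.exp_add]; ring_nf
      have h7 : Real.exp (r ^ 2 / 4) * Real.exp (-(r ^ 2 / 4)) = 1 := by
        rw [← Real.exp_add]; simp
      have h10 := inv_sqrt_two_pi_bounds.2
      calc _ ≤ Real.exp (r ^ 2 / 4) * (2 * r * gpdf r) := by gcongr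
        _ = 2 * (Real.sqrt (2 * Real.pi))⁻¹ * (r * Real.exp (-(r ^ 2 / 4))) *
            (Real.exp (r ^ 2 / 4) * Real.exp (-(r ^ 2 / 4))) := by rw [h6]; ring
        _ ≤ 2 * (4 / 10) * (Real.exp (r ^ 2 / 4) * Real.exp (-(r ^ 2 / 4))) * 
            (Real.exp (r ^ 2 / 4) * Real.exp (-(r ^ 2 / 4))) := by gcongr
        _ ≤ 1 := by rw [h7]; norm_num

/-- Positivity of the numerator of the derivative of `n_t / n_{1-t}`, where `n = r φ(r)`. -/
theorem wronskian_lower {p r s : ℝ} (hp2 : p ≤ 1 / 2) (hr : 0 < r) (hs : 0 < s)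
    (hrs : gaussMass r + gaussMass s = 1) (h1 : p ≤ gaussMass r) (h2 : p ≤ gaussMass s) :
    p / 10 ≤ (1 - r ^ 2) * (s * gpdf s) + (1 - s ^ 2) * (r * gpdf r) := by
  -- The expression is symmetric in `r` and `s`. The smaller interval has mass at most `1/2`, which
  -- forces `r < 3/4` and `s ≥ 5/8`.
  wlog hle : r ≤ s generalizing r s
  · have := this hs hr (by linarith) h2 h1 (le_of_not_ge hle)
    linarith
  have hm := strictMono_gaussMass.monotone hle
  have hr34 : r < 3 / 4 := by
    by_contra hcon
    push Not at hcon
    have := strictMono_gaussMass.monotone hcon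
    have := gaussMass_ge_cubic (r := 3 / 4) (by norm_num)
    norm_num at this
    linarith
  have hs58 : 5 / 8 ≤ s := by
    have := gaussMass_le hs.le
    linarith
  have hφs := gpdf_pos s
  have hφr := gpdf_pos r
  have hr2 : r ^ 2 ≤ 9 / 16 := by nlinarith
  rcases le_total s 1 with h | h
  · have i1 := gpdf_anti hs.le h
    have i2 := gpdf_one_ge
    have i3 : 5 / 8 * (238 / 1000) ≤ s * gpdf s := by
      apply mul_le_mul hs58 (i2.trans i1) (by norm_num) hs.le
    have i4 : 0 ≤ (1 - s ^ 2) * (r * gpdf r) := mul_nonneg (by nlinarith) (by positivity)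
    nlinarith
  -- For `s ≥ 1` the second summand is nonpositive. Mills' inequality at `s`, with the complementary
  -- mass bounded below by `2 r φ(r)`, gives `s r φ(r) ≤ φ(s)`. Then `s` times the expression is at
  -- least `(1 - (r s)²) φ(s)`, and the same inequality bounds `r s` by `exp (-(s² - r²) / 2)`, away
  -- from `1`.
  · have i1 := one_sub_gaussMass_le hs
    have i2 := le_gaussMass hr.le
    have i3 : s * (r * gpdf r) ≤ gpdf s := by nlinarith
    have i4 : gpdf s ≤ gpdf r * Real.exp (-((s ^ 2 - r ^ 2) / 2)) := by
      rw [gpdf, gamma1_pdf, gamma1_pdf, mul_assoc, ← Real.exp_add]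
      ring_nf; rfl
    have i5 : Real.exp (-((s ^ 2 - r ^ 2) / 2)) ^ 2 ≤ 16 / 23 := by
      rw [← Real.exp_nat_mul, show ((2 : ℕ) : ℝ) * -((s ^ 2 - r ^ 2) / 2) = -(s ^ 2 - r ^ 2) by
        push_cast; ring, Real.exp_neg, inv_le_comm₀ (Real.exp_pos _) (by norm_num)]
      have := Real.add_one_le_exp (s ^ 2 - r ^ 2)
      norm_num
      nlinarith
    have i6 : r * s ≤ Real.exp (-((s ^ 2 - r ^ 2) / 2)) := by
      have : gpdf r * (r * s) ≤ gpdf r * Real.exp (-((s ^ 2 - r ^ 2) / 2)) := by linarith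
      exact le_of_mul_le_mul_left this hφr
    have i7 : (r * s) ^ 2 ≤ 16 / 23 := (pow_le_pow_left₀ (by positivity) i6 2).trans i5
    have i8 : p * s ≤ 2 * gpdf s := by nlinarith
    have i9 : s * ((s ^ 2 - 1) * (r * gpdf r)) ≤ (s ^ 2 - 1) * gpdf s := by
      have : 0 ≤ s ^ 2 - 1 := by nlinarith
      calc _ = (s ^ 2 - 1) * (s * (r * gpdf r)) := by ring
        _ ≤ _ := by gcongr
    have i10 : s * (p / 10) ≤ s * ((1 - r ^ 2) * (s * gpdf s) + (1 - s ^ 2) * (r * gpdf r)) := by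
      have : (7 / 23) * gpdf s ≤ (1 - (r * s) ^ 2) * gpdf s := by gcongr; linarith
      nlinarith
    exact le_of_mul_le_mul_left i10 hs

/-! ### Caps and the sign of a deviation from a cap. -/

/-- `A` is the centered interval of radius `r` (for `σ = 1`) or its complement (for `σ = -1`). -/
def IsCap (σ r : ℝ) (A : Set ℝ) : Prop :=
  (σ = 1 ∧ A = Metric.ball (0 : ℝ) r) ∨ (σ = -1 ∧ A = (Metric.ball (0 : ℝ) r)ᶜ)

theorem ind_nonneg (A : Set ℝ) (x : ℝ) : 0 ≤ ind A x :=
  Set.indicator_nonneg (fun _ _ => zero_le_one) x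

theorem ind_le_one (A : Set ℝ) (x : ℝ) : ind A x ≤ 1 :=
  Set.indicator_le_self' (fun _ _ => zero_le_one) x

theorem ind_compl (A : Set ℝ) (x : ℝ) : ind Aᶜ x = 1 - ind A x := by
  by_cases h : x ∈ A <;> simp [ind, h]

theorem unitBdd_of_mem {f : ℝ → ℝ} (hm : Measurable f) (h : ∀ x, 0 ≤ f x ∧ f x ≤ 1) : UnitBdd f :=
  ⟨hm, fun x => abs_le.2 ⟨by linarith [(h x).1], (h x).2⟩⟩

theorem FunClass.unitBdd {a : ℝ} {f : ℝ → ℝ} (hf : FunClass a f) : UnitBdd f :=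
  unitBdd_of_mem hf.1 hf.2.1

theorem funClass_ind {a : ℝ} {A : Set ℝ} (hA : SetClass a A) : FunClass a (ind A) := by
  refine ⟨measurable_const.indicator hA.1, fun x => ⟨ind_nonneg A x, ind_le_one A x⟩, ?_⟩
  rw [ind, integral_indicator hA.1]
  simp [hA.2]

theorem unitBdd_ind {A : Set ℝ} (hA : MeasurableSet A) : UnitBdd (ind A) :=
  unitBdd_of_mem (measurable_const.indicator hA) fun x => ⟨ind_nonneg A x, ind_le_one A x⟩

theorem FunClass.unitBdd_sub {a b : ℝ} {f g : ℝ → ℝ} (hf : FunClass a f) (hg : FunClass b g) :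
    UnitBdd fun x => f x - g x := by
  refine ⟨hf.1.sub hg.1, fun x => abs_le.2 ?_⟩
  have := hf.2.1 x
  have := hg.2.1 x
  constructor <;> linarith

theorem FunClass.integral_sub {a : ℝ} {f g : ℝ → ℝ} (hf : FunClass a f) (hg : FunClass a g) :
    ∫ x, (f x - g x) ∂gamma1 = 0 := by
  rw [MeasureTheory.integral_sub hf.unitBdd.integrable hg.unitBdd.integrable, hf.2.2, hg.2.2,
    sub_self]

theorem IsCap.measurableSet {σ r : ℝ} {A : Set ℝ} (h : IsCap σ r A) : MeasurableSet A := by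
  rcases h with ⟨-, rfl⟩ | ⟨-, rfl⟩
  · exact Metric.isOpen_ball.measurableSet
  · exact Metric.isOpen_ball.measurableSet.compl

theorem IsCap.neg_mem_iff {σ r : ℝ} {A : Set ℝ} (h : IsCap σ r A) (x : ℝ) : -x ∈ A ↔ x ∈ A := by
  rcases h with ⟨-, rfl⟩ | ⟨-, rfl⟩ <;> simp

theorem IsCap.sq_eq_one {σ r : ℝ} {A : Set ℝ} (h : IsCap σ r A) : σ ^ 2 = 1 := by
  rcases h with ⟨rfl, -⟩ | ⟨rfl, -⟩ <;> norm_num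

/-- The deviation of a `[0,1]`-valued function from a cap has the sign of the complement. -/
theorem IsCap.sign {σ r : ℝ} {A : Set ℝ} (h : IsCap σ r A) (hr : 0 < r) {f : ℝ → ℝ} {x : ℝ}
    (hf : 0 ≤ f x ∧ f x ≤ 1) :
    σ * (f x - ind A x) * (x ^ 2 - r ^ 2) = |f x - ind A x| * |x ^ 2 - r ^ 2| := by
  have hb : x ∈ Metric.ball (0 : ℝ) r ↔ x ^ 2 < r ^ 2 := by
    rw [mem_ball_zero_iff, Real.norm_eq_abs, sq_lt_sq, abs_of_pos hr]
  rcases h with ⟨rfl, rfl⟩ | ⟨rfl, rfl⟩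
  · by_cases hx : x ∈ Metric.ball (0 : ℝ) r
    · have h1 : ind (Metric.ball (0 : ℝ) r) x = 1 := Set.indicator_of_mem hx _
      have h2 := hb.1 hx
      rw [h1, abs_of_nonpos (by linarith : f x - 1 ≤ 0), abs_of_neg (by linarith)]
      ring
    · have h1 : ind (Metric.ball (0 : ℝ) r) x = 0 := Set.indicator_of_notMem hx _
      have h2 := not_lt.1 (hb.not.1 hx)
      rw [h1, abs_of_nonneg (by linarith : 0 ≤ f x - 0), abs_of_nonneg (by linarith)]
      ring
  · by_cases hx : x ∈ Metric.ball (0 : ℝ) r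
    · have h1 : ind (Metric.ball (0 : ℝ) r)ᶜ x = 0 := Set.indicator_of_notMem (by simpa using hx) _
      have h2 := hb.1 hx
      rw [h1, abs_of_nonneg (by linarith : 0 ≤ f x - 0), abs_of_neg (by linarith)]
      ring
    · have h1 : ind (Metric.ball (0 : ℝ) r)ᶜ x = 1 := Set.indicator_of_mem (by simpa using hx) _
      have h2 := not_lt.1 (hb.not.1 hx)
      rw [h1, abs_of_nonpos (by linarith : f x - 1 ≤ 0), abs_of_nonneg (by linarith)]
      ring

/-! ### First variation at a pair of caps. -/

theorem integral_ind_ball {s : ℝ} (hs : 0 ≤ s) (h : ℝ → ℝ) :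
    ∫ y, ind (Metric.ball (0 : ℝ) s) y * h y ∂gamma1 = ∫ y in (-s)..s, gpdf y * h y := by
  rw [intervalIntegral.integral_of_le (by linarith), integral_Ioc_eq_integral_Ioo,
    ← integral_indicator measurableSet_Ioo, gamma1,
    integral_gaussianReal_eq_integral_smul one_ne_zero]
  refine integral_congr_ae (Filter.Eventually.of_forall fun y => ?_)
  rw [Real.ball_eq_Ioo, zero_sub, zero_add]
  by_cases hy : y ∈ Set.Ioo (-s) s <;> simp [ind, hy]

theorem ouOp_one (ρ x : ℝ) : ouOp ρ (fun _ => 1) x = 1 := by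
  simp [ouOp]

theorem integral_mehlerKernel {ρ : ℝ} (h : ρ ^ 2 < 1) (x : ℝ) :
    ∫ y, mehlerKernel ρ x y ∂gamma1 = 1 := by
  have := ouOp_eq h (fun _ => 1) x
  rw [ouOp_one] at this
  simpa using this.symm

theorem TameKernel.integrable_section {k : ℝ → ℝ → ℝ} (hk : TameKernel k) (x : ℝ) {g : ℝ → ℝ}
    (hg : UnitBdd g) : Integrable (fun y => g y * k x y) gamma1 := by
  obtain ⟨hm, C, hC⟩ := hk
  have hm' : Measurable (k x) := hm.comp (measurable_const.prodMk measurable_id)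
  refine integrable_of_le_exp (hg.1.mul hm') (C := C * Real.exp (x ^ 2 / 4)) fun y => ?_
  rw [abs_mul, mul_assoc]
  calc _ ≤ 1 * |k x y| := by gcongr; exact hg.2 y
    _ ≤ _ := by rw [one_mul]; exact hC x y

theorem unitBdd_one : UnitBdd fun _ => (1 : ℝ) := ⟨measurable_const, fun _ => by simp⟩

theorem integral_mehlerEven {ρ : ℝ} (h : |ρ| ≤ 1 / 1000) (x : ℝ) :
    ∫ y, mehlerEven ρ x y ∂gamma1 = 1 := by
  have h1 := (small_corr h).1
  have t := tameKernel_mehlerKernel h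
  have i1 := t.integrable_section x unitBdd_one
  have i2 := t.integrable_section (-x) unitBdd_one
  simp only [one_mul] at i1 i2
  simp_rw [mehlerEven_eq]
  rw [integral_div, integral_add i1 i2, integral_mehlerKernel (by linarith),
    integral_mehlerKernel (by linarith)]
  norm_num

/-- The action of the even Mehler kernel. -/
def evenOp (ρ : ℝ) (g : ℝ → ℝ) (x : ℝ) : ℝ := ∫ y, g y * mehlerEven ρ x y ∂gamma1

theorem evenOp_abs (ρ : ℝ) (g : ℝ → ℝ) (x : ℝ) : evenOp ρ g |x| = evenOp ρ g x := by
  simp only [evenOp, mehlerEven_abs_left]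

theorem evenOp_compl {ρ : ℝ} (h : |ρ| ≤ 1 / 1000) {B : Set ℝ} (hB : MeasurableSet B) (x : ℝ) :
    evenOp ρ (ind Bᶜ) x = 1 - evenOp ρ (ind B) x := by
  have t := tameKernel_mehlerEven h
  have i1 := t.integrable_section x unitBdd_one
  have i2 := t.integrable_section x (unitBdd_ind hB)
  rw [evenOp, evenOp, ← integral_mehlerEven h x]
  simp only [one_mul] at i1
  rw [← integral_sub i1 i2]
  refine integral_congr_ae (Filter.Eventually.of_forall fun y => ?_)
  simp only [ind_compl]
  ring

/-- With `q` the centered normal density of variance `1 - ρ²`, the smoothed indicator at `x` is the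
mass given by `q` to the interval `(-s, s)` shifted by `-ρ x`. As `q` is even, this is the primitive
of `q` from `0` evaluated at `s - ρ x` plus its value at `s + ρ x`. -/
theorem hasDerivAt_evenOp_ball {ρ : ℝ} (h : |ρ| ≤ 1 / 1000) {s : ℝ} (hs : 0 ≤ s) (x : ℝ) :
    HasDerivAt (evenOp ρ (ind (Metric.ball (0 : ℝ) s)))
      (ρ * (gaussianPDFReal 0 (1 - ρ ^ 2).toNNReal (s + ρ * x) -
        gaussianPDFReal 0 (1 - ρ ^ 2).toNNReal (s - ρ * x))) x := by
  obtain ⟨h1, h2, -, -⟩ := small_corr h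
  set q := gaussianPDFReal 0 (1 - ρ ^ 2).toNNReal with hq
  have hqc : Continuous q := by
    rw [hq]; unfold gaussianPDFReal; fun_prop
  have hqs : ∀ m y, gaussianPDFReal m (1 - ρ ^ 2).toNNReal y = q (y - m) := by
    intro m y; simp [hq, gaussianPDFReal]
  have hqn : ∀ y, q (-y) = q y := by
    intro y; simp [hq, gaussianPDFReal]
  have hqi : ∀ a b, IntervalIntegrable q volume a b := fun a b => hqc.intervalIntegrable a b
  have hΨ : ∀ t, HasDerivAt (fun u => ∫ y in (0 : ℝ)..u, q y) (q t) t := fun t =>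
    intervalIntegral.integral_hasDerivAt_right (hqi _ _)
      (hqc.stronglyMeasurableAtFilter _ _) hqc.continuousAt
  have hK : ∀ x, evenOp ρ (ind (Metric.ball (0 : ℝ) s)) x =
      (∫ y in (0 : ℝ)..(s - ρ * x), q y) + ∫ y in (0 : ℝ)..(s + ρ * x), q y := by
    intro x
    rw [evenOp, integral_ind_ball hs]
    have e : ∀ y, gpdf y * mehlerEven ρ x y = (q (y - x * ρ) + q (y + x * ρ)) / 2 := by
      intro y
      have e1 := mehlerKernel_mul_pdf (by linarith : ρ ^ 2 < 1) x y
      have e2 := mehlerKernel_mul_pdf (by linarith : ρ ^ 2 < 1) (-x) y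
      rw [hqs] at e1 e2
      rw [mehlerEven_eq, show y + x * ρ = y - -x * ρ by ring, ← e1, ← e2]
      ring
    simp_rw [e]
    have e3 : ∀ a : ℝ, (∫ y in (0 : ℝ)..(-a), q y) = - ∫ y in (0 : ℝ)..a, q y := by
      intro a
      have := intervalIntegral.integral_comp_neg (f := q) (a := 0) (b := a)
      simp only [hqn, neg_zero] at this
      rw [this, ← intervalIntegral.integral_symm]
    rw [intervalIntegral.integral_div, intervalIntegral.integral_add
      (by apply Continuous.intervalIntegrable; fun_prop)
      (by apply Continuous.intervalIntegrable; fun_prop),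
      intervalIntegral.integral_comp_sub_right, intervalIntegral.integral_comp_add_right,
      ← intervalIntegral.integral_interval_sub_left (hqi 0 (s - x * ρ)) (hqi 0 (-s - x * ρ)),
      ← intervalIntegral.integral_interval_sub_left (hqi 0 (s + x * ρ)) (hqi 0 (-s + x * ρ)),
      show -s - x * ρ = -(s + ρ * x) by ring, show -s + x * ρ = -(s - ρ * x) by ring, e3, e3,
      mul_comm x ρ]
    ring
  have hfun : evenOp ρ (ind (Metric.ball (0 : ℝ) s)) = fun x =>
      (∫ y in (0 : ℝ)..(s - ρ * x), q y) + ∫ y in (0 : ℝ)..(s + ρ * x), q y := funext hK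
  rw [hfun]
  have d1 : HasDerivAt (fun x : ℝ => s - ρ * x) (-ρ) x := by
    simpa using ((hasDerivAt_id x).const_mul ρ).const_sub s
  have d2 : HasDerivAt (fun x : ℝ => s + ρ * x) ρ x := by
    simpa using ((hasDerivAt_id x).const_mul ρ).const_add s
  refine (((hΨ _).comp x d1).fun_add ((hΨ _).comp x d2)).congr_deriv ?_
  ring

/-- Factoring the two densities turns their difference into a negative multiple of `sinh (ρ s x / (1
- ρ²))`. Both signs of `ρ` are covered at once by `ρ sinh (ρ t) ≥ ρ² t` for `t ≥ 0`. Comparison of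
the prefactor with `φ(s)` costs the factor `1 - ρ² (s² + x²)`. -/
theorem evenOp_ball_deriv_le {ρ : ℝ} (h : |ρ| ≤ 1 / 1000) {s : ℝ} (hs : 0 ≤ s) {x : ℝ} (hx : 0 ≤ x) :
    ρ * (gaussianPDFReal 0 (1 - ρ ^ 2).toNNReal (s + ρ * x) -
        gaussianPDFReal 0 (1 - ρ ^ 2).toNNReal (s - ρ * x)) ≤
      -(2 * ρ ^ 2 * (s * gpdf s) * x * (1 - ρ ^ 2 * (s ^ 2 + x ^ 2))) ∧ 
    ρ * (gaussianPDFReal 0 (1 - ρ ^ 2).toNNReal (s + ρ * x) -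
        gaussianPDFReal 0 (1 - ρ ^ 2).toNNReal (s - ρ * x)) ≤ 0 := by
  obtain ⟨h1, h2, -, -⟩ := small_corr h
  have h0 := sq_nonneg ρ
  set v := 1 - ρ ^ 2 with hv
  set E := Real.exp (-((s ^ 2 + ρ ^ 2 * x ^ 2) / (2 * v))) with hE
  set A := (Real.sqrt (2 * Real.pi * v))⁻¹ with hA
  have e : ρ * (gaussianPDFReal 0 v.toNNReal (s + ρ * x) - gaussianPDFReal 0 v.toNNReal (s - ρ * x))
      = -(2 * A * E * (ρ * Real.sinh (ρ * (s * x / v)))) := by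
    simp only [gaussianPDFReal, sub_zero, Real.coe_toNNReal _ h2.le]
    have e1 : Real.exp (-(s + ρ * x) ^ 2 / (2 * v)) = E * Real.exp (-(ρ * (s * x / v))) := by
      rw [hE, ← Real.exp_add]; congr 1; field_simp; ring
    have e2 : Real.exp (-(s - ρ * x) ^ 2 / (2 * v)) = E * Real.exp (ρ * (s * x / v)) := by
      rw [hE, ← Real.exp_add]; congr 1; field_simp; ring
    rw [e1, e2, Real.sinh_eq]
    ring
  have hsinh : ∀ t, 0 ≤ t → ρ ^ 2 * t ≤ ρ * Real.sinh (ρ * t) := by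
    intro t ht
    rcases le_total 0 ρ with hρ | hρ
    · have := Real.self_le_sinh_iff.2 (mul_nonneg hρ ht)
      nlinarith
    · have := Real.sinh_le_self_iff.2 (mul_nonpos_of_nonpos_of_nonneg hρ ht)
      nlinarith
  have hv1 : v ≤ 1 := by rw [hv]; linarith
  have hsx : s * x ≤ s * x / v := by
    rw [le_div_iff₀ h2]
    exact mul_le_of_le_one_right (mul_nonneg hs hx) hv1
  have i1 := hsinh _ (by positivity : 0 ≤ s * x / v)
  have i2 : ρ ^ 2 * (s * x) ≤ ρ * Real.sinh (ρ * (s * x / v)) := le_trans (by gcongr) i1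
  have i0 : 0 ≤ ρ ^ 2 * (s * x) := by positivity
  rw [e]
  constructor
  · have hA1 : (Real.sqrt (2 * Real.pi))⁻¹ ≤ A := by
      rw [hA]
      apply inv_anti₀ (by positivity)
      apply Real.sqrt_le_sqrt
      exact mul_le_of_le_one_right (by positivity) hv1
    have hE1 : Real.exp (-(s ^ 2 / 2)) * (1 - ρ ^ 2 * (s ^ 2 + x ^ 2)) ≤ E := by
      have := Real.add_one_le_exp (-(ρ ^ 2 * (s ^ 2 + x ^ 2)))
      calc _ ≤ Real.exp (-(s ^ 2 / 2)) * Real.exp (-(ρ ^ 2 * (s ^ 2 + x ^ 2))) := by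
            gcongr; linarith
        _ ≤ E := by
            rw [hE, ← Real.exp_add]
            apply Real.exp_le_exp.2
            have : (s ^ 2 + ρ ^ 2 * x ^ 2) / (2 * v) ≤ s ^ 2 / 2 + ρ ^ 2 * (s ^ 2 + x ^ 2) := by
              rw [div_le_iff₀ (by positivity)]
              have e4 : (s ^ 2 / 2 + ρ ^ 2 * (s ^ 2 + x ^ 2)) * (2 * v) - (s ^ 2 + ρ ^ 2 * x ^ 2) =
                ρ ^ 2 * (s ^ 2 * (1 - 2 * ρ ^ 2) + x ^ 2 * (1 - 2 * ρ ^ 2)) := by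
                  rw [hv]; ring
              have : 0 ≤ ρ ^ 2 * (s ^ 2 * (1 - 2 * ρ ^ 2) + x ^ 2 * (1 - 2 * ρ ^ 2)) := by
                have : 0 ≤ 1 - 2 * ρ ^ 2 := by linarith
                positivity
              linarith
            linarith
    have hAE : gpdf s * (1 - ρ ^ 2 * (s ^ 2 + x ^ 2)) ≤ A * E := by
      rw [gpdf, gamma1_pdf, mul_assoc]
      calc _ ≤ (Real.sqrt (2 * Real.pi))⁻¹ * E := by gcongr
        _ ≤ A * E := by gcongr
    have : gpdf s * (1 - ρ ^ 2 * (s ^ 2 + x ^ 2)) * (ρ ^ 2 * (s * x)) ≤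
        A * E * (ρ * Real.sinh (ρ * (s * x / v))) :=
      (mul_le_mul_of_nonneg_right hAE i0).trans (mul_le_mul_of_nonneg_left i2 (by positivity))
    linarith
  · have : 0 ≤ 2 * A * E * (ρ * Real.sinh (ρ * (s * x / v))) := by
      have := i0.trans i2
      positivity
    linarith

/-- Weight measuring the distance to the boundary of a centered interval. -/
def bdryWeight (r x : ℝ) : ℝ := min |x ^ 2 - r ^ 2| 1

theorem bdryWeight_nonneg (r x : ℝ) : 0 ≤ bdryWeight r x := le_min (abs_nonneg _) zero_le_one

/-- `T_ρ` of a centered interval is decreasing in `|x|`, quantitatively near the sphere `|x| = r`. -/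
theorem evenOp_ball_gap {ρ : ℝ} (h : |ρ| ≤ 1 / 1000) {r s : ℝ} (hr : 0 ≤ r) (hs : 0 ≤ s)
    (hrs : ρ ^ 2 * (s ^ 2 + r ^ 2 + 1) ≤ 1 / 10) (x : ℝ) :
    (x ^ 2 ≤ r ^ 2 → 9 / 10 * (s * gpdf s) * ρ ^ 2 * bdryWeight r x ≤
      evenOp ρ (ind (Metric.ball (0 : ℝ) s)) x - evenOp ρ (ind (Metric.ball (0 : ℝ) s)) r) ∧
    (r ^ 2 ≤ x ^ 2 → 9 / 10 * (s * gpdf s) * ρ ^ 2 * bdryWeight r x ≤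
      evenOp ρ (ind (Metric.ball (0 : ℝ) s)) r - evenOp ρ (ind (Metric.ball (0 : ℝ) s)) x) := by
  have hd := hasDerivAt_evenOp_ball h hs
  have hφ := gpdf_pos s
  set u := evenOp ρ (ind (Metric.ball (0 : ℝ) s)) with hu
  set κ := 9 / 10 * (s * gpdf s) * ρ ^ 2 with hκ
  have anti : ∀ y z, 0 ≤ y → y ≤ z → u z ≤ u y := by
    intro y z hy hyz
    have := le_of_deriv_bound (F := fun x => -u x) (fun x => (hd x).fun_neg) hyz
      (fun x hx _ => by linarith [(evenOp_ball_deriv_le h hs (hy.trans hx.le)).2])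
    linarith
  -- The derivative bound loses at most a factor `9/10` as long as `x² ≤ r² + 1`. Farther out only
  -- monotonicity is used, which is why the weight is truncated at `1`.
  have quant : ∀ y z, 0 ≤ y → y ≤ z → z ^ 2 ≤ r ^ 2 + 1 → κ * (z ^ 2 - y ^ 2) ≤ u y - u z := by
    intro y z hy hyz hz
    have := le_of_deriv_bound (F := fun x => -u x - κ * x ^ 2)
      (fun x => (hd x).fun_neg.fun_sub ((hasDerivAt_pow 2 x).const_mul κ)) hyz
      (fun x hx hxz => by
        have hx0 := hy.trans hx.le
        have h1 := (evenOp_ball_deriv_le h hs hx0).1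
        have h2 : 9 / 10 ≤ 1 - ρ ^ 2 * (s ^ 2 + x ^ 2) := by
          have : ρ ^ 2 * (s ^ 2 + x ^ 2) ≤ ρ ^ 2 * (s ^ 2 + r ^ 2 + 1) := by
            have : x ^ 2 ≤ z ^ 2 := by gcongr
            exact mul_le_mul_of_nonneg_left (by linarith) (sq_nonneg ρ)
          linarith
        have h3 : 2 * ρ ^ 2 * (s * gpdf s) * x * (9 / 10) ≤
            2 * ρ ^ 2 * (s * gpdf s) * x * (1 - ρ ^ 2 * (s ^ 2 + x ^ 2)) := by gcongr
        rw [hκ]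
        norm_num
        linarith)
    linarith
  have hux : u |x| = u x := evenOp_abs ρ _ x
  rw [← hux]
  have hw : bdryWeight r x = bdryWeight r |x| := by simp [bdryWeight]
  rw [hw, ← sq_abs x]
  have hy := abs_nonneg x
  generalize |x| = y at *
  constructor
  · intro hyr
    have hyr' : y ≤ r := abs_le_of_sq_le_sq' hyr hr |>.2
    refine le_trans ?_ (quant y r hy hyr' (by linarith))
    have : bdryWeight r y ≤ r ^ 2 - y ^ 2 := by
      refine (min_le_left _ _).trans (le_of_eq ?_)
      rw [abs_sub_comm, abs_of_nonneg (by linarith)]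
    gcongr
  · intro hyr
    have hyr' : r ≤ y := abs_le_of_sq_le_sq' hyr hy |>.2
    rcases le_total (y ^ 2) (r ^ 2 + 1) with hy1 | hy1
    · refine le_trans ?_ (quant r y hr hyr' hy1)
      have : bdryWeight r y ≤ y ^ 2 - r ^ 2 := by
        refine (min_le_left _ _).trans (le_of_eq ?_)
        rw [abs_of_nonneg (by linarith)]
      gcongr
    · set z := Real.sqrt (r ^ 2 + 1) with hz
      have hz2 : z ^ 2 = r ^ 2 + 1 := Real.sq_sqrt (by positivity)
      have hz0 : 0 ≤ z := Real.sqrt_nonneg _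
      have hrz : r ≤ z := abs_le_of_sq_le_sq' (by linarith) hz0 |>.2
      have hzy : z ≤ y := abs_le_of_sq_le_sq' (by linarith) hy |>.2
      have i1 := quant r z hr hrz hz2.le
      have i2 := anti z y hz0 hzy
      have : κ * bdryWeight r y ≤ κ * (z ^ 2 - r ^ 2) := by
        have : bdryWeight r y ≤ z ^ 2 - r ^ 2 := by rw [hz2]; simp [bdryWeight]
        gcongr
      linarith

/-- First variation of the noise functional at a pair of caps. -/
theorem cap_first_variation {ρ : ℝ} (h : |ρ| ≤ 1 / 1000) {σ τ r s a κ : ℝ} {A B : Set ℝ} (hr : 0 < r)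
    (hs : 0 < s) (hrs : ρ ^ 2 * (s ^ 2 + r ^ 2 + 1) ≤ 1 / 10) (hA : IsCap σ r A) (hB : IsCap τ s B)
    (ha : SetClass a A) (hκ : κ ≤ 9 / 10 * (s * gpdf s)) {f : ℝ → ℝ} (hf : FunClass a f) :
    κ * ρ ^ 2 * ∫ x, |f x - ind A x| * bdryWeight r x ∂gamma1 ≤
      -(σ * τ * kernelForm (mehlerEven ρ) (fun x => f x - ind A x) (ind B)) := by
  have t := tameKernel_mehlerEven h
  have hφ := hf.unitBdd_sub (funClass_ind ha)
  have hBu := unitBdd_ind hB.measurableSet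
  have hint : Integrable (fun x => (f x - ind A x) * evenOp ρ (ind B) x) gamma1 := by
    have := (t.integrable hφ hBu).integral_prod_left
    simp only [mul_assoc, integral_const_mul] at this
    exact this
  -- The deviation has mean zero, so the boundary value at `r` may be subtracted. The two factors of
  -- the integrand then change sign together at `|x| = r`.
  have e : kernelForm (mehlerEven ρ) (fun x => f x - ind A x) (ind B) =
      ∫ x, (f x - ind A x) * (evenOp ρ (ind B) x - evenOp ρ (ind B) r) ∂gamma1 := by
    rw [kernelForm_iterated t hφ hBu]
    simp only [mul_sub]
    rw [integral_sub hint (hφ.integrable.mul_const _), integral_mul_const,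
      hf.integral_sub (funClass_ind ha), zero_mul, sub_zero]
    rfl
  rw [e, ← integral_const_mul, ← integral_const_mul, ← integral_neg]
  refine integral_mono ?_ ?_ fun x => ?_
  · refine Integrable.const_mul ?_ _
    refine Integrable.of_bound ((hφ.1.abs.mul ?_).aestronglyMeasurable) 1
      (Filter.Eventually.of_forall fun x => ?_)
    · unfold bdryWeight; fun_prop
    · rw [Real.norm_eq_abs, abs_mul, abs_abs, abs_of_nonneg (bdryWeight_nonneg _ _)]
      exact mul_le_one₀ (hφ.2 x) (bdryWeight_nonneg _ _) (min_le_right _ _)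
  · refine ((hint.sub (hφ.integrable.mul_const (evenOp ρ (ind B) r))).const_mul (σ * τ)).neg.congr
      (Filter.Eventually.of_forall fun x => ?_)
    simp only [Pi.neg_apply, Pi.sub_apply]
    ring
  · simp only
    have hsg := hA.sign hr (hf.2.1 x)
    obtain ⟨g1, g2⟩ := evenOp_ball_gap h hr.le hs.le hrs x
    have hw := bdryWeight_nonneg r x
    have hτ : τ * (evenOp ρ (ind B) x - evenOp ρ (ind B) r) =
        evenOp ρ (ind (Metric.ball (0 : ℝ) s)) x - evenOp ρ (ind (Metric.ball (0 : ℝ) s)) r := by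
      rcases hB with ⟨rfl, rfl⟩ | ⟨rfl, rfl⟩
      · ring
      · rw [evenOp_compl h Metric.isOpen_ball.measurableSet,
          evenOp_compl h Metric.isOpen_ball.measurableSet]
        ring
    set u := evenOp ρ (ind (Metric.ball (0 : ℝ) s))
    set φ := f x - ind A x
    have hgoal : -(σ * τ * (φ * (evenOp ρ (ind B) x - evenOp ρ (ind B) r))) =
        -(σ * φ * (u x - u r)) := by rw [← hτ]; ring
    rw [hgoal]
    have hκ' : κ * ρ ^ 2 * bdryWeight r x ≤ 9 / 10 * (s * gpdf s) * ρ ^ 2 * bdryWeight r x := by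
      gcongr
    rcases lt_trichotomy (x ^ 2) (r ^ 2) with hx | hx | hx
    · have h3 : σ * φ = -|φ| := by
        rw [abs_of_neg (by linarith : x ^ 2 - r ^ 2 < 0)] at hsg
        have : (σ * φ + |φ|) * (x ^ 2 - r ^ 2) = 0 := by linarith
        rcases mul_eq_zero.1 this with h | h <;> linarith
      rw [h3]
      have := mul_le_mul_of_nonneg_left (hκ'.trans (g1 hx.le)) (abs_nonneg φ)
      linarith
    · have h1 := hκ'.trans (g1 hx.le)
      have h2 := hκ'.trans (g2 hx.ge)
      have hw0 : bdryWeight r x = 0 := by simp [bdryWeight, hx]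
      rw [hw0] at h1 h2 ⊢
      have : u x - u r = 0 := by linarith
      rw [this]; simp
    · have h3 : σ * φ = |φ| := by
        rw [abs_of_pos (by linarith : 0 < x ^ 2 - r ^ 2)] at hsg
        have : (σ * φ - |φ|) * (x ^ 2 - r ^ 2) = 0 := by linarith
        rcases mul_eq_zero.1 this with h | h <;> linarith
      rw [h3]
      have := mul_le_mul_of_nonneg_left (hκ'.trans (g2 hx.le)) (abs_nonneg φ)
      linarith

/-! ### Second variation: the cross term. -/

theorem one_add_le_exp_twentieth (X : ℝ) : 1 + X ≤ 20 * Real.exp (X / 20) := by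
  have := Real.add_one_le_exp (X / 20)
  linarith [Real.exp_pos (X / 20)]

theorem sq_le_of_exp_le {p r : ℝ} (h : Real.exp (r ^ 2 / 4) ≤ 1 / p) :
    1 + r ^ 2 ≤ 4 / p := by
  have := Real.add_one_le_exp (r ^ 2 / 4)
  have : 4 / p = 4 * (1 / p) := by ring
  linarith

/-- The variable of larger modulus absorbs all growth, leaving the bounded weight on the other one.
The constant is `(4 · 20)² · 9/8`, and the exponents `1/20 + 1/20 + 1/40` add up to `1/8`. -/
theorem mixed_bound_of_le {ρ p r s : ℝ} (h : |ρ| ≤ 1 / 1000) (hp : 0 < p)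
    (hr : Real.exp (r ^ 2 / 4) ≤ 1 / p) (hs : Real.exp (s ^ 2 / 4) ≤ 1 / p)
    (hρ : |ρ| * (r ^ 2 + s ^ 2) ≤ 1 / 10) {x y : ℝ} (hxy : x ^ 2 ≤ y ^ 2) :
    |x ^ 2 - r ^ 2| * |y ^ 2 - s ^ 2| * Real.exp (|ρ| * (x ^ 2 + r ^ 2 + y ^ 2 + s ^ 2)) ≤
      7200 / p ^ 2 * (bdryWeight r x * Real.exp (y ^ 2 / 8)) := by
  have hR := sq_le_of_exp_le hr
  have hS := sq_le_of_exp_le hs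
  have hX0 := sq_nonneg x
  have hR0 := sq_nonneg r
  have hS0 := sq_nonneg s
  have hw0 := bdryWeight_nonneg r x
  have h1 : |x ^ 2 - r ^ 2| ≤ bdryWeight r x * ((4 / p) * (1 + y ^ 2)) := by
    have hge : 1 + (x ^ 2 + r ^ 2) ≤ (4 / p) * (1 + y ^ 2) := by
      calc 1 + (x ^ 2 + r ^ 2) ≤ (1 + r ^ 2) * (1 + y ^ 2) := by nlinarith
        _ ≤ _ := by gcongr
    unfold bdryWeight
    rcases le_total |x ^ 2 - r ^ 2| 1 with hle | hle
    · rw [min_eq_left hle]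
      exact le_mul_of_one_le_right (abs_nonneg _) (by linarith)
    · rw [min_eq_right hle, one_mul]
      refine le_trans ?_ hge
      rw [abs_le]; constructor <;> linarith
  have h2 : |y ^ 2 - s ^ 2| ≤ (4 / p) * (1 + y ^ 2) := by
    have : 1 + (y ^ 2 + s ^ 2) ≤ (4 / p) * (1 + y ^ 2) := by
      calc 1 + (y ^ 2 + s ^ 2) ≤ (1 + s ^ 2) * (1 + y ^ 2) := by nlinarith
        _ ≤ _ := by gcongr
    rw [abs_le]; constructor <;> linarith
  have h3 : Real.exp (|ρ| * (x ^ 2 + r ^ 2 + y ^ 2 + s ^ 2)) ≤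
      9 / 8 * Real.exp (y ^ 2 / 40) := by
    have e1 : Real.exp (1 / 10) ≤ 9 / 8 := by
      have := Real.exp_bound_div_one_sub_of_interval (x := 1 / 10) (by norm_num) (by norm_num)
      norm_num at *; linarith
    calc _ ≤ Real.exp (1 / 10 + y ^ 2 / 40) := by
          apply Real.exp_le_exp.2
          have : |ρ| * (x ^ 2 + y ^ 2) ≤ 1 / 1000 * (y ^ 2 + y ^ 2) := by gcongr
          linarith
      _ = Real.exp (1 / 10) * Real.exp (y ^ 2 / 40) := Real.exp_add _ _
      _ ≤ _ := by gcongr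
  have h4 := one_add_le_exp_twentieth (y ^ 2)
  calc _ ≤ (bdryWeight r x * ((4 / p) * (1 + y ^ 2))) * ((4 / p) * (1 + y ^ 2)) *
        (9 / 8 * Real.exp (y ^ 2 / 40)) := by gcongr
    _ ≤ (bdryWeight r x * ((4 / p) * (20 * Real.exp (y ^ 2 / 20)))) *
        ((4 / p) * (20 * Real.exp (y ^ 2 / 20))) * (9 / 8 * Real.exp (y ^ 2 / 40)) := by gcongr
    _ = 7200 / p ^ 2 * (bdryWeight r x *
        Real.exp (y ^ 2 / 20 + y ^ 2 / 20 + y ^ 2 / 40)) := by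
        rw [Real.exp_add, Real.exp_add]; field_simp; ring
    _ = _ := by ring_nf

theorem mixed_difference_weight {ρ p r s : ℝ} (h : |ρ| ≤ 1 / 1000) (hp : 0 < p) (hr0 : 0 ≤ r)
    (hs0 : 0 ≤ s) (hr : Real.exp (r ^ 2 / 4) ≤ 1 / p) (hs : Real.exp (s ^ 2 / 4) ≤ 1 / p)
    (hρ : |ρ| * (r ^ 2 + s ^ 2) ≤ 1 / 10) (x y : ℝ) :
    |mehlerEven ρ x y - mehlerEven ρ x s - mehlerEven ρ r y + mehlerEven ρ r s| ≤
      ρ ^ 2 * (7200 / p ^ 2) * (bdryWeight r x * Real.exp (y ^ 2 / 8) +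
        Real.exp (x ^ 2 / 8) * bdryWeight s y) := by
  have hm := abs_mixed_difference_le h hr0 hs0 x y
  have w1 := bdryWeight_nonneg r x
  have w2 := bdryWeight_nonneg s y
  refine hm.trans ?_
  rw [mul_assoc, mul_assoc, mul_assoc (ρ ^ 2)]
  refine mul_le_mul_of_nonneg_left ?_ (sq_nonneg ρ)
  rcases le_total (x ^ 2) (y ^ 2) with hxy | hxy
  · have := mixed_bound_of_le h hp hr hs hρ hxy
    rw [mul_assoc] at this
    refine this.trans ?_
    gcongr
    have : 0 ≤ Real.exp (x ^ 2 / 8) * bdryWeight s y := by positivity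
    linarith
  · have := mixed_bound_of_le h hp hs hr (by rwa [add_comm]) hxy
    calc _ = |y ^ 2 - s ^ 2| * |x ^ 2 - r ^ 2| *
          Real.exp (|ρ| * (y ^ 2 + s ^ 2 + x ^ 2 + r ^ 2)) := by
          rw [show x ^ 2 + r ^ 2 + y ^ 2 + s ^ 2 = y ^ 2 + s ^ 2 + x ^ 2 + r ^ 2 by ring]; ring
      _ ≤ _ := this
      _ ≤ _ := by
        gcongr
        have : 0 ≤ bdryWeight r x * Real.exp (y ^ 2 / 8) := by positivity
        linarith

theorem measurable_bdryWeight (r : ℝ) : Measurable (bdryWeight r) := by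
  unfold bdryWeight; fun_prop

theorem abs_bdryWeight_le (r x : ℝ) : |bdryWeight r x| ≤ 1 * Real.exp (x ^ 2 / 4) := by
  rw [abs_of_nonneg (bdryWeight_nonneg _ _), one_mul]
  exact (min_le_right _ _).trans (Real.one_le_exp (by positivity))

theorem abs_exp_eighth_le (x : ℝ) : |Real.exp (x ^ 2 / 8)| ≤ 1 * Real.exp (x ^ 2 / 4) := by
  rw [abs_of_pos (Real.exp_pos _), one_mul]
  exact Real.exp_le_exp.2 (by linarith [sq_nonneg x])

theorem TameKernel.add {k k' : ℝ → ℝ → ℝ} (hk : TameKernel k) (hk' : TameKernel k') :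
    TameKernel fun x y => k x y + k' x y := by
  obtain ⟨hkm, C, hC⟩ := hk
  obtain ⟨hkm', C', hC'⟩ := hk'
  refine ⟨hkm.add hkm', C + C', fun x y => ?_⟩
  rw [add_mul]
  exact (abs_add_le _ _).trans (add_le_add (hC x y) (hC' x y))

theorem TameKernel.const_mul {k : ℝ → ℝ → ℝ} (hk : TameKernel k) (c : ℝ) :
    TameKernel fun x y => c * k x y := by
  obtain ⟨hkm, C, hC⟩ := hk
  refine ⟨hkm.const_mul c, |c| * C, fun x y => ?_⟩
  rw [abs_mul, mul_assoc]
  exact mul_le_mul_of_nonneg_left (hC x y) (abs_nonneg c)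

theorem kernelForm_add_kernel {k k' : ℝ → ℝ → ℝ} (hk : TameKernel k) (hk' : TameKernel k')
    {f g : ℝ → ℝ} (hf : UnitBdd f) (hg : UnitBdd g) :
    kernelForm (fun x y => k x y + k' x y) f g = kernelForm k f g + kernelForm k' f g := by
  unfold kernelForm
  rw [← integral_add (hk.integrable hf hg) (hk'.integrable hf hg)]
  refine integral_congr_ae (Filter.Eventually.of_forall fun z => ?_)
  simp only
  ring

theorem kernelForm_const_mul (c : ℝ) (k : ℝ → ℝ → ℝ) (f g : ℝ → ℝ) :
    kernelForm (fun x y => c * k x y) f g = c * kernelForm k f g := by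
  unfold kernelForm
  rw [← integral_const_mul]
  refine integral_congr_ae (Filter.Eventually.of_forall fun z => ?_)
  simp only
  ring

/-- Bound for the second variation of the noise functional. -/
theorem cross_term_le {ρ p r s : ℝ} (h : |ρ| ≤ 1 / 1000) (hp : 0 < p) (hr0 : 0 ≤ r)
    (hs0 : 0 ≤ s) (hr : Real.exp (r ^ 2 / 4) ≤ 1 / p) (hs : Real.exp (s ^ 2 / 4) ≤ 1 / p)
    (hρ : |ρ| * (r ^ 2 + s ^ 2) ≤ 1 / 10) {φ ψ : ℝ → ℝ} (hφ : UnitBdd φ) (hψ : UnitBdd ψ)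
    (hφ0 : ∫ x, φ x ∂gamma1 = 0) (hψ0 : ∫ x, ψ x ∂gamma1 = 0) :
    |kernelForm (mehlerEven ρ) φ ψ| ≤ ρ ^ 2 * (7200 / p ^ 2) *
      ((∫ x, |φ x| * bdryWeight r x ∂gamma1) * (∫ y, |ψ y| * Real.exp (y ^ 2 / 8) ∂gamma1) +
       (∫ x, |φ x| * Real.exp (x ^ 2 / 8) ∂gamma1) * ∫ y, |ψ y| * bdryWeight s y ∂gamma1) := by
  have t := tameKernel_mehlerEven h
  have hcont := continuous_mehlerEven ρ
  have bound : ∀ s x : ℝ, |mehlerEven ρ x s| ≤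
      (2 * Real.exp (s ^ 2 / 8)) * Real.exp (x ^ 2 / 4) := by
    intro s x
    rw [abs_of_nonneg (mehlerEven_nonneg _ _ _)]
    have := mehlerEven_le h x s
    have e : Real.exp (x ^ 2 / 8) ≤ Real.exp (x ^ 2 / 4) :=
      Real.exp_le_exp.2 (by linarith [sq_nonneg x])
    calc _ ≤ 2 * Real.exp (x ^ 2 / 8) * Real.exp (s ^ 2 / 8) := this
      _ ≤ 2 * Real.exp (x ^ 2 / 4) * Real.exp (s ^ 2 / 8) := by gcongr
      _ = _ := by ring
  have one_bound : ∀ x : ℝ, |(1 : ℝ)| ≤ 1 * Real.exp (x ^ 2 / 4) := fun x => by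
    rw [abs_one, one_mul]; exact Real.one_le_exp (by positivity)
  have m1 : Measurable fun x => mehlerEven ρ x s :=
    (hcont.comp (continuous_id.prodMk continuous_const)).measurable
  have m2 : Measurable fun y => mehlerEven ρ r y :=
    (hcont.comp (continuous_const.prodMk continuous_id)).measurable
  have t1 : TameKernel fun x _ => mehlerEven ρ x s * 1 :=
    tameKernel_prod m1 measurable_const (bound s) one_bound
  have t2 : TameKernel fun _ y => 1 * (mehlerEven ρ r y - mehlerEven ρ r s) := by
    refine tameKernel_prod measurable_const (m2.sub measurable_const) one_bound
      (D := 2 * Real.exp (r ^ 2 / 8) + |mehlerEven ρ r s|) fun x => ?_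
    rw [add_mul]
    refine (abs_sub _ _).trans (add_le_add ?_ ?_)
    · rw [mehlerEven_comm]; exact bound r x
    · exact le_mul_of_one_le_right (abs_nonneg _) (Real.one_le_exp (by positivity))
  -- Terms depending on one variable only integrate to zero against deviations of mean zero.
  -- Removing them leaves the second mixed difference based at `(r, s)`.
  have e1 : kernelForm (fun x y => mehlerEven ρ x y - mehlerEven ρ x s * 1 -
      1 * (mehlerEven ρ r y - mehlerEven ρ r s)) φ ψ = kernelForm (mehlerEven ρ) φ ψ := by
    rw [kernelForm_sub_kernel (t.sub t1) t2 hφ hψ, kernelForm_sub_kernel t t1 hφ hψ,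
      kernelForm_prod (fun x => mehlerEven ρ x s) (fun _ => 1),
      kernelForm_prod (fun _ => 1) (fun y => mehlerEven ρ r y - mehlerEven ρ r s)]
    simp only [mul_one]
    rw [hφ0, hψ0]
    ring
  have mexp : Measurable fun x : ℝ => Real.exp (x ^ 2 / 8) := by fun_prop
  have t3 : TameKernel fun x y => bdryWeight r x * Real.exp (y ^ 2 / 8) :=
    tameKernel_prod (measurable_bdryWeight r) mexp (abs_bdryWeight_le r) abs_exp_eighth_le
  have t4 : TameKernel fun x y => Real.exp (x ^ 2 / 8) * bdryWeight s y :=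
    tameKernel_prod mexp (measurable_bdryWeight s) abs_exp_eighth_le (abs_bdryWeight_le s)
  rw [← e1]
  refine (abs_kernelForm_le ((t3.add t4).const_mul (ρ ^ 2 * (7200 / p ^ 2))) (fun x y => ?_)
    hφ hψ).trans (le_of_eq ?_)
  · have := mixed_difference_weight h hp hr0 hs0 hr hs hρ x y
    rw [show mehlerEven ρ x y - mehlerEven ρ x s * 1 - 1 * (mehlerEven ρ r y - mehlerEven ρ r s) =
      mehlerEven ρ x y - mehlerEven ρ x s - mehlerEven ρ r y + mehlerEven ρ r s by ring]
    exact this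
  · rw [kernelForm_const_mul, kernelForm_add_kernel t3 t4 hφ.abs hψ.abs,
      kernelForm_prod (bdryWeight r) fun y => Real.exp (y ^ 2 / 8),
      kernelForm_prod (fun x => Real.exp (x ^ 2 / 8)) (bdryWeight s)]

/-- A Cauchy–Schwarz estimate in the form of weighted AM–GM, with `|ψ|² ≤ |ψ|`. It turns an `L¹`
norm of size `t²` into a weighted norm of size `t`. -/
theorem integral_abs_mul_exp_le {ψ : ℝ → ℝ} (hψ : UnitBdd ψ) {t : ℝ} (ht : 0 < t)
    (h : ∫ x, |ψ x| ∂gamma1 ≤ t ^ 2) :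
    ∫ x, |ψ x| * Real.exp (x ^ 2 / 8) ∂gamma1 ≤ 5 / 4 * t := by
  have hpt : ∀ x, |ψ x| * Real.exp (x ^ 2 / 8) ≤
      t / 2 * Real.exp (x ^ 2 / 4) + 1 / (2 * t) * |ψ x| := by
    intro x
    have e : Real.exp (x ^ 2 / 4) = Real.exp (x ^ 2 / 8) ^ 2 := by
      rw [← Real.exp_nat_mul]; push_cast; ring_nf
    rw [e]
    have h1 := hψ.2 x
    have h0 := abs_nonneg (ψ x)
    have h2 : |ψ x| ^ 2 ≤ |ψ x| := by nlinarith
    have h3 : |ψ x| * Real.exp (x ^ 2 / 8) ≤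
        t / 2 * Real.exp (x ^ 2 / 8) ^ 2 + 1 / (2 * t) * |ψ x| ^ 2 := by
      have : t / 2 * Real.exp (x ^ 2 / 8) ^ 2 + 1 / (2 * t) * |ψ x| ^ 2 -
        |ψ x| * Real.exp (x ^ 2 / 8) = (t * Real.exp (x ^ 2 / 8) - |ψ x|) ^ 2 / (2 * t) := by
          field_simp; ring
      have : 0 ≤ (t * Real.exp (x ^ 2 / 8) - |ψ x|) ^ 2 / (2 * t) := by positivity
      linarith
    refine h3.trans ?_
    gcongr
  have i1 := gaussian_exp_quarter.1.const_mul (t / 2)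
  have i2 := hψ.abs.integrable.const_mul (1 / (2 * t))
  calc _ ≤ ∫ x, (t / 2 * Real.exp (x ^ 2 / 4) + 1 / (2 * t) * |ψ x|) ∂gamma1 := by
        refine integral_mono_of_nonneg (Filter.Eventually.of_forall fun x => by positivity)
          (i1.add i2) (Filter.Eventually.of_forall hpt)
    _ = t / 2 * ∫ x, Real.exp (x ^ 2 / 4) ∂gamma1 + 1 / (2 * t) * ∫ x, |ψ x| ∂gamma1 := by
        rw [integral_add i1 i2, integral_const_mul, integral_const_mul]
    _ ≤ t / 2 * (3 / 2) + 1 / (2 * t) * t ^ 2 := by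
        have := gaussian_exp_quarter.2
        gcongr
    _ = _ := by field_simp; ring

theorem integrable_weighted {φ : ℝ → ℝ} (hφ : UnitBdd φ) (r : ℝ) :
    Integrable (fun x => |φ x| * bdryWeight r x) gamma1 := by
  refine integrable_of_le_exp (hφ.1.abs.mul (measurable_bdryWeight r)) (C := 1) fun x => ?_
  rw [abs_mul, abs_abs, ← one_mul (1 * Real.exp (x ^ 2 / 4))]
  exact mul_le_mul (hφ.2 x) (abs_bdryWeight_le r x) (abs_nonneg _) zero_le_one

/-- The weight vanishes only at `r` and `-r`, which form a null set. This is the source of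
uniqueness up to null sets. -/
theorem ae_eq_zero_of_weighted {φ : ℝ → ℝ} (hφ : UnitBdd φ) {r : ℝ}
    (h : ∫ x, |φ x| * bdryWeight r x ∂gamma1 ≤ 0) : φ =ᵐ[gamma1] 0 := by
  have hnn : 0 ≤ fun x => |φ x| * bdryWeight r x := fun x =>
    mul_nonneg (abs_nonneg _) (bdryWeight_nonneg _ _)
  have h0 := (integral_eq_zero_iff_of_nonneg hnn (integrable_weighted hφ r)).1
    (le_antisymm h (integral_nonneg hnn))
  have : NullSingletonClass gamma1 := nullSingletonClass_gaussianReal one_ne_zero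
  have hne : ∀ᵐ x ∂gamma1, x ∉ ({r, -r} : Set ℝ) :=
    (Set.toFinite ({r, -r} : Set ℝ)).countable.ae_notMem _
  filter_upwards [h0, hne] with x hx hxr
  simp only [Pi.zero_apply, mul_eq_zero, abs_eq_zero] at hx ⊢
  refine hx.resolve_right fun hw => hxr ?_
  have : |x ^ 2 - r ^ 2| = 0 := by
    unfold bdryWeight at hw
    rcases min_choice |x ^ 2 - r ^ 2| 1 with h | h
    · rw [← h]; exact hw
    · rw [h] at hw; norm_num at hw
  have : x ^ 2 = r ^ 2 := by linarith [abs_eq_zero.1 this]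
  simpa using sq_eq_sq_iff_eq_or_eq_neg.1 this

/-! ### Strict local optimality of a pair of caps. -/

/-- A pair of caps is a strict local optimum of the noise functional. -/
theorem cap_pair_local {ρ p σ τ r s a b : ℝ} {A B : Set ℝ} (hp : 0 < p) (hp2 : p ≤ 1 / 2)
    (hρ : |ρ| ≤ p / 1000) (hr0 : 0 < r) (hs0 : 0 < s)
    (hr1 : p ≤ gaussMass r) (hr2 : gaussMass r ≤ 1 - p)
    (hs1 : p ≤ gaussMass s) (hs2 : gaussMass s ≤ 1 - p)
    (hA : IsCap σ r A) (hB : IsCap τ s B) (ha : SetClass a A) (hb : SetClass b B)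
    {f g : ℝ → ℝ} (hf : FunClass a f) (hg : FunClass b g)
    (hfs : ∫ x, |f x - ind A x| ∂gamma1 ≤ (15 / 1000000 * p ^ 3) ^ 2)
    (hgs : ∫ x, |g x - ind B x| ∂gamma1 ≤ (15 / 1000000 * p ^ 3) ^ 2) :
    ρ ^ 2 * (p / 20) * (∫ x, |f x - ind A x| * bdryWeight r x ∂gamma1 +
        ∫ x, |g x - ind B x| * bdryWeight s x ∂gamma1) ≤
      -(σ * τ * (kernelForm (mehlerEven ρ) f g - kernelForm (mehlerEven ρ) (ind A) (ind B))) := by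
  obtain ⟨-, hrφ, hr⟩ := radius_bounds hp hp2 hr0 hr1 hr2
  obtain ⟨-, hsφ, hs⟩ := radius_bounds hp hp2 hs0 hs1 hs2
  have hρ' : |ρ| ≤ 1 / 1000 := by linarith
  have hR := sq_le_of_exp_le hr
  have hS := sq_le_of_exp_le hs
  have hRS : |ρ| * (r ^ 2 + s ^ 2 + 1) ≤ 1 / 100 := by
    have : r ^ 2 + s ^ 2 + 1 ≤ 8 / p := by
      have : 8 / p = 4 / p + 4 / p := by ring
      linarith
    calc _ ≤ p / 1000 * (8 / p) := by gcongr
      _ ≤ _ := by field_simp; norm_num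
  have hRS1 : |ρ| * (r ^ 2 + s ^ 2) ≤ 1 / 10 := by
    have := abs_nonneg ρ
    linarith
  have hRS2 : ρ ^ 2 * (s ^ 2 + r ^ 2 + 1) ≤ 1 / 10 := by
    rw [← sq_abs ρ]
    have h0 : 0 ≤ |ρ| * (r ^ 2 + s ^ 2 + 1) := by positivity
    have : |ρ| ^ 2 * (s ^ 2 + r ^ 2 + 1) = |ρ| * (|ρ| * (r ^ 2 + s ^ 2 + 1)) := by ring
    rw [this]
    nlinarith [abs_nonneg ρ]
  have t := tameKernel_mehlerEven hρ'
  have hφ := hf.unitBdd_sub (funClass_ind ha)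
  have hψ := hg.unitBdd_sub (funClass_ind hb)
  have uA := unitBdd_ind hA.measurableSet
  have uB := unitBdd_ind hB.measurableSet
  -- The coefficient is `9/10` of the lower bound `p / 4` for `s φ(s)`.
  have f1 := cap_first_variation hρ' hr0 hs0 hRS2 hA hB ha (κ := 225 / 1000 * p)
    (by linarith) hf
  have f2 := cap_first_variation hρ' hs0 hr0 (by rwa [add_comm (r ^ 2)]) hB hA hb
    (κ := 225 / 1000 * p) (by linarith) hg
  rw [kernelForm_comm (mehlerEven_comm ρ)] at f2
  have hc := cross_term_le hρ' hp hr0.le hs0.le hr hs hRS1 hφ hψ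
    (hf.integral_sub (funClass_ind ha)) (hg.integral_sub (funClass_ind hb))
  have ht : 0 < 15 / 1000000 * p ^ 3 := by positivity
  have v1 := integral_abs_mul_exp_le hφ ht hfs
  have v2 := integral_abs_mul_exp_le hψ ht hgs
  have expand : kernelForm (mehlerEven ρ) f g - kernelForm (mehlerEven ρ) (ind A) (ind B) =
      kernelForm (mehlerEven ρ) (fun x => f x - ind A x) (ind B) +
      kernelForm (mehlerEven ρ) (ind A) (fun x => g x - ind B x) +
      kernelForm (mehlerEven ρ) (fun x => f x - ind A x) (fun x => g x - ind B x) := by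
    rw [kernelForm_sub_left t hf.unitBdd uA hψ, kernelForm_sub_left t hf.unitBdd uA uB,
      kernelForm_sub_right t uA hg.unitBdd uB, kernelForm_sub_right t hf.unitBdd hg.unitBdd uB]
    ring
  have hU : 0 ≤ ∫ x, |f x - ind A x| * bdryWeight r x ∂gamma1 :=
    integral_nonneg fun x => mul_nonneg (abs_nonneg _) (bdryWeight_nonneg _ _)
  have hW : 0 ≤ ∫ x, |g x - ind B x| * bdryWeight s x ∂gamma1 :=
    integral_nonneg fun x => mul_nonneg (abs_nonneg _) (bdryWeight_nonneg _ _)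
  rw [expand]
  generalize kernelForm (mehlerEven ρ) (fun x => f x - ind A x) (ind B) = F1 at *
  generalize kernelForm (mehlerEven ρ) (ind A) (fun x => g x - ind B x) = F2 at *
  generalize kernelForm (mehlerEven ρ) (fun x => f x - ind A x) (fun x => g x - ind B x) = F3 at *
  generalize ∫ x, |f x - ind A x| * bdryWeight r x ∂gamma1 = U at *
  generalize ∫ x, |g x - ind B x| * bdryWeight s x ∂gamma1 = W at *
  -- The `L¹` smallness is calibrated so that `7200 · 5/4 · 15/1000000 = 135/1000`. This lies below
  -- the `225/1000` of the first variation, with margin at least the claimed `1/20`.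
  have hc2 : |F3| ≤ ρ ^ 2 * (135 / 1000 * p) * (U + W) := by
    calc |F3| ≤ ρ ^ 2 * (7200 / p ^ 2) * (U * (5 / 4 * (15 / 1000000 * p ^ 3)) +
          (5 / 4 * (15 / 1000000 * p ^ 3)) * W) := by
          refine hc.trans ?_
          gcongr
      _ = _ := by field_simp; ring
  have hστ : |σ * τ * F3| = |F3| := by
    have : (σ * τ) ^ 2 = 1 := by rw [mul_pow, hA.sq_eq_one, hB.sq_eq_one, one_mul]
    rcases sq_eq_one_iff.1 this with h | h <;> simp [h]
  have hst2 := (le_abs_self (σ * τ * F3)).trans (hστ.le.trans hc2)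
  have hpos : 0 ≤ ρ ^ 2 * p * (U + W) := by positivity
  linarith

/-! ### The second Hermite coefficient: bathtub principle and stability. -/

/-- The unnormalised Hermite coefficient of degree two. -/
def secondCoeff (f : ℝ → ℝ) : ℝ := ∫ x, f x * (x ^ 2 - 1) ∂gamma1

theorem hermiteCoeff_two (f : ℝ → ℝ) : hermiteCoeff 2 f = Real.sqrt 2 / 2 * secondCoeff f := by
  rw [hermiteCoeff, secondCoeff, ← integral_const_mul]
  refine integral_congr_ae (Filter.Eventually.of_forall fun x => ?_)
  have : Polynomial.aeval x (Polynomial.hermite 2) = x ^ 2 - 1 := by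
    simp [Polynomial.hermite_succ]
    ring
  simp only [hermiteFn, this, Nat.factorial]
  push_cast
  ring_nf

theorem hermiteCoeff_two_mul (f g : ℝ → ℝ) :
    hermiteCoeff 2 f * hermiteCoeff 2 g = secondCoeff f * secondCoeff g / 2 := by
  rw [hermiteCoeff_two, hermiteCoeff_two]
  have := Real.mul_self_sqrt (show (0 : ℝ) ≤ 2 by norm_num)
  calc _ = (Real.sqrt 2 * Real.sqrt 2) / 4 * (secondCoeff f * secondCoeff g) := by ring
    _ = _ := by rw [this]; ring

theorem abs_sq_sub_le (r x : ℝ) :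
    |x ^ 2 - r ^ 2| ≤ (4 + r ^ 2) * Real.exp (x ^ 2 / 4) := by
  have := Real.add_one_le_exp (x ^ 2 / 4)
  have h0 := sq_nonneg x
  have h1 := sq_nonneg r
  have : x ^ 2 + r ^ 2 ≤ (4 + r ^ 2) * Real.exp (x ^ 2 / 4) := by nlinarith
  rw [abs_le]; constructor <;> linarith

theorem UnitBdd.integrable_mul_sq_sub {f : ℝ → ℝ} (hf : UnitBdd f) (r : ℝ) :
    Integrable (fun x => f x * (x ^ 2 - r ^ 2)) gamma1 := by
  refine integrable_of_le_exp (hf.1.mul (by fun_prop)) (C := 4 + r ^ 2) fun x => ?_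
  rw [abs_mul]
  exact (mul_le_of_le_one_left (abs_nonneg _) (hf.2 x)).trans (abs_sq_sub_le r x)

theorem UnitBdd.integrable_mul_sq_sub_one {f : ℝ → ℝ} (hf : UnitBdd f) :
    Integrable (fun x => f x * (x ^ 2 - 1)) gamma1 := by
  simpa using hf.integrable_mul_sq_sub 1

theorem secondCoeff_one : secondCoeff (fun _ => 1) = 0 := by
  have h1 := variance_fun_id_gaussianReal (μ := 0) (v := 1)
  rw [variance_of_integral_eq_zero (by fun_prop) (by simp)] at h1
  have h2 := unitBdd_one.integrable_mul_sq_sub 0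
  have h3 : Integrable (fun _ => (1 : ℝ)) gamma1 := integrable_const _
  simp only [one_mul, ne_eq, OfNat.ofNat_ne_zero, not_false_eq_true, zero_pow, sub_zero] at h2
  rw [secondCoeff]
  simp only [one_mul]
  rw [integral_sub h2 h3]
  simp at h1 ⊢
  linarith

theorem secondCoeff_sub {f g : ℝ → ℝ} (hf : UnitBdd f) (hg : UnitBdd g) :
    secondCoeff (fun x => f x - g x) = secondCoeff f - secondCoeff g := by
  rw [secondCoeff, secondCoeff, secondCoeff,
    ← integral_sub hf.integrable_mul_sq_sub_one hg.integrable_mul_sq_sub_one]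
  refine integral_congr_ae (Filter.Eventually.of_forall fun x => ?_)
  simp only
  ring

theorem secondCoeff_ball {r : ℝ} (hr : 0 ≤ r) :
    secondCoeff (ind (Metric.ball (0 : ℝ) r)) = -(2 * (r * gpdf r)) := by
  rw [secondCoeff, integral_ind_ball hr]
  have hd : ∀ y, HasDerivAt (fun y => -(y * gpdf y)) (gpdf y * (y ^ 2 - 1)) y := by
    intro y
    refine ((hasDerivAt_id y).fun_mul (hasDerivAt_gpdf y)).fun_neg.congr_deriv ?_
    simp only [id]
    ring
  have hc := continuous_gpdf
  rw [intervalIntegral.integral_eq_sub_of_hasDerivAt (fun y _ => hd y)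
    (by apply Continuous.intervalIntegrable; fun_prop), gpdf_neg]
  ring

theorem IsCap.secondCoeff_eq {σ r : ℝ} {A : Set ℝ} (h : IsCap σ r A) (hr : 0 ≤ r) :
    secondCoeff (ind A) = -(σ * (2 * (r * gpdf r))) := by
  rcases h with ⟨rfl, rfl⟩ | ⟨rfl, rfl⟩
  · rw [secondCoeff_ball hr]; ring
  · have : ind (Metric.ball (0 : ℝ) r)ᶜ = fun x => 1 - ind (Metric.ball (0 : ℝ) r) x :=
      funext (ind_compl _)
    rw [this, secondCoeff_sub unitBdd_one (unitBdd_ind Metric.isOpen_ball.measurableSet),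
      secondCoeff_one, secondCoeff_ball hr]
    ring

/-- The bathtub principle for the second Hermite coefficient. -/
theorem IsCap.excess {σ r a : ℝ} {A : Set ℝ} (h : IsCap σ r A) (hr : 0 < r) (ha : SetClass a A)
    {f : ℝ → ℝ} (hf : FunClass a f) :
    ∫ x, |f x - ind A x| * |x ^ 2 - r ^ 2| ∂gamma1 = σ * (secondCoeff f - secondCoeff (ind A)) := by
  have hA := funClass_ind ha
  have hφ := hf.unitBdd_sub hA
  rw [← secondCoeff_sub hf.unitBdd hA.unitBdd]
  -- The deviation has mean zero, so `1` may be replaced by `r²`. The integrand then has constant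
  -- sign.
  have e : secondCoeff (fun x => f x - ind A x) =
      ∫ x, (f x - ind A x) * (x ^ 2 - r ^ 2) ∂gamma1 := by
    have h0 := hf.integral_sub hA
    have i1 := hφ.integrable_mul_sq_sub_one
    have i2 := hφ.integrable.const_mul (1 - r ^ 2)
    have : ∫ x, ((f x - ind A x) * (x ^ 2 - 1) + (1 - r ^ 2) * (f x - ind A x)) ∂gamma1 =
        secondCoeff (fun x => f x - ind A x) := by
      rw [integral_add i1 i2, integral_const_mul, h0, mul_zero, add_zero, secondCoeff]
    rw [← this]
    refine integral_congr_ae (Filter.Eventually.of_forall fun x => ?_)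
    simp only
    ring
  rw [e, ← integral_const_mul]
  refine integral_congr_ae (Filter.Eventually.of_forall fun x => ?_)
  simp only
  rw [← h.sign hr (hf.2.1 x)]
  ring

theorem IsCap.excess_nonneg {σ r a : ℝ} {A : Set ℝ} (h : IsCap σ r A) (hr : 0 < r)
    (ha : SetClass a A) {f : ℝ → ℝ} (hf : FunClass a f) :
    0 ≤ σ * (secondCoeff f - secondCoeff (ind A)) := by
  rw [← h.excess hr ha hf]
  exact integral_nonneg fun x => mul_nonneg (abs_nonneg _) (abs_nonneg _)

theorem gamma1_real_Icc_le {u v : ℝ} (h : u ≤ v) :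
    gamma1.real (Set.Icc u v) ≤ 4 / 10 * (v - u) := by
  have h0 : 0 ≤ ∫ x in Set.Icc u v, gpdf x := integral_nonneg fun x => (gpdf_pos x).le
  rw [Measure.real, gaussianReal_apply_eq_integral _ one_ne_zero, ENNReal.toReal_ofReal h0,
    integral_Icc_eq_integral_Ioc, ← intervalIntegral.integral_of_le h]
  calc ∫ x in u..v, gpdf x ≤ ∫ _ in u..v, (4 / 10 : ℝ) :=
        intervalIntegral.integral_mono_on h (continuous_gpdf.intervalIntegrable _ _)
          (by simp) fun x _ => gpdf_le x
    _ = _ := by simp; ring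

/-- Since `|y² - r²| = |y - r| (y + r) ≥ r |y - r|` for `y ≥ 0`, the set lies within `δ / r` of `r`
or `-r`, and the density is at most `4/10`. -/
theorem gamma1_real_annulus_le {r δ : ℝ} (hr : 0 < r) (hδ : 0 < δ) :
    gamma1.real {x | |x ^ 2 - r ^ 2| < δ} ≤ 16 / 10 * (δ / r) := by
  have hsub : {x | |x ^ 2 - r ^ 2| < δ} ⊆
      Set.Icc (r - δ / r) (r + δ / r) ∪ Set.Icc (-r - δ / r) (-r + δ / r) := by
    intro x hx
    simp only [Set.mem_ofPred_eq] at hx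
    have key : ∀ y, 0 ≤ y → |y ^ 2 - r ^ 2| < δ → |y - r| ≤ δ / r := by
      intro y hy h
      rw [le_div_iff₀ hr]
      have e : |y ^ 2 - r ^ 2| = |y - r| * (y + r) := by
        rw [show y ^ 2 - r ^ 2 = (y - r) * (y + r) by ring, abs_mul,
          abs_of_nonneg (by linarith : 0 ≤ y + r)]
      rw [e] at h
      nlinarith [abs_nonneg (y - r)]
    rcases le_total 0 x with h0 | h0
    · left
      have := abs_le.1 (key x h0 hx)
      constructor <;> linarith
    · right
      have := abs_le.1 (key (-x) (by linarith) (by rwa [neg_sq]))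
      constructor <;> linarith
  have hpos : 0 ≤ δ / r := by positivity
  calc _ ≤ gamma1.real (Set.Icc (r - δ / r) (r + δ / r) ∪ Set.Icc (-r - δ / r) (-r + δ / r)) :=
        measureReal_mono hsub
    _ ≤ _ := measureReal_union_le _ _
    _ ≤ 4 / 10 * ((r + δ / r) - (r - δ / r)) + 4 / 10 * ((-r + δ / r) - (-r - δ / r)) :=
        add_le_add (gamma1_real_Icc_le (by linarith)) (gamma1_real_Icc_le (by linarith))
    _ = _ := by ring

/-- The `L¹` distance to a cap is controlled by the excess. -/
theorem integral_abs_le_of_excess {φ : ℝ → ℝ} (hφ : UnitBdd φ) {r δ : ℝ} (hr : 0 < r)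
    (hδ : 0 < δ) :
    ∫ x, |φ x| ∂gamma1 ≤ 16 / 10 * (δ / r) + (∫ x, |φ x| * |x ^ 2 - r ^ 2| ∂gamma1) / δ := by
  have hS : MeasurableSet {x : ℝ | |x ^ 2 - r ^ 2| < δ} :=
    measurableSet_lt (by fun_prop) measurable_const
  have i1 : Integrable (ind {x : ℝ | |x ^ 2 - r ^ 2| < δ}) gamma1 := (unitBdd_ind hS).integrable
  have i2 : Integrable (fun x => |φ x| * |x ^ 2 - r ^ 2| / δ) gamma1 := by
    have := (hφ.integrable_mul_sq_sub r).abs.div_const δ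
    simpa only [abs_mul] using this
  -- Near the boundary the deviation is bounded by `1`. Elsewhere the weight is at least `δ`, and
  -- Markov's inequality applies.
  calc _ ≤ ∫ x, (ind {x : ℝ | |x ^ 2 - r ^ 2| < δ} x + |φ x| * |x ^ 2 - r ^ 2| / δ) ∂gamma1 := by
        refine integral_mono hφ.abs.integrable (i1.add i2) fun x => ?_
        simp only
        by_cases hx : |x ^ 2 - r ^ 2| < δ
        · have h1 : ind {x : ℝ | |x ^ 2 - r ^ 2| < δ} x = 1 :=
            Set.indicator_of_mem (show x ∈ {x : ℝ | |x ^ 2 - r ^ 2| < δ} from hx) _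
          rw [h1]
          have := hφ.2 x
          have : 0 ≤ |φ x| * |x ^ 2 - r ^ 2| / δ := by positivity
          linarith
        · have h1 := ind_nonneg {x : ℝ | |x ^ 2 - r ^ 2| < δ} x
          have : |φ x| ≤ |φ x| * |x ^ 2 - r ^ 2| / δ := by
            rw [le_div_iff₀ hδ]
            exact mul_le_mul_of_nonneg_left (not_lt.1 hx) (abs_nonneg _)
          linarith
    _ = gamma1.real {x | |x ^ 2 - r ^ 2| < δ} + (∫ x, |φ x| * |x ^ 2 - r ^ 2| ∂gamma1) / δ := by
        rw [integral_add i1 i2, integral_div, (funClass_ind ⟨hS, rfl⟩).2.2]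
    _ ≤ _ := by linarith [gamma1_real_annulus_le hr hδ]

/-! ### Expansion of the noise functional and localization near a pair of caps. -/

/-- The remainder of the even Mehler kernel after its second-order expansion. -/
def remKernel (ρ x y : ℝ) : ℝ :=
  mehlerEven ρ x y - 1 - ρ ^ 2 / 2 * ((x ^ 2 - 1) * (y ^ 2 - 1))

theorem tameKernel_sq : TameKernel fun x y => (x ^ 2 - 1) * (y ^ 2 - 1) := by
  have h : ∀ x : ℝ, |x ^ 2 - 1| ≤ (4 + 1 ^ 2) * Real.exp (x ^ 2 / 4) := fun x => by
    simpa using abs_sq_sub_le 1 x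
  exact tameKernel_prod (u := fun x => x ^ 2 - 1) (w := fun x => x ^ 2 - 1) (by fun_prop)
    (by fun_prop) h h

theorem tameKernel_remKernel {ρ : ℝ} (h : |ρ| ≤ 1 / 1000) : TameKernel (remKernel ρ) :=
  ((tameKernel_mehlerEven h).sub (tameKernel_const 1)).sub (tameKernel_sq.const_mul _)

theorem remKernel_comm (ρ x y : ℝ) : remKernel ρ x y = remKernel ρ y x := by
  unfold remKernel
  rw [mehlerEven_comm, mul_comm (x ^ 2 - 1)]

/-- Second-order expansion of the noise functional. -/
theorem kernelForm_mehlerEven_eq {ρ : ℝ} (h : |ρ| ≤ 1 / 1000) {f g : ℝ → ℝ} (hf : UnitBdd f)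
    (hg : UnitBdd g) :
    kernelForm (mehlerEven ρ) f g = (∫ x, f x ∂gamma1) * (∫ x, g x ∂gamma1) +
      ρ ^ 2 / 2 * (secondCoeff f * secondCoeff g) + kernelForm (remKernel ρ) f g := by
  have t := tameKernel_mehlerEven h
  have t1 := tameKernel_const 1
  have t2 := tameKernel_sq.const_mul (ρ ^ 2 / 2)
  have e1 : kernelForm (remKernel ρ) f g = kernelForm (mehlerEven ρ) f g -
      kernelForm (fun _ _ => 1) f g -
      kernelForm (fun x y => ρ ^ 2 / 2 * ((x ^ 2 - 1) * (y ^ 2 - 1))) f g := by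
    rw [← kernelForm_sub_kernel t t1 hf hg, ← kernelForm_sub_kernel (t.sub t1) t2 hf hg]
    rfl
  have e2 := kernelForm_prod (fun _ => 1) (fun _ => 1) f g
  have e3 := kernelForm_prod (fun x => x ^ 2 - 1) (fun x => x ^ 2 - 1) f g
  simp only [mul_one] at e2
  rw [e1, e2, kernelForm_const_mul, e3, secondCoeff, secondCoeff]
  ring

/-- Only `g` is bounded by `1`. The weighted norm of `f` is kept, so that the estimate stays linear
in a small difference of indicators. -/
theorem abs_remForm_le {ρ : ℝ} (h : |ρ| ≤ 1 / 1000) {f g : ℝ → ℝ} (hf : UnitBdd f)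
    (hg : UnitBdd g) :
    |kernelForm (remKernel ρ) f g| ≤ 300000 * ρ ^ 4 *
      ∫ x, |f x| * Real.exp (x ^ 2 / 4) ∂gamma1 := by
  have hexp : ∀ x : ℝ, |Real.exp (x ^ 2 / 4)| ≤ 1 * Real.exp (x ^ 2 / 4) := fun x => by
    rw [abs_of_pos (Real.exp_pos _), one_mul]
  have t : TameKernel fun x y => Real.exp (x ^ 2 / 4) * Real.exp (y ^ 2 / 4) :=
    tameKernel_prod (by fun_prop) (by fun_prop) hexp hexp
  have h1 := abs_kernelForm_le (t.const_mul (200000 * ρ ^ 4))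
    (fun x y => abs_mehlerEven_sub_le h x y) hf hg
  rw [kernelForm_const_mul, kernelForm_prod (fun x => Real.exp (x ^ 2 / 4))
    (fun x => Real.exp (x ^ 2 / 4))] at h1
  refine h1.trans ?_
  have h2 : ∫ x, |g x| * Real.exp (x ^ 2 / 4) ∂gamma1 ≤ 3 / 2 := by
    refine le_trans ?_ gaussian_exp_quarter.2
    refine integral_mono_of_nonneg (Filter.Eventually.of_forall fun x => by positivity)
      gaussian_exp_quarter.1 (Filter.Eventually.of_forall fun x => ?_)
    exact mul_le_of_le_one_left (Real.exp_pos _).le (hg.2 x)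
  calc _ ≤ 200000 * ρ ^ 4 * ((∫ x, |f x| * Real.exp (x ^ 2 / 4) ∂gamma1) * (3 / 2)) := by gcongr
    _ = _ := by ring

theorem abs_remForm_le' {ρ : ℝ} (h : |ρ| ≤ 1 / 1000) {f g : ℝ → ℝ} (hf : UnitBdd f)
    (hg : UnitBdd g) : |kernelForm (remKernel ρ) f g| ≤ 450000 * ρ ^ 4 := by
  refine (abs_remForm_le h hf hg).trans ?_
  have h2 : ∫ x, |f x| * Real.exp (x ^ 2 / 4) ∂gamma1 ≤ 3 / 2 := by
    refine le_trans ?_ gaussian_exp_quarter.2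
    refine integral_mono_of_nonneg (Filter.Eventually.of_forall fun x => by positivity)
      gaussian_exp_quarter.1 (Filter.Eventually.of_forall fun x => ?_)
    exact mul_le_of_le_one_left (Real.exp_pos _).le (hf.2 x)
  calc _ ≤ 300000 * ρ ^ 4 * (3 / 2) := by gcongr
    _ = _ := by ring

/-- The choice `δ = 1500 |ρ|` balances the two terms of `integral_abs_le_of_excess`, each at most
`2400 |ρ| / p`. The assumed power of `p` then gives the `L¹` smallness required by `cap_pair_local`.
-/
theorem deviation_small {ρ p σ r a : ℝ} {A : Set ℝ} (hp : 0 < p) (hp2 : p ≤ 1 / 2)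
    (hρ : |ρ| ≤ 4 / 10 ^ 14 * p ^ 8) (hρ0 : ρ ≠ 0) (hpr : p ≤ r)
    (hA : IsCap σ r A) (ha : SetClass a A) {f : ℝ → ℝ} (hf : FunClass a f)
    (hex : p / 2 * (σ * (secondCoeff f - secondCoeff (ind A))) ≤ 1800000 * ρ ^ 2) :
    ∫ x, |f x - ind A x| ∂gamma1 ≤ (15 / 1000000 * p ^ 3) ^ 2 := by
  have hr : 0 < r := hp.trans_le hpr
  have hρ1 : 0 < |ρ| := abs_pos.2 hρ0
  rw [← hA.excess hr ha hf, ← sq_abs ρ] at hex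
  have h1 := integral_abs_le_of_excess (hf.unitBdd_sub (funClass_ind ha)) hr
    (δ := 1500 * |ρ|) (by positivity)
  generalize ∫ x, |f x - ind A x| * |x ^ 2 - r ^ 2| ∂gamma1 = X at *
  generalize |ρ| = e at *
  have hX : X ≤ 3600000 * e ^ 2 / p := by
    rw [le_div_iff₀ hp]; linarith
  have h2 : X / (1500 * e) ≤ 2400 * e / p := by
    rw [div_le_iff₀ (by positivity)]
    refine hX.trans (le_of_eq ?_)
    field_simp; ring
  have h3 : 16 / 10 * (1500 * e / r) ≤ 2400 * e / p := by
    calc _ ≤ 16 / 10 * (1500 * e / p) := by gcongr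
      _ = _ := by ring
  have h4 : 4800 * e / p ≤ 4800 * (4 / 10 ^ 14 * p ^ 8) / p := by gcongr
  have h5 : 4800 * (4 / 10 ^ 14 * p ^ 8) / p = 4800 * 4 / 10 ^ 14 * p ^ 6 * p := by
    field_simp
  have h6 : 4800 * 4 / 10 ^ 14 * p ^ 6 * p ≤ 4800 * 4 / 10 ^ 14 * p ^ 6 * (1 / 2) := by gcongr
  have h7 : 4800 * e / p = 2400 * e / p + 2400 * e / p := by ring
  have h8 : (15 / 1000000 * p ^ 3) ^ 2 = 225 / 10 ^ 12 * p ^ 6 := by ring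
  have h9 : 0 ≤ p ^ 6 := by positivity
  rw [h8]
  norm_num at *
  linarith

/-- Competitors at least as good as a pair of caps, on its side of the second-order landscape, are
worse unless they agree with the pair almost everywhere. -/
theorem cap_pair_optimal {ρ p σ τ r s a b : ℝ} {A B : Set ℝ} (hp : 0 < p) (hp2 : p ≤ 1 / 2)
    (hρ : |ρ| ≤ 4 / 10 ^ 14 * p ^ 8) (hρ0 : ρ ≠ 0) (hr0 : 0 < r) (hs0 : 0 < s)
    (hr1 : p ≤ gaussMass r) (hr2 : gaussMass r ≤ 1 - p)
    (hs1 : p ≤ gaussMass s) (hs2 : gaussMass s ≤ 1 - p)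
    (hA : IsCap σ r A) (hB : IsCap τ s B) (ha : SetClass a A) (hb : SetClass b B)
    {f g : ℝ → ℝ} (hf : FunClass a f) (hg : FunClass b g) (hside : σ * secondCoeff f ≤ 0)
    (hsec : σ * τ * (secondCoeff (ind A) * secondCoeff (ind B)) - 1800000 * ρ ^ 2 ≤
      σ * τ * (secondCoeff f * secondCoeff g)) :
    0 ≤ -(σ * τ * (kernelForm (mehlerEven ρ) f g - kernelForm (mehlerEven ρ) (ind A) (ind B))) ∧
    (kernelForm (mehlerEven ρ) f g = kernelForm (mehlerEven ρ) (ind A) (ind B) →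
      f =ᵐ[gamma1] ind A ∧ g =ᵐ[gamma1] ind B) := by
  obtain ⟨hpr, hrφ, -⟩ := radius_bounds hp hp2 hr0 hr1 hr2
  obtain ⟨hps, hsφ, -⟩ := radius_bounds hp hp2 hs0 hs1 hs2
  have hp8 : p ^ 8 ≤ p * (1 / 128) := by
    have : p ^ 7 ≤ (1 / 2) ^ 7 := pow_le_pow_left₀ hp.le hp2 7
    calc p ^ 8 = p * p ^ 7 := by ring
      _ ≤ p * (1 / 2) ^ 7 := by gcongr
      _ = _ := by norm_num
  have hρp : |ρ| ≤ p / 1000 := by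
    norm_num at hρ
    linarith
  have eA := hA.excess_nonneg hr0 ha hf
  have eB := hB.excess_nonneg hs0 hb hg
  have hσ := hA.sq_eq_one
  have hτ := hB.sq_eq_one
  have ds := deviation_small hp hp2 hρ hρ0 hpr hA ha hf
  have dt := deviation_small hp hp2 hρ hρ0 hps hB hb hg
  have cA := hA.secondCoeff_eq hr0.le
  have cB := hB.secondCoeff_eq hs0.le
  rw [cA] at ds eA hsec
  rw [cB] at dt eB hsec
  set m := 2 * (r * gpdf r) with hm
  set M := 2 * (s * gpdf s) with hM
  have hm2 : p / 2 ≤ m := by linarith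
  have hM2 : p / 2 ≤ M := by linarith
  set P := σ * secondCoeff f with hP
  set Q := τ * secondCoeff g with hQ
  have e1 : σ * (secondCoeff f - -(σ * m)) = P + m := by
    rw [hP]; linear_combination m * hσ
  have e2 : τ * (secondCoeff g - -(τ * M)) = Q + M := by
    rw [hQ]; linear_combination M * hτ
  have e3 : σ * τ * (-(σ * m) * -(τ * M)) = m * M := by
    linear_combination m * M * (τ ^ 2 * hσ + hτ)
  have e4 : σ * τ * (secondCoeff f * secondCoeff g) = P * Q := by rw [hP, hQ]; ring
  rw [e1] at eA ds
  rw [e2] at eB dt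
  rw [e3, e4] at hsec
  -- The tolerance is smaller than the optimal product `m M`, so the competitor's product `P Q` is
  -- positive and `Q` must have the same strict sign as `P`.
  have hη : 1800000 * ρ ^ 2 < m * M := by
    have h1 : |ρ| * |ρ| ≤ (4 / 10 ^ 14 * (p * (1 / 128))) * (4 / 10 ^ 14 * (p * (1 / 128))) := by
      gcongr <;> exact hρ.trans (by gcongr)
    have h2 : p / 2 * (p / 2) ≤ m * M :=
      mul_le_mul hm2 hM2 (by positivity) (by linarith)
    rw [abs_mul_abs_self] at h1
    have : 0 < p * p := by positivity
    norm_num at h1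
    nlinarith
  have hQ0 : Q < 0 := by
    by_contra hcon
    push Not at hcon
    nlinarith
  -- The identity `m M - P Q = M (P + m) + (-P) (Q + M)` is a sum of nonnegative terms, so the total
  -- defect bounds the first excess. The second follows with the roles exchanged.
  have d1 : p / 2 * (P + m) ≤ 1800000 * ρ ^ 2 := by
    have : p / 2 * (P + m) ≤ M * (P + m) := by gcongr
    nlinarith
  have d2 : p / 2 * (Q + M) ≤ 1800000 * ρ ^ 2 := by
    have : p / 2 * (Q + M) ≤ m * (Q + M) := by gcongr
    nlinarith
  have main := cap_pair_local hp hp2 hρp hr0 hs0 hr1 hr2 hs1 hs2 hA hB ha hb hf hg (ds d1) (dt d2)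
  have hU : 0 ≤ ∫ x, |f x - ind A x| * bdryWeight r x ∂gamma1 :=
    integral_nonneg fun x => mul_nonneg (abs_nonneg _) (bdryWeight_nonneg _ _)
  have hW : 0 ≤ ∫ x, |g x - ind B x| * bdryWeight s x ∂gamma1 :=
    integral_nonneg fun x => mul_nonneg (abs_nonneg _) (bdryWeight_nonneg _ _)
  have hcoef : 0 < ρ ^ 2 * (p / 20) := by positivity
  constructor
  · exact le_trans (by positivity) main
  · intro heq
    rw [heq, sub_self, mul_zero, neg_zero] at main
    have hsum := nonpos_of_mul_nonpos_right main hcoef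
    have z1 := ae_eq_zero_of_weighted (hf.unitBdd_sub (funClass_ind ha)) (r := r) (by linarith)
    have z2 := ae_eq_zero_of_weighted (hg.unitBdd_sub (funClass_ind hb)) (r := s) (by linarith)
    constructor
    · filter_upwards [z1] with x hx
      simpa [sub_eq_zero] using hx
    · filter_upwards [z2] with x hx
      simpa [sub_eq_zero] using hx

/-! ### Comparison of the two centered pairs. -/

/-- The radius of the centered interval of given Gaussian measure. -/
def massRadius (t : ℝ) : ℝ := Function.invFun gaussMass t

theorem massRadius_gaussMass (r : ℝ) : massRadius (gaussMass r) = r :=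
  Function.leftInverse_invFun strictMono_gaussMass.injective r

theorem gaussMass_massRadius {t : ℝ} (h0 : 0 < t) (h1 : t < 1) : gaussMass (massRadius t) = t := by
  obtain ⟨r, -, hr⟩ := exists_radius h0 h1
  exact Function.invFun_eq ⟨r, hr⟩

theorem massRadius_pos {t : ℝ} (h0 : 0 < t) (h1 : t < 1) : 0 < massRadius t := by
  obtain ⟨r, hr0, hr⟩ := exists_radius h0 h1
  rwa [← hr, massRadius_gaussMass]

theorem continuousAt_massRadius {t : ℝ} (h0 : 0 < t) (h1 : t < 1) :
    ContinuousAt massRadius t := by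
  have hev : ∀ᶠ y in nhds t, 0 < y ∧ y < 1 := (lt_mem_nhds h0).and (gt_mem_nhds h1)
  refine tendsto_order.2 ⟨fun c hc => ?_, fun c hc => ?_⟩
  · have : gaussMass c < t := by
      rw [← gaussMass_massRadius h0 h1]; exact strictMono_gaussMass hc
    filter_upwards [hev, lt_mem_nhds this] with y hy hcy
    rw [← gaussMass_massRadius hy.1 hy.2] at hcy
    exact strictMono_gaussMass.lt_iff_lt.1 hcy
  · have : t < gaussMass c := by
      conv_lhs => rw [← gaussMass_massRadius h0 h1]
      exact strictMono_gaussMass hc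
    filter_upwards [hev, gt_mem_nhds this] with y hy hcy
    rw [← gaussMass_massRadius hy.1 hy.2] at hcy
    exact strictMono_gaussMass.lt_iff_lt.1 hcy

theorem hasDerivAt_massRadius {t : ℝ} (h0 : 0 < t) (h1 : t < 1) :
    HasDerivAt massRadius (2 * gpdf (massRadius t))⁻¹ t := by
  refine (hasDerivAt_gaussMass _).of_local_left_inverse (continuousAt_massRadius h0 h1)
    (by have := gpdf_pos (massRadius t); positivity) ?_
  filter_upwards [lt_mem_nhds h0, gt_mem_nhds h1] with y hy0 hy1
  exact gaussMass_massRadius hy0 hy1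

/-- Half of the absolute second coefficient of the centered interval of measure `t`. -/
def massCoeff (t : ℝ) : ℝ := massRadius t * gpdf (massRadius t)

/-- In terms of the radius, `dt = 2 φ(r) dr` and `d(r φ(r)) = (1 - r²) φ(r) dr`. -/
theorem hasDerivAt_massCoeff {t : ℝ} (h0 : 0 < t) (h1 : t < 1) :
    HasDerivAt massCoeff ((1 - massRadius t ^ 2) / 2) t := by
  have h := hasDerivAt_massRadius h0 h1
  have hφ := gpdf_pos (massRadius t)
  refine (h.fun_mul ((hasDerivAt_gpdf _).comp t h)).congr_deriv ?_
  simp only [Function.comp]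
  field_simp
  ring

theorem massCoeff_bounds {p t : ℝ} (hp : 0 < p) (hp2 : p ≤ 1 / 2) (h1 : p ≤ t) (h2 : t ≤ 1 - p) :
    p / 4 ≤ massCoeff t ∧ massCoeff t ≤ 1 := by
  have t0 : 0 < t := hp.trans_le h1
  have t1 : t < 1 := by linarith
  have hr := massRadius_pos t0 t1
  have hm := gaussMass_massRadius t0 t1
  refine ⟨(radius_bounds hp hp2 hr (by rw [hm]; exact h1) (by rw [hm]; exact h2)).2.1, ?_⟩
  have := le_gaussMass hr.le
  rw [hm] at this
  unfold massCoeff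
  linarith

/-- Quantitative monotonicity of the ratio of the coefficients of an interval and its complement. -/
theorem massCoeff_cross_lower {p a b : ℝ} (hp : 0 < p) (hp2 : p ≤ 1 / 2) (hb : p ≤ b) (hab : b < a)
    (ha : a ≤ 1 - p) :
    p ^ 3 / 320 * (a - b) ≤ massCoeff a * massCoeff (1 - b) - massCoeff (1 - a) * massCoeff b := by
  have hbd : ∀ t, b ≤ t → t ≤ a → HasDerivAt (fun t => massCoeff t / massCoeff (1 - t))
      (((1 - massRadius t ^ 2) / 2 * massCoeff (1 - t) + massCoeff t *
        ((1 - massRadius (1 - t) ^ 2) / 2)) / massCoeff (1 - t) ^ 2) t := by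
    intro t h1 h2
    have hn := (massCoeff_bounds hp hp2 (t := 1 - t) (by linarith) (by linarith)).1
    have d1 := hasDerivAt_massCoeff (t := t) (by linarith) (by linarith)
    have d2 := (hasDerivAt_massCoeff (t := 1 - t) (by linarith) (by linarith)).comp t
      ((hasDerivAt_id t).const_sub 1)
    refine (d1.fun_div d2 (by simp only [Function.comp]; linarith)).congr_deriv ?_
    simp only [Function.comp]
    ring
  -- By the mean value theorem the increment of the ratio is `a - b` times a derivative bounded
  -- below through `wronskian_lower`. Clearing the denominators `n (1 - a)` and `n (1 - b)`, each at
  -- least `p / 4`, costs `p² / 16`.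
  obtain ⟨t, ht, hslope⟩ := exists_hasDerivAt_eq_slope (fun t => massCoeff t / massCoeff (1 - t)) _
    hab (fun t ht => (hbd t ht.1 ht.2).continuousAt.continuousWithinAt)
    (fun t ht => hbd t ht.1.le ht.2.le)
  have t0 : 0 < t := by linarith [ht.1]
  have t1 : t < 1 := by linarith [ht.2]
  have hmt := gaussMass_massRadius t0 t1
  have hms := gaussMass_massRadius (t := 1 - t) (by linarith) (by linarith)
  have hw := wronskian_lower hp2 (massRadius_pos t0 t1)
    (massRadius_pos (t := 1 - t) (by linarith) (by linarith)) (by rw [hmt, hms]; ring)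
    (by rw [hmt]; linarith [ht.1]) (by rw [hms]; linarith [ht.2])
  have hnt := massCoeff_bounds hp hp2 (t := 1 - t) (by linarith [ht.2]) (by linarith [ht.1])
  have hna := massCoeff_bounds hp hp2 (t := 1 - a) (by linarith) (by linarith)
  have hnb := massCoeff_bounds hp hp2 (t := 1 - b) (by linarith) (by linarith)
  have hlow : p / 20 ≤ ((1 - massRadius t ^ 2) / 2 * massCoeff (1 - t) + massCoeff t *
        ((1 - massRadius (1 - t) ^ 2) / 2)) / massCoeff (1 - t) ^ 2 := by
    have h0 : 0 < massCoeff (1 - t) := by linarith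
    rw [le_div_iff₀ (by positivity)]
    have : massCoeff (1 - t) ^ 2 ≤ 1 := pow_le_one₀ h0.le hnt.2
    have h3 : p / 20 * massCoeff (1 - t) ^ 2 ≤ p / 20 * 1 := by gcongr
    unfold massCoeff at *
    linarith
  rw [hslope, le_div_iff₀ (by linarith)] at hlow
  have pa : 0 < massCoeff (1 - a) := by linarith
  have pb : 0 < massCoeff (1 - b) := by linarith
  have hprod : p / 4 * (p / 4) ≤ massCoeff (1 - a) * massCoeff (1 - b) := by
    apply mul_le_mul hna.1 hnb.1 (by positivity) pa.le
  have e : massCoeff a * massCoeff (1 - b) - massCoeff (1 - a) * massCoeff b =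
      massCoeff (1 - a) * massCoeff (1 - b) *
        (massCoeff a / massCoeff (1 - a) - massCoeff b / massCoeff (1 - b)) := by
    field_simp
  rw [e]
  calc p ^ 3 / 320 * (a - b) = p / 4 * (p / 4) * (p / 20 * (a - b)) := by ring
    _ ≤ _ := by
      have : 0 ≤ p / 20 * (a - b) := mul_nonneg (by positivity) (by linarith)
      exact mul_le_mul hprod hlow this (by positivity)

theorem integral_annulus_exp_le {r r' : ℝ} (hr' : 0 ≤ r') (h : r' ≤ r) :
    ∫ x, |ind (Metric.ball (0 : ℝ) r) x - ind (Metric.ball (0 : ℝ) r') x| *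
      Real.exp (x ^ 2 / 4) ∂gamma1 ≤ Real.exp (r ^ 2 / 4) * (gaussMass r - gaussMass r') := by
  have hr := hr'.trans h
  have hc : ∀ s : ℝ, 0 ≤ s → FunClass (gaussMass s) (ind (Metric.ball (0 : ℝ) s)) := fun s hs =>
    funClass_ind ⟨Metric.isOpen_ball.measurableSet, gamma1_real_ball hs⟩
  have c1 := hc r hr
  have c2 := hc r' hr'
  have hsub := Metric.ball_subset_ball (x := (0 : ℝ)) h
  rw [← c1.2.2, ← c2.2.2, ← integral_sub c1.unitBdd.integrable c2.unitBdd.integrable,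
    ← integral_const_mul]
  refine integral_mono_of_nonneg (Filter.Eventually.of_forall fun x => by positivity)
    ((c1.unitBdd.integrable.sub c2.unitBdd.integrable).const_mul _)
    (Filter.Eventually.of_forall fun x => ?_)
  simp only
  have hmono : ind (Metric.ball (0 : ℝ) r') x ≤ ind (Metric.ball (0 : ℝ) r) x :=
    Set.indicator_le_indicator_of_subset hsub (fun _ => zero_le_one) x
  rw [abs_of_nonneg (by linarith), mul_comm]
  by_cases hx : x ∈ Metric.ball (0 : ℝ) r
  · have : x ^ 2 ≤ r ^ 2 := by
      rw [mem_ball_zero_iff, Real.norm_eq_abs] at hx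
      rw [← sq_abs]
      exact pow_le_pow_left₀ (abs_nonneg x) hx.le 2
    have := sub_nonneg.2 hmono
    gcongr
  · have h1 : ind (Metric.ball (0 : ℝ) r) x = 0 := Set.indicator_of_notMem hx _
    have h2 : ind (Metric.ball (0 : ℝ) r') x = 0 :=
      Set.indicator_of_notMem (fun h => hx (hsub h)) _
    rw [h1, h2]; simp

/-- The two pairs of caps of measures `b < a` are ordered in the same way by the product of the
second coefficients and by the noise functional. -/
theorem cap_pairs_compare {ρ p a b : ℝ} (hp : 0 < p) (hp2 : p ≤ 1 / 2)
    (hρ : |ρ| ≤ 4 / 10 ^ 14 * p ^ 8) (hρ0 : ρ ≠ 0) (hb : p ≤ b) (hab : b < a) (ha : a ≤ 1 - p)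
    {r₁ s₁ r₂ s₂ : ℝ} (hr₁ : 0 < r₁) (hs₁ : 0 < s₁) (hr₂ : 0 < r₂) (hs₂ : 0 < s₂)
    (mr₁ : gaussMass r₁ = a) (ms₁ : gaussMass s₁ = 1 - b) (mr₂ : gaussMass r₂ = 1 - a)
    (ms₂ : gaussMass s₂ = b) :
    secondCoeff (ind (Metric.ball (0 : ℝ) r₁)) * secondCoeff (ind (Metric.ball (0 : ℝ) s₁)ᶜ) <
      secondCoeff (ind (Metric.ball (0 : ℝ) r₂)ᶜ) * secondCoeff (ind (Metric.ball (0 : ℝ) s₂)) ∧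
    kernelForm (mehlerEven ρ) (ind (Metric.ball (0 : ℝ) r₁)) (ind (Metric.ball (0 : ℝ) s₁)ᶜ) <
      kernelForm (mehlerEven ρ) (ind (Metric.ball (0 : ℝ) r₂)ᶜ)
        (ind (Metric.ball (0 : ℝ) s₂)) := by
  have hp8 : p ^ 8 ≤ p ^ 2 := pow_le_pow_of_le_one hp.le (by linarith) (by norm_num)
  have hpp : p ^ 2 ≤ 1 / 4 := by nlinarith
  have hρ' : |ρ| ≤ 1 / 1000 := by
    norm_num at hρ
    linarith
  have hmc := massCoeff_cross_lower hp hp2 hb hab ha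
  have n1 : massCoeff a = r₁ * gpdf r₁ := by rw [← mr₁, massCoeff, massRadius_gaussMass]
  have n2 : massCoeff (1 - b) = s₁ * gpdf s₁ := by rw [← ms₁, massCoeff, massRadius_gaussMass]
  have n3 : massCoeff (1 - a) = r₂ * gpdf r₂ := by rw [← mr₂, massCoeff, massRadius_gaussMass]
  have n4 : massCoeff b = s₂ * gpdf s₂ := by rw [← ms₂, massCoeff, massRadius_gaussMass]
  rw [n1, n2, n3, n4] at hmc
  have q1 := IsCap.secondCoeff_eq (σ := 1) (Or.inl ⟨rfl, rfl⟩) hr₁.le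
  have q2 := IsCap.secondCoeff_eq (σ := -1) (Or.inr ⟨rfl, rfl⟩) hs₁.le
  have q3 := IsCap.secondCoeff_eq (σ := -1) (Or.inr ⟨rfl, rfl⟩) hr₂.le
  have q4 := IsCap.secondCoeff_eq (σ := 1) (Or.inl ⟨rfl, rfl⟩) hs₂.le
  have mB : ∀ r : ℝ, MeasurableSet (Metric.ball (0 : ℝ) r) := fun r =>
    Metric.isOpen_ball.measurableSet
  have hV : secondCoeff (ind (Metric.ball (0 : ℝ) r₁)) *
      secondCoeff (ind (Metric.ball (0 : ℝ) s₁)ᶜ) - secondCoeff (ind (Metric.ball (0 : ℝ) r₂)ᶜ) *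
      secondCoeff (ind (Metric.ball (0 : ℝ) s₂)) ≤ -(p ^ 3 / 80 * (a - b)) := by
    rw [q1, q2, q3, q4]
    linarith
  have hd : 0 < a - b := by linarith
  have hneg : 0 < p ^ 3 / 80 * (a - b) := by positivity
  refine ⟨by linarith, ?_⟩
  have t := tameKernel_remKernel hρ'
  have u1 := unitBdd_ind (mB r₁)
  have u2 := unitBdd_ind (mB s₁).compl
  have u3 := unitBdd_ind (mB r₂).compl
  have u4 := unitBdd_ind (mB s₂)
  have c1 : FunClass a (ind (Metric.ball (0 : ℝ) r₁)) :=
    funClass_ind ⟨mB r₁, by rw [gamma1_real_ball hr₁.le, mr₁]⟩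
  have c2 : FunClass b (ind (Metric.ball (0 : ℝ) s₁)ᶜ) :=
    funClass_ind ⟨(mB s₁).compl, by rw [gamma1_real_ball_compl hs₁.le, ms₁]; ring⟩
  have c3 : FunClass a (ind (Metric.ball (0 : ℝ) r₂)ᶜ) :=
    funClass_ind ⟨(mB r₂).compl, by rw [gamma1_real_ball_compl hr₂.le, mr₂]; ring⟩
  have c4 : FunClass b (ind (Metric.ball (0 : ℝ) s₂)) :=
    funClass_ind ⟨mB s₂, by rw [gamma1_real_ball hs₂.le, ms₂]⟩
  have rem1 := abs_remForm_le hρ' (c1.unitBdd_sub c4) u2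
  have rem2 := abs_remForm_le hρ' (c2.unitBdd_sub c3) u4
  have hsr : s₂ ≤ r₁ := strictMono_gaussMass.le_iff_le.1 (by rw [mr₁, ms₂]; exact hab.le)
  have hrs : r₂ ≤ s₁ := strictMono_gaussMass.le_iff_le.1 (by rw [mr₂, ms₁]; linarith)
  have x1 := integral_annulus_exp_le hs₂.le hsr
  have x2 := integral_annulus_exp_le hr₂.le hrs
  have y1 := (radius_bounds hp hp2 hr₁ (by linarith) (by linarith)).2.2
  have y2 := (radius_bounds hp hp2 hs₁ (by linarith) (by linarith)).2.2
  rw [mr₁, ms₂] at x1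
  rw [mr₂, ms₁, show 1 - b - (1 - a) = a - b by ring] at x2
  have x2' : ∫ x, |ind (Metric.ball (0 : ℝ) s₁)ᶜ x - ind (Metric.ball (0 : ℝ) r₂)ᶜ x| *
      Real.exp (x ^ 2 / 4) ∂gamma1 ≤ Real.exp (s₁ ^ 2 / 4) * (a - b) := by
    refine le_trans (le_of_eq ?_) x2
    refine integral_congr_ae (Filter.Eventually.of_forall fun x => ?_)
    simp only [ind_compl]
    rw [abs_sub_comm]
    congr 2
    ring
  have z1 := x1.trans (mul_le_mul_of_nonneg_right y1 hd.le)
  have z2 := x2'.trans (mul_le_mul_of_nonneg_right y2 hd.le)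
  -- Inserting the mixed pair `(ball s₂, complement of ball s₁)`, and using symmetry of the form,
  -- leaves differences of nested sets of mass `a - b`. The remainders therefore differ by a
  -- quantity linear in `a - b`.
  have hid : kernelForm (remKernel ρ) (ind (Metric.ball (0 : ℝ) r₁))
        (ind (Metric.ball (0 : ℝ) s₁)ᶜ) -
      kernelForm (remKernel ρ) (ind (Metric.ball (0 : ℝ) r₂)ᶜ) (ind (Metric.ball (0 : ℝ) s₂)) =
      kernelForm (remKernel ρ) (fun x => ind (Metric.ball (0 : ℝ) r₁) x -
        ind (Metric.ball (0 : ℝ) s₂) x) (ind (Metric.ball (0 : ℝ) s₁)ᶜ) +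
      kernelForm (remKernel ρ) (fun x => ind (Metric.ball (0 : ℝ) s₁)ᶜ x -
        ind (Metric.ball (0 : ℝ) r₂)ᶜ x) (ind (Metric.ball (0 : ℝ) s₂)) := by
    rw [kernelForm_sub_left t u1 u4 u2, kernelForm_sub_left t u2 u3 u4,
      kernelForm_comm (remKernel_comm ρ) (ind (Metric.ball (0 : ℝ) s₂))]
    ring
  rw [kernelForm_mehlerEven_eq hρ' u1 u2, kernelForm_mehlerEven_eq hρ' u3 u4, c1.2.2, c2.2.2,
    c3.2.2, c4.2.2]
  have hρ4 : 0 ≤ 300000 * ρ ^ 4 := by positivity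
  have w1 := (le_abs_self _).trans (rem1.trans (mul_le_mul_of_nonneg_left z1 hρ4))
  have w2 := (le_abs_self _).trans (rem2.trans (mul_le_mul_of_nonneg_left z2 hρ4))
  have hV2 : ρ ^ 2 / 2 * (secondCoeff (ind (Metric.ball (0 : ℝ) r₁)) *
      secondCoeff (ind (Metric.ball (0 : ℝ) s₁)ᶜ)) - ρ ^ 2 / 2 *
      (secondCoeff (ind (Metric.ball (0 : ℝ) r₂)ᶜ) *
      secondCoeff (ind (Metric.ball (0 : ℝ) s₂))) ≤ ρ ^ 2 / 2 * (-(p ^ 3 / 80 * (a - b))) := by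
    rw [← mul_sub]
    exact mul_le_mul_of_nonneg_left hV (by positivity)
  -- The factor `a - b` is common to both sides, so the comparison only needs `ρ²` small relative to
  -- `p⁴`.
  have hsmall : 300000 * ρ ^ 4 * (1 / p * (a - b)) * 2 < ρ ^ 2 / 2 * (p ^ 3 / 80 * (a - b)) := by
    have hρ2 : ρ ^ 2 ≤ 1 / 10 ^ 10 * p ^ 4 := by
      rw [← sq_abs]
      calc |ρ| ^ 2 ≤ (4 / 10 ^ 14 * p ^ 2) ^ 2 := by
            apply pow_le_pow_left₀ (abs_nonneg ρ)
            exact hρ.trans (by gcongr)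
        _ = 16 / 10 ^ 28 * p ^ 4 := by ring
        _ ≤ _ := mul_le_mul_of_nonneg_right (by norm_num) (by positivity)
    calc 300000 * ρ ^ 4 * (1 / p * (a - b)) * 2 = 600000 * ρ ^ 2 * (1 / p * (a - b)) * ρ ^ 2 := by
          ring
      _ ≤ 600000 * ρ ^ 2 * (1 / p * (a - b)) * (1 / 10 ^ 10 * p ^ 4) := by gcongr
      _ = 6 / 10 ^ 5 * (ρ ^ 2 * p ^ 3 * (a - b)) := by field_simp; norm_num
      _ < 1 / 160 * (ρ ^ 2 * p ^ 3 * (a - b)) := by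
          have : 0 < ρ ^ 2 * p ^ 3 * (a - b) := by positivity
          apply mul_lt_mul_of_pos_right _ this
          norm_num
      _ = _ := by ring
  linarith

/-! ### The two centered pairs and the second-order problem. -/

theorem centeredPair_iff {a b : ℝ} {A B : Set ℝ} :
    CenteredPair a b A B ↔ gamma1.real A = a ∧ gamma1.real B = b ∧
      ∃ r > 0, ∃ s > 0, (IsCap 1 r A ∧ IsCap (-1) s B) ∨ (IsCap (-1) r A ∧ IsCap 1 s B) := by
  have h : (-1 : ℝ) ≠ 1 := by norm_num
  simp [CenteredPair, IsCap, h, h.symm]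

theorem IsCap.gamma1_real {σ r : ℝ} {A : Set ℝ} (h : IsCap σ r A) (hr : 0 ≤ r) :
    gamma1.real A = (1 - σ) / 2 + σ * gaussMass r := by
  rcases h with ⟨rfl, rfl⟩ | ⟨rfl, rfl⟩
  · rw [gamma1_real_ball hr]; ring
  · rw [gamma1_real_ball_compl hr]; ring

theorem IsCap.mass_bounds {σ r a p : ℝ} {A : Set ℝ} (h : IsCap σ r A) (hr : 0 ≤ r)
    (hA : gamma1.real A = a) (h1 : p ≤ a) (h2 : a ≤ 1 - p) :
    p ≤ gaussMass r ∧ gaussMass r ≤ 1 - p := by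
  rw [h.gamma1_real hr] at hA
  rcases h with ⟨rfl, -⟩ | ⟨rfl, -⟩ <;> constructor <;> linarith

theorem IsCap.eq_of_measure_eq {σ r r' : ℝ} {A A' : Set ℝ} (h : IsCap σ r A) (h' : IsCap σ r' A')
    (hr : 0 ≤ r) (hr' : 0 ≤ r') (hA : gamma1.real A = gamma1.real A') : A = A' := by
  rw [h.gamma1_real hr, h'.gamma1_real hr'] at hA
  have hrr : r = r' := by
    apply strictMono_gaussMass.injective
    rcases h with ⟨rfl, -⟩ | ⟨rfl, -⟩ <;> linarith
  subst hrr
  rcases h with ⟨h1, rfl⟩ | ⟨h1, rfl⟩ <;> rcases h' with ⟨h2, rfl⟩ | ⟨h2, rfl⟩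
  · rfl
  · exfalso; linarith
  · exfalso; linarith
  · rfl

theorem exists_cap {a : ℝ} (h0 : 0 < a) (h1 : a < 1) {σ : ℝ} (hσ : σ = 1 ∨ σ = -1) :
    ∃ r A, 0 < r ∧ IsCap σ r A ∧ SetClass a A := by
  rcases hσ with rfl | rfl
  · obtain ⟨r, hr, hm⟩ := exists_radius h0 h1
    have hc : IsCap 1 r (Metric.ball (0 : ℝ) r) := Or.inl ⟨rfl, rfl⟩
    exact ⟨r, _, hr, hc, hc.measurableSet, by rw [gamma1_real_ball hr.le, hm]⟩
  · obtain ⟨r, hr, hm⟩ := exists_radius (t := 1 - a) (by linarith) (by linarith)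
    have hc : IsCap (-1) r (Metric.ball (0 : ℝ) r)ᶜ := Or.inr ⟨rfl, rfl⟩
    exact ⟨r, _, hr, hc, hc.measurableSet, by rw [gamma1_real_ball_compl hr.le, hm]; ring⟩

/-- The two centered pairs of measures `a` and `b`. -/
structure CapPairs (a b : ℝ) (A₁ B₁ A₂ B₂ : Set ℝ) (r₁ s₁ r₂ s₂ : ℝ) : Prop where
  r₁_pos : 0 < r₁
  s₁_pos : 0 < s₁
  r₂_pos : 0 < r₂
  s₂_pos : 0 < s₂
  cap_A₁ : IsCap 1 r₁ A₁
  cap_B₁ : IsCap (-1) s₁ B₁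
  cap_A₂ : IsCap (-1) r₂ A₂
  cap_B₂ : IsCap 1 s₂ B₂
  class_A₁ : SetClass a A₁
  class_B₁ : SetClass b B₁
  class_A₂ : SetClass a A₂
  class_B₂ : SetClass b B₂

theorem exists_capPairs {a b : ℝ} (ha0 : 0 < a) (ha1 : a < 1) (hb0 : 0 < b) (hb1 : b < 1) :
    ∃ A₁ B₁ A₂ B₂ r₁ s₁ r₂ s₂, CapPairs a b A₁ B₁ A₂ B₂ r₁ s₁ r₂ s₂ := by
  obtain ⟨r₁, A₁, h1, h2, h3⟩ := exists_cap ha0 ha1 (σ := 1) (Or.inl rfl)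
  obtain ⟨s₁, B₁, h4, h5, h6⟩ := exists_cap hb0 hb1 (σ := -1) (Or.inr rfl)
  obtain ⟨r₂, A₂, h7, h8, h9⟩ := exists_cap ha0 ha1 (σ := -1) (Or.inr rfl)
  obtain ⟨s₂, B₂, h10, h11, h12⟩ := exists_cap hb0 hb1 (σ := 1) (Or.inl rfl)
  exact ⟨A₁, B₁, A₂, B₂, r₁, s₁, r₂, s₂, h1, h4, h7, h10, h2, h5, h8, h11, h3, h6, h9, h12⟩

section CapPairs

variable {a b : ℝ} {A₁ B₁ A₂ B₂ : Set ℝ} {r₁ s₁ r₂ s₂ : ℝ}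

theorem CapPairs.centered_one (h : CapPairs a b A₁ B₁ A₂ B₂ r₁ s₁ r₂ s₂) : CenteredPair a b A₁ B₁ :=
  centeredPair_iff.2 ⟨h.class_A₁.2, h.class_B₁.2, r₁, h.r₁_pos, s₁, h.s₁_pos,
    Or.inl ⟨h.cap_A₁, h.cap_B₁⟩⟩

theorem CapPairs.centered_two (h : CapPairs a b A₁ B₁ A₂ B₂ r₁ s₁ r₂ s₂) : CenteredPair a b A₂ B₂ :=
  centeredPair_iff.2 ⟨h.class_A₂.2, h.class_B₂.2, r₂, h.r₂_pos, s₂, h.s₂_pos,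
    Or.inr ⟨h.cap_A₂, h.cap_B₂⟩⟩

theorem CapPairs.eq_or_eq (h : CapPairs a b A₁ B₁ A₂ B₂ r₁ s₁ r₂ s₂) {A B : Set ℝ}
    (hAB : CenteredPair a b A B) : (A = A₁ ∧ B = B₁) ∨ (A = A₂ ∧ B = B₂) := by
  obtain ⟨hA, hB, r, hr, s, hs, ⟨c1, c2⟩ | ⟨c1, c2⟩⟩ := centeredPair_iff.1 hAB
  · exact Or.inl ⟨c1.eq_of_measure_eq h.cap_A₁ hr.le h.r₁_pos.le (by rw [hA, h.class_A₁.2]),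
      c2.eq_of_measure_eq h.cap_B₁ hs.le h.s₁_pos.le (by rw [hB, h.class_B₁.2])⟩
  · exact Or.inr ⟨c1.eq_of_measure_eq h.cap_A₂ hr.le h.r₂_pos.le (by rw [hA, h.class_A₂.2]),
      c2.eq_of_measure_eq h.cap_B₂ hs.le h.s₂_pos.le (by rw [hB, h.class_B₂.2])⟩

/-- The second-order problem: one of the two centered pairs is optimal. -/
theorem CapPairs.second_order_lower (h : CapPairs a b A₁ B₁ A₂ B₂ r₁ s₁ r₂ s₂) {f g : ℝ → ℝ}
    (hf : FunClass a f) (hg : FunClass b g) :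
    min (secondCoeff (ind A₁) * secondCoeff (ind B₁))
      (secondCoeff (ind A₂) * secondCoeff (ind B₂)) ≤ secondCoeff f * secondCoeff g := by
  have eA1 := h.cap_A₁.excess_nonneg h.r₁_pos h.class_A₁ hf
  have eA2 := h.cap_A₂.excess_nonneg h.r₂_pos h.class_A₂ hf
  have eB1 := h.cap_B₁.excess_nonneg h.s₁_pos h.class_B₁ hg
  have eB2 := h.cap_B₂.excess_nonneg h.s₂_pos h.class_B₂ hg
  have cB1 := h.cap_B₁.secondCoeff_eq h.s₁_pos.le
  have cB2 := h.cap_B₂.secondCoeff_eq h.s₂_pos.le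
  have p2 := mul_pos h.s₁_pos (gpdf_pos s₁)
  have p4 := mul_pos h.s₂_pos (gpdf_pos s₂)
  generalize secondCoeff (ind A₁) = x1 at *
  generalize secondCoeff (ind A₂) = x2 at *
  generalize secondCoeff (ind B₁) = y1 at *
  generalize secondCoeff (ind B₂) = y2 at *
  generalize secondCoeff f = u at *
  generalize secondCoeff g = v at *
  have hy1 : 0 ≤ y1 := by linarith
  have hy2 : y2 ≤ 0 := by linarith
  -- The sign of the coefficient of `f` selects the pair. First `f`, then `g`, is exchanged for the
  -- corresponding cap, each exchange being monotone because the other factor has known sign.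
  rcases le_total u 0 with hu | hu
  · refine (min_le_left _ _).trans ?_
    calc x1 * y1 ≤ u * y1 := mul_le_mul_of_nonneg_right (by linarith) hy1
      _ ≤ u * v := mul_le_mul_of_nonpos_left (by linarith) hu
  · refine (min_le_right _ _).trans ?_
    calc x2 * y2 ≤ u * y2 := mul_le_mul_of_nonpos_right (by linarith) hy2
      _ ≤ u * v := mul_le_mul_of_nonneg_left (by linarith) hu

theorem minimizesSecondOrder_iff {A B : Set ℝ} (hA : SetClass a A) (hB : SetClass b B) :
    MinimizesSecondOrder a b A B ↔ ∀ f g, FunClass a f → FunClass b g →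
      secondCoeff (ind A) * secondCoeff (ind B) ≤ secondCoeff f * secondCoeff g := by
  constructor
  · intro h f g hf hg
    have := h.2 ⟨f, g, hf, hg, rfl⟩
    rw [hermiteCoeff_two_mul, hermiteCoeff_two_mul] at this
    linarith
  · intro h
    refine ⟨⟨_, _, funClass_ind hA, funClass_ind hB, rfl⟩, ?_⟩
    rintro v ⟨f, g, hf, hg, rfl⟩
    rw [hermiteCoeff_two_mul, hermiteCoeff_two_mul]
    have := h f g hf hg
    linarith

theorem CapPairs.minimizes_one_iff (h : CapPairs a b A₁ B₁ A₂ B₂ r₁ s₁ r₂ s₂) :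
    MinimizesSecondOrder a b A₁ B₁ ↔ secondCoeff (ind A₁) * secondCoeff (ind B₁) ≤
      secondCoeff (ind A₂) * secondCoeff (ind B₂) := by
  rw [minimizesSecondOrder_iff h.class_A₁ h.class_B₁]
  refine ⟨fun H => H _ _ (funClass_ind h.class_A₂) (funClass_ind h.class_B₂), fun H f g hf hg => ?_⟩
  have := h.second_order_lower hf hg
  rwa [min_eq_left H] at this

theorem CapPairs.minimizes_two_iff (h : CapPairs a b A₁ B₁ A₂ B₂ r₁ s₁ r₂ s₂) :
    MinimizesSecondOrder a b A₂ B₂ ↔ secondCoeff (ind A₂) * secondCoeff (ind B₂) ≤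
      secondCoeff (ind A₁) * secondCoeff (ind B₁) := by
  rw [minimizesSecondOrder_iff h.class_A₂ h.class_B₂]
  refine ⟨fun H => H _ _ (funClass_ind h.class_A₁) (funClass_ind h.class_B₁), fun H f g hf hg => ?_⟩
  have := h.second_order_lower hf hg
  rwa [min_eq_right H] at this

theorem exists_second_order_minimizer (ha0 : 0 < a) (ha1 : a < 1) (hb0 : 0 < b) (hb1 : b < 1) :
    ∃ A B, CenteredPair a b A B ∧ MinimizesSecondOrder a b A B := by
  obtain ⟨A₁, B₁, A₂, B₂, r₁, s₁, r₂, s₂, h⟩ := exists_capPairs ha0 ha1 hb0 hb1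
  rcases le_total (secondCoeff (ind A₁) * secondCoeff (ind B₁))
    (secondCoeff (ind A₂) * secondCoeff (ind B₂)) with H | H
  · exact ⟨A₁, B₁, h.centered_one, h.minimizes_one_iff.2 H⟩
  · exact ⟨A₂, B₂, h.centered_two, h.minimizes_two_iff.2 H⟩

/-- The noise functional and the second-order product order the two centered pairs alike. -/
theorem CapPairs.compare (h : CapPairs a b A₁ B₁ A₂ B₂ r₁ s₁ r₂ s₂) {ρ p : ℝ} (hp : 0 < p)
    (hp2 : p ≤ 1 / 2) (hρ : |ρ| ≤ 4 / 10 ^ 14 * p ^ 8) (hρ0 : ρ ≠ 0) (ha1 : p ≤ a) (ha2 : a ≤ 1 - p)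
    (hb1 : p ≤ b) (hb2 : b ≤ 1 - p) :
    (secondCoeff (ind A₁) * secondCoeff (ind B₁) ≤ secondCoeff (ind A₂) * secondCoeff (ind B₂) ↔
      kernelForm (mehlerEven ρ) (ind A₁) (ind B₁) ≤ kernelForm (mehlerEven ρ) (ind A₂) (ind B₂)) ∧
    (secondCoeff (ind A₂) * secondCoeff (ind B₂) ≤ secondCoeff (ind A₁) * secondCoeff (ind B₁) ↔
      kernelForm (mehlerEven ρ) (ind A₂) (ind B₂) ≤
        kernelForm (mehlerEven ρ) (ind A₁) (ind B₁)) := by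
  have m1 := h.cap_A₁.gamma1_real h.r₁_pos.le
  have m2 := h.cap_B₁.gamma1_real h.s₁_pos.le
  have m3 := h.cap_A₂.gamma1_real h.r₂_pos.le
  have m4 := h.cap_B₂.gamma1_real h.s₂_pos.le
  rw [h.class_A₁.2] at m1
  rw [h.class_B₁.2] at m2
  rw [h.class_A₂.2] at m3
  rw [h.class_B₂.2] at m4
  rcases lt_trichotomy a b with hab | hab | hab
  -- Exchanging the two members of each pair reduces `a < b` to the opposite order.
  · have H := cap_pairs_compare hp hp2 hρ hρ0 ha1 hab hb2 h.s₂_pos h.r₂_pos h.s₁_pos h.r₁_pos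
      (by linarith) (by linarith) (by linarith) (by linarith)
    rcases h.cap_A₁ with ⟨-, rfl⟩ | ⟨h0, -⟩
    swap
    · norm_num at h0
    rcases h.cap_B₂ with ⟨-, rfl⟩ | ⟨h0, -⟩
    swap
    · norm_num at h0
    rcases h.cap_A₂ with ⟨h0, -⟩ | ⟨-, rfl⟩
    · norm_num at h0
    rcases h.cap_B₁ with ⟨h0, -⟩ | ⟨-, rfl⟩
    · norm_num at h0
    rw [kernelForm_comm (mehlerEven_comm ρ), kernelForm_comm (mehlerEven_comm ρ)
      (ind (Metric.ball (0 : ℝ) s₁)ᶜ)] at H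
    have H1 : secondCoeff (ind (Metric.ball (0 : ℝ) r₂)ᶜ) * secondCoeff (ind (Metric.ball 0 s₂)) <
        secondCoeff (ind (Metric.ball (0 : ℝ) r₁)) * secondCoeff (ind (Metric.ball 0 s₁)ᶜ) := by
      linarith [H.1]
    exact ⟨iff_of_false (not_le.2 H1) (not_le.2 H.2), iff_of_true H1.le H.2.le⟩
  -- For equal masses the two pairs are swaps of one another, and both functionals are symmetric, so
  -- there is a tie on both sides.
  · have e1 : A₁ = B₂ := h.cap_A₁.eq_of_measure_eq h.cap_B₂ h.r₁_pos.le h.s₂_pos.le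
      (by rw [h.class_A₁.2, h.class_B₂.2, hab])
    have e2 : A₂ = B₁ := h.cap_A₂.eq_of_measure_eq h.cap_B₁ h.r₂_pos.le h.s₁_pos.le
      (by rw [h.class_A₂.2, h.class_B₁.2, hab])
    rw [e1, e2, kernelForm_comm (mehlerEven_comm ρ), mul_comm (secondCoeff (ind B₂))]
    simp
  · have H := cap_pairs_compare hp hp2 hρ hρ0 hb1 hab ha2 h.r₁_pos h.s₁_pos h.r₂_pos h.s₂_pos
      (by linarith) (by linarith) (by linarith) (by linarith)
    rcases h.cap_A₁ with ⟨-, rfl⟩ | ⟨h0, -⟩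
    swap
    · norm_num at h0
    rcases h.cap_B₂ with ⟨-, rfl⟩ | ⟨h0, -⟩
    swap
    · norm_num at h0
    rcases h.cap_A₂ with ⟨h0, -⟩ | ⟨-, rfl⟩
    · norm_num at h0
    rcases h.cap_B₁ with ⟨h0, -⟩ | ⟨-, rfl⟩
    · norm_num at h0
    exact ⟨iff_of_true H.1.le H.2.le, iff_of_false (not_le.2 H.1) (not_le.2 H.2)⟩

end CapPairs

/-! ### From local to global optimality. -/

theorem abs_le_of_small {ρ p : ℝ} (hp : 0 < p) (hp2 : p ≤ 1 / 2)
    (hρ : |ρ| ≤ 4 / 10 ^ 14 * p ^ 8) : |ρ| ≤ 1 / 1000 := by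
  have : p ^ 8 ≤ 1 := pow_le_one₀ hp.le (by linarith)
  norm_num at hρ
  linarith

/-- The constant terms `a b` cancel, and the two remainders contribute at most `2 · 450000 ρ⁴`.
Division by `ρ² / 2` gives the tolerance. -/
theorem second_order_gap {ρ a b : ℝ} (h : |ρ| ≤ 1 / 1000) (hρ0 : ρ ≠ 0) {f g f' g' : ℝ → ℝ}
    (hf : FunClass a f) (hg : FunClass b g) (hf' : FunClass a f') (hg' : FunClass b g')
    (hle : kernelForm (mehlerEven ρ) f g ≤ kernelForm (mehlerEven ρ) f' g') :
    secondCoeff f * secondCoeff g ≤ secondCoeff f' * secondCoeff g' + 1800000 * ρ ^ 2 := by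
  rw [kernelForm_mehlerEven_eq h hf.unitBdd hg.unitBdd,
    kernelForm_mehlerEven_eq h hf'.unitBdd hg'.unitBdd, hf.2.2, hg.2.2, hf'.2.2, hg'.2.2] at hle
  have h1 := abs_le.1 (abs_remForm_le' h hf.unitBdd hg.unitBdd)
  have h2 := abs_le.1 (abs_remForm_le' h hf'.unitBdd hg'.unitBdd)
  have hpos : 0 < ρ ^ 2 := by positivity
  have : ρ ^ 2 * (secondCoeff f * secondCoeff g) ≤
      ρ ^ 2 * (secondCoeff f' * secondCoeff g' + 1800000 * ρ ^ 2) := by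
    have e : ρ ^ 2 * (1800000 * ρ ^ 2) = 1800000 * ρ ^ 4 := by ring
    rw [mul_add, e]
    linarith [h1.1, h2.2]
  exact le_of_mul_le_mul_left this hpos

/-- Centered pairs which are optimal to second order minimize the noise functional, uniquely up to
null sets among such pairs. -/
theorem kernelForm_lower {ρ p a b : ℝ} (hp : 0 < p) (hp2 : p ≤ 1 / 2)
    (hρ : |ρ| ≤ 4 / 10 ^ 14 * p ^ 8) (hρ0 : ρ ≠ 0) (ha1 : p ≤ a) (ha2 : a ≤ 1 - p)
    (hb1 : p ≤ b) (hb2 : b ≤ 1 - p) {A B : Set ℝ} (hAB : CenteredPair a b A B)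
    (hmin : MinimizesSecondOrder a b A B) {f g : ℝ → ℝ} (hf : FunClass a f) (hg : FunClass b g) :
    kernelForm (mehlerEven ρ) (ind A) (ind B) ≤ kernelForm (mehlerEven ρ) f g ∧
    (kernelForm (mehlerEven ρ) f g = kernelForm (mehlerEven ρ) (ind A) (ind B) →
      ∃ A' B', CenteredPair a b A' B' ∧ MinimizesSecondOrder a b A' B' ∧
        f =ᵐ[gamma1] ind A' ∧ g =ᵐ[gamma1] ind B') := by
  obtain ⟨A₁, B₁, A₂, B₂, r₁, s₁, r₂, s₂, h⟩ :=
    exists_capPairs (a := a) (b := b) (by linarith) (by linarith) (by linarith) (by linarith)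
  have hρ' := abs_le_of_small hp hp2 hρ
  obtain ⟨cmp1, cmp2⟩ := h.compare hp hp2 hρ hρ0 ha1 ha2 hb1 hb2
  have hclass : SetClass a A ∧ SetClass b B ∧
      kernelForm (mehlerEven ρ) (ind A) (ind B) ≤ kernelForm (mehlerEven ρ) (ind A₁) (ind B₁) ∧
      kernelForm (mehlerEven ρ) (ind A) (ind B) ≤ kernelForm (mehlerEven ρ) (ind A₂) (ind B₂) := by
    rcases h.eq_or_eq hAB with ⟨rfl, rfl⟩ | ⟨rfl, rfl⟩
    · exact ⟨h.class_A₁, h.class_B₁, le_rfl, cmp1.1 (h.minimizes_one_iff.1 hmin)⟩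
    · exact ⟨h.class_A₂, h.class_B₂, cmp2.1 (h.minimizes_two_iff.1 hmin), le_rfl⟩
  obtain ⟨hA, hB, hle1, hle2⟩ := hclass
  rcases lt_or_ge (kernelForm (mehlerEven ρ) (ind A) (ind B)) (kernelForm (mehlerEven ρ) f g)
    with hlt | hge
  · exact ⟨hlt.le, fun heq => absurd heq hlt.ne'⟩
  have hgap := second_order_gap hρ' hρ0 hf hg (funClass_ind hA) (funClass_ind hB) hge
  have hmin' := (minimizesSecondOrder_iff hA hB).1 hmin
  -- The competitor is compared with the centered pair on its own side, which need not be the given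
  -- optimal one. That the given pair does no worse than either was obtained from
  -- `CapPairs.compare`.
  rcases le_total (secondCoeff f) 0 with hside | hside
  · have hV := hmin' _ _ (funClass_ind h.class_A₁) (funClass_ind h.class_B₁)
    have b1 := h.cap_A₁.mass_bounds h.r₁_pos.le h.class_A₁.2 ha1 ha2
    have b2 := h.cap_B₁.mass_bounds h.s₁_pos.le h.class_B₁.2 hb1 hb2
    have main := cap_pair_optimal hp hp2 hρ hρ0 h.r₁_pos h.s₁_pos b1.1 b1.2 b2.1 b2.2 h.cap_A₁
      h.cap_B₁ h.class_A₁ h.class_B₁ hf hg (by linarith) (by linarith)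
    have hF : kernelForm (mehlerEven ρ) (ind A₁) (ind B₁) ≤ kernelForm (mehlerEven ρ) f g := by
      linarith [main.1]
    refine ⟨hle1.trans hF, fun heq => ?_⟩
    -- Equality pinches: this pair has the same noise as the optimal one, so it is itself optimal to
    -- second order by the comparison equivalence.
    obtain ⟨e1, e2⟩ := main.2 (by linarith)
    exact ⟨A₁, B₁, h.centered_one, h.minimizes_one_iff.2 (cmp1.2 (by linarith)), e1, e2⟩
  · have hV := hmin' _ _ (funClass_ind h.class_A₂) (funClass_ind h.class_B₂)
    have b1 := h.cap_A₂.mass_bounds h.r₂_pos.le h.class_A₂.2 ha1 ha2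
    have b2 := h.cap_B₂.mass_bounds h.s₂_pos.le h.class_B₂.2 hb1 hb2
    have main := cap_pair_optimal hp hp2 hρ hρ0 h.r₂_pos h.s₂_pos b1.1 b1.2 b2.1 b2.2 h.cap_A₂
      h.cap_B₂ h.class_A₂ h.class_B₂ hf hg (by linarith) (by linarith)
    have hF : kernelForm (mehlerEven ρ) (ind A₂) (ind B₂) ≤ kernelForm (mehlerEven ρ) f g := by
      linarith [main.1]
    refine ⟨hle2.trans hF, fun heq => ?_⟩
    obtain ⟨e1, e2⟩ := main.2 (by linarith)
    exact ⟨A₂, B₂, h.centered_two, h.minimizes_two_iff.2 (cmp2.2 (by linarith)), e1, e2⟩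

/-- Among functions of given integral, one of the two caps maximizes the quadratic functional. -/
theorem kernelForm_diag_upper {ρ p a : ℝ} (hp : 0 < p) (hp2 : p ≤ 1 / 2)
    (hρ : |ρ| ≤ 4 / 10 ^ 14 * p ^ 8) (hρ0 : ρ ≠ 0) (ha1 : p ≤ a) (ha2 : a ≤ 1 - p)
    {r₁ r₂ : ℝ} {A₁ A₂ : Set ℝ} (hr₁ : 0 < r₁) (hr₂ : 0 < r₂) (c₁ : IsCap 1 r₁ A₁)
    (c₂ : IsCap (-1) r₂ A₂) (h₁ : SetClass a A₁) (h₂ : SetClass a A₂) {f : ℝ → ℝ}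
    (hf : FunClass a f) :
    kernelForm (mehlerEven ρ) f f ≤ max (kernelForm (mehlerEven ρ) (ind A₁) (ind A₁))
      (kernelForm (mehlerEven ρ) (ind A₂) (ind A₂)) := by
  have hρ' := abs_le_of_small hp hp2 hρ
  by_contra hcon
  push Not at hcon
  obtain ⟨l1, l2⟩ := max_lt_iff.1 hcon
  have g1 := second_order_gap hρ' hρ0 (funClass_ind h₁) (funClass_ind h₁) hf hf l1.le
  have g2 := second_order_gap hρ' hρ0 (funClass_ind h₂) (funClass_ind h₂) hf hf l2.le
  -- Two caps of equal type have `σ τ = 1`, so `cap_pair_optimal` now gives a maximum, contradicting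
  -- the strict improvement.
  rcases le_total (secondCoeff f) 0 with hside | hside
  · have b1 := c₁.mass_bounds hr₁.le h₁.2 ha1 ha2
    have main := cap_pair_optimal hp hp2 hρ hρ0 hr₁ hr₁ b1.1 b1.2 b1.1 b1.2 c₁ c₁ h₁ h₁ hf hf
      (by linarith) (by linarith)
    linarith [main.1]
  · have b1 := c₂.mass_bounds hr₂.le h₂.2 ha1 ha2
    have main := cap_pair_optimal hp hp2 hρ hρ0 hr₂ hr₂ b1.1 b1.2 b1.1 b1.2 c₂ c₂ h₂ h₂ hf hf
      (by linarith) (by linarith)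
    linarith [main.1]

theorem ind_neg {A : Set ℝ} (h : ∀ x, -x ∈ A ↔ x ∈ A) (x : ℝ) : ind A (-x) = ind A x := by
  by_cases hx : x ∈ A
  · simp [ind, hx, (h x).2 hx]
  · simp [ind, hx, mt (h x).1 hx]

theorem ind_ae_eq_iff {A B : Set ℝ} : ind A =ᵐ[gamma1] ind B ↔ A =ᵐ[gamma1] B := by
  have key : ∀ x, ind A x = ind B x ↔ (x ∈ A ↔ x ∈ B) := by
    intro x
    by_cases hA : x ∈ A <;> by_cases hB : x ∈ B <;> simp [ind, hA, hB]
  exact (Filter.eventually_congr (.of_forall key)).trans Filter.eventuallyEq_set.symm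

theorem CenteredPair.admissible {ρ a b : ℝ} {A B : Set ℝ} (h : CenteredPair a b A B) :
    AdmissibleSets ρ a b A B := by
  obtain ⟨hA, hB, r, -, s, -, ⟨c1, c2⟩ | ⟨c1, c2⟩⟩ := centeredPair_iff.1 h <;>
  exact ⟨⟨c1.measurableSet, hA⟩, ⟨c2.measurableSet, hB⟩, c1.neg_mem_iff, fun _ => c2.neg_mem_iff⟩

theorem AdmissibleSets.noise_eq {ρ a b : ℝ} (h : |ρ| ≤ 1 / 1000) {A B : Set ℝ}
    (hAB : AdmissibleSets ρ a b A B) :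
    noise ρ (ind A) (ind B) = kernelForm (mehlerEven ρ) (ind A) (ind B) :=
  noise_eq_kernelForm h (unitBdd_ind hAB.1.1) (unitBdd_ind hAB.2.1.1) (ind_neg hAB.2.2.1)

theorem AdmissibleFuns.noise_eq {ρ a b : ℝ} (h : |ρ| ≤ 1 / 1000) {f g : ℝ → ℝ}
    (hfg : AdmissibleFuns ρ a b f g) : noise ρ f g = kernelForm (mehlerEven ρ) f g :=
  noise_eq_kernelForm h hfg.1.unitBdd hfg.2.1.unitBdd hfg.2.2.1

theorem AdmissibleSets.admissibleFuns {ρ a b : ℝ} {A B : Set ℝ} (h : AdmissibleSets ρ a b A B) :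
    AdmissibleFuns ρ a b (ind A) (ind B) :=
  ⟨funClass_ind h.1, funClass_ind h.2.1, ind_neg h.2.2.1, fun hρ => ind_neg (h.2.2.2 hρ)⟩

/-- The remainder bound vanishes at `ρ = 0`, so the form is constant on each class of fixed masses
and every competitor is optimal. -/
theorem kernelForm_zero_corr {a b : ℝ} {f g : ℝ → ℝ} (hf : FunClass a f) (hg : FunClass b g) :
    kernelForm (mehlerEven 0) f g = a * b := by
  have h : |(0 : ℝ)| ≤ 1 / 1000 := by norm_num
  have h1 := abs_remForm_le' h hf.unitBdd hg.unitBdd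
  rw [kernelForm_mehlerEven_eq h hf.unitBdd hg.unitBdd, hf.2.2, hg.2.2]
  norm_num at h1 ⊢
  exact h1

/-- A centered pair optimal to second order exists and attains the relaxed minimum. Any other
minimizer therefore ties with it, and the equality case of `kernelForm_lower` applies. Conversely,
the form does not see null sets. -/
theorem minimizes_iff {ρ p a b : ℝ} (hp : 0 < p) (hp2 : p ≤ 1 / 2)
    (hρ : |ρ| ≤ 4 / 10 ^ 14 * p ^ 8) (hρ0 : ρ ≠ 0) (ha1 : p ≤ a) (ha2 : a ≤ 1 - p)
    (hb1 : p ≤ b) (hb2 : b ≤ 1 - p) {A' B' : Set ℝ} (hA' : AdmissibleSets ρ a b A' B') :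
    MinimizesOverFuns ρ a b A' B' ↔ ∃ A B, CenteredPair a b A B ∧ MinimizesSecondOrder a b A B ∧
      A' =ᵐ[gamma1] A ∧ B' =ᵐ[gamma1] B := by
  have hρ' := abs_le_of_small hp hp2 hρ
  constructor
  · rintro ⟨-, -, hlow⟩
    obtain ⟨A, B, hAB, hmin⟩ := exists_second_order_minimizer (a := a) (b := b) (by linarith)
      (by linarith) (by linarith) (by linarith)
    obtain ⟨h1, h2⟩ := kernelForm_lower hp hp2 hρ hρ0 ha1 ha2 hb1 hb2 hAB hmin
      hA'.admissibleFuns.1 hA'.admissibleFuns.2.1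
    have h3 := hlow ⟨_, _, (hAB.admissible (ρ := ρ)).admissibleFuns, rfl⟩
    rw [hA'.noise_eq hρ', hAB.admissible.noise_eq hρ'] at h3
    obtain ⟨A₀, B₀, hc, hm, e1, e2⟩ := h2 (le_antisymm h3 h1)
    exact ⟨A₀, B₀, hc, hm, ind_ae_eq_iff.1 e1, ind_ae_eq_iff.1 e2⟩
  · rintro ⟨A, B, hAB, hmin, e1, e2⟩
    refine ⟨hA', ⟨_, _, hA'.admissibleFuns, rfl⟩, ?_⟩
    rintro v ⟨f, g, hfg, rfl⟩
    rw [hA'.noise_eq hρ', hfg.noise_eq hρ',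
      kernelForm_congr_ae _ (ind_ae_eq_iff.2 e1) (ind_ae_eq_iff.2 e2)]
    exact (kernelForm_lower hp hp2 hρ hρ0 ha1 ha2 hb1 hb2 hAB hmin hfg.1 hfg.2.1).1

theorem symmetricGaussianProblem {ρ p a b : ℝ} (hp : 0 < p) (hp2 : p ≤ 1 / 2)
    (hρ : |ρ| ≤ 4 / 10 ^ 14 * p ^ 8) (ha1 : p ≤ a) (ha2 : a ≤ 1 - p)
    (hb1 : p ≤ b) (hb2 : b ≤ 1 - p) : SymmetricGaussianProblem ρ a b := by
  have hρ' := abs_le_of_small hp hp2 hρ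
  obtain ⟨A, B, hAB, hmin⟩ := exists_second_order_minimizer (a := a) (b := b) (by linarith)
    (by linarith) (by linarith) (by linarith)
  refine ⟨A, B, hAB, hAB.admissible, ⟨A, B, hAB.admissible, rfl⟩, ?_⟩
  rintro v ⟨A', B', hA', rfl⟩
  rw [hA'.noise_eq hρ', (hAB.admissible (ρ := ρ)).noise_eq hρ']
  rcases eq_or_ne ρ 0 with rfl | hρ0
  · have hadm := hAB.admissible (ρ := 0)
    rw [kernelForm_zero_corr (funClass_ind hadm.1) (funClass_ind hadm.2.1),
      kernelForm_zero_corr (funClass_ind hA'.1) (funClass_ind hA'.2.1)]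
  · exact (kernelForm_lower hp hp2 hρ hρ0 ha1 ha2 hb1 hb2 hAB hmin (funClass_ind hA'.1)
      (funClass_ind hA'.2.1)).1

theorem quadraticSymmetricGaussianProblem {ρ p a : ℝ} (hp : 0 < p) (hp2 : p ≤ 1 / 2)
    (hρ : |ρ| ≤ 4 / 10 ^ 14 * p ^ 8) (ha1 : p ≤ a) (ha2 : a ≤ 1 - p) :
    QuadraticSymmetricGaussianProblem ρ a := by
  have hρ' := abs_le_of_small hp hp2 hρ
  obtain ⟨r₁, A₁, hr₁, c₁, h₁⟩ := exists_cap (a := a) (by linarith) (by linarith) (Or.inl rfl)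
  obtain ⟨r₂, A₂, hr₂, c₂, h₂⟩ := exists_cap (a := a) (by linarith) (by linarith) (Or.inr rfl)
  have heq : ∀ A, SetClass a A → (∀ x, -x ∈ A ↔ x ∈ A) →
      noise ρ (ind A) (ind A) = kernelForm (mehlerEven ρ) (ind A) (ind A) := fun A hA hs =>
    noise_eq_kernelForm hρ' (unitBdd_ind hA.1) (unitBdd_ind hA.1) (ind_neg hs)
  have key : ∀ A, SetClass a A → (∀ x, -x ∈ A ↔ x ∈ A) →
      (∀ A', SetClass a A' → kernelForm (mehlerEven ρ) (ind A') (ind A') ≤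
        kernelForm (mehlerEven ρ) (ind A) (ind A)) →
      IsGreatest {v | ∃ A', SetClass a A' ∧ (∀ x, -x ∈ A' ↔ x ∈ A') ∧
        v = noise ρ (ind A') (ind A')} (noise ρ (ind A) (ind A)) := by
    intro A hA hs hmax
    refine ⟨⟨A, hA, hs, rfl⟩, ?_⟩
    rintro v ⟨A', hA', hs', rfl⟩
    rw [heq A hA hs, heq A' hA' hs']
    exact hmax A' hA'
  have hcap : ∀ σ r A, IsCap σ r A → A = Metric.ball (0 : ℝ) r ∨ A = (Metric.ball (0 : ℝ) r)ᶜ := by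
    rintro σ r A (⟨-, h⟩ | ⟨-, h⟩)
    · exact Or.inl h
    · exact Or.inr h
  have hupper : ∀ A', SetClass a A' → kernelForm (mehlerEven ρ) (ind A') (ind A') ≤
      max (kernelForm (mehlerEven ρ) (ind A₁) (ind A₁))
        (kernelForm (mehlerEven ρ) (ind A₂) (ind A₂)) := by
    intro A' hA'
    rcases eq_or_ne ρ 0 with rfl | hρ0
    · rw [kernelForm_zero_corr (funClass_ind hA') (funClass_ind hA'),
        kernelForm_zero_corr (funClass_ind h₁) (funClass_ind h₁)]
      exact le_max_left _ _
    · exact kernelForm_diag_upper hp hp2 hρ hρ0 ha1 ha2 hr₁ hr₂ c₁ c₂ h₁ h₂ (funClass_ind hA')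
  rcases le_total (kernelForm (mehlerEven ρ) (ind A₁) (ind A₁))
    (kernelForm (mehlerEven ρ) (ind A₂) (ind A₂)) with hle | hle
  · rw [max_eq_right hle] at hupper
    exact ⟨A₂, h₂.2, ⟨r₂, hr₂, hcap _ _ _ c₂⟩, key A₂ h₂ c₂.neg_mem_iff hupper⟩
  · rw [max_eq_left hle] at hupper
    exact ⟨A₁, h₁.2, ⟨r₁, hr₁, hcap _ _ _ c₁⟩, key A₁ h₁ c₁.neg_mem_iff hupper⟩

/-! ### Numerical form of the smallness hypothesis and conclusion. -/

theorem exp_neg_twenty_four : Real.exp (-24) ≤ 4 / 10 ^ 11 := by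
  have h1 := Real.exp_one_gt_d9
  have h2 : Real.exp 24 = Real.exp 1 ^ 24 := by
    rw [← Real.exp_nat_mul]; norm_num
  have h4 : (2718 / 1000 : ℝ) ^ 24 ≤ Real.exp 1 ^ 24 :=
    pow_le_pow_left₀ (by norm_num) (by norm_num at *; linarith) 24
  rw [Real.exp_neg, inv_le_comm₀ (Real.exp_pos _) (by norm_num), h2]
  refine le_trans ?_ h4
  norm_num

/-- Interpolation between the two bounds for `x = 1000 |ρ|`: `x = x^(3/5) x^(2/5) ≤ exp (-24) p⁸`.
Fifth powers avoid fractional exponents. -/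
theorem corr_bound {ρ p : ℝ} (hp : 0 < p) (h : |ρ| < min (Real.exp (-40)) (p ^ 20) / 1000) :
    |ρ| ≤ 4 / 10 ^ 14 * p ^ 8 := by
  set x := 1000 * |ρ| with hx
  have h1 : x ≤ Real.exp (-40) := by
    have := min_le_left (Real.exp (-40)) (p ^ 20)
    linarith
  have h2 : x ≤ p ^ 20 := by
    have := min_le_right (Real.exp (-40)) (p ^ 20)
    linarith
  have h3 : x ^ 5 ≤ (Real.exp (-24) * p ^ 8) ^ 5 := by
    calc x ^ 5 = x ^ 3 * x ^ 2 := by ring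
      _ ≤ Real.exp (-40) ^ 3 * (p ^ 20) ^ 2 := by gcongr
      _ = Real.exp (-24) ^ 5 * p ^ 40 := by
        rw [← Real.exp_nat_mul, ← Real.exp_nat_mul]
        norm_num
        ring
      _ = _ := by ring
  have h4 : x ≤ Real.exp (-24) * p ^ 8 := le_of_pow_le_pow_left₀ (by norm_num) (by positivity) h3
  have h5 : Real.exp (-24) * p ^ 8 ≤ 4 / 10 ^ 11 * p ^ 8 := by
    have := exp_neg_twenty_four
    gcongr
  have : 4 / 10 ^ 11 * p ^ 8 = 1000 * (4 / 10 ^ 14 * p ^ 8) := by ring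
  linarith

theorem min_pow_twenty {x y : ℝ} (hx : 0 ≤ x) (hy : 0 ≤ y) :
    min (x ^ 20) (y ^ 20) = min x y ^ 20 := by
  rcases le_total x y with h | h
  · rw [min_eq_left h, min_eq_left (pow_le_pow_left₀ hx h 20)]
  · rw [min_eq_right h, min_eq_right (pow_le_pow_left₀ hy h 20)]

theorem min_one_sub_le (a : ℝ) : min a (1 - a) ≤ 1 / 2 := by
  rcases le_total a (1 / 2) with h | h
  · exact (min_le_left _ _).trans h
  · exact (min_le_right _ _).trans (by linarith)

end

end SymmNoise

theorem theorem1p5 :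
    (∀ a b ρ : ℝ, 0 < a → a < 1 → 0 < b → b < 1 →
      |ρ| < min (Real.exp (-40))
        (min (min (a ^ 20) ((1 - a) ^ 20)) (min (b ^ 20) ((1 - b) ^ 20))) / 1000 →
      SymmNoise.SymmetricGaussianProblem ρ a b ∧
      (∃ A B, SymmNoise.CenteredPair a b A B ∧ SymmNoise.MinimizesSecondOrder a b A B) ∧
      (ρ ≠ 0 → ∀ A' B' : Set ℝ, SymmNoise.AdmissibleSets ρ a b A' B' →
        (SymmNoise.MinimizesOverFuns ρ a b A' B' ↔
          ∃ A B, SymmNoise.CenteredPair a b A B ∧ SymmNoise.MinimizesSecondOrder a b A B ∧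
            A' =ᵐ[SymmNoise.gamma1] A ∧ B' =ᵐ[SymmNoise.gamma1] B))) ∧
    (∀ a ρ : ℝ, 0 < a → a < 1 →
      |ρ| < min (Real.exp (-40)) (min (a ^ 20) ((1 - a) ^ 20)) / 1000 →
      SymmNoise.QuadraticSymmetricGaussianProblem ρ a) := by
  constructor
  · intro a b ρ ha0 ha1 hb0 hb1 hρ
    have pa : 0 < min a (1 - a) := lt_min ha0 (by linarith)
    have pb : 0 < min b (1 - b) := lt_min hb0 (by linarith)
    rw [SymmNoise.min_pow_twenty ha0.le (by linarith), SymmNoise.min_pow_twenty hb0.le (by linarith),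
      SymmNoise.min_pow_twenty pa.le pb.le] at hρ
    -- A single parameter bounds both masses and both complementary masses from below, and its
    -- twentieth power is the minimum in the hypothesis.
    set p := min (min a (1 - a)) (min b (1 - b)) with hp
    have hp0 : 0 < p := lt_min pa pb
    have h1 : p ≤ min a (1 - a) := min_le_left _ _
    have h2 : p ≤ min b (1 - b) := min_le_right _ _
    have hp2 : p ≤ 1 / 2 := h1.trans (SymmNoise.min_one_sub_le a)
    have a1 : p ≤ a := h1.trans (min_le_left _ _)
    have a2 : a ≤ 1 - p := by linarith [h1.trans (min_le_right _ _)]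
    have b1 : p ≤ b := h2.trans (min_le_left _ _)
    have b2 : b ≤ 1 - p := by linarith [h2.trans (min_le_right _ _)]
    have hρp := SymmNoise.corr_bound hp0 hρ
    exact ⟨SymmNoise.symmetricGaussianProblem hp0 hp2 hρp a1 a2 b1 b2,
      SymmNoise.exists_second_order_minimizer ha0 ha1 hb0 hb1,
      fun hρ0 A' B' hA' => SymmNoise.minimizes_iff hp0 hp2 hρp hρ0 a1 a2 b1 b2 hA'⟩
  · intro a ρ ha0 ha1 hρ
    have pa : 0 < min a (1 - a) := lt_min ha0 (by linarith)
    rw [SymmNoise.min_pow_twenty ha0.le (by linarith)] at hρ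
    exact SymmNoise.quadraticSymmetricGaussianProblem pa (SymmNoise.min_one_sub_le a)
      (SymmNoise.corr_bound pa hρ) (min_le_left _ _) (by linarith [min_le_right a (1 - a)])
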